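/- **Setting.** Let $d,n\ge 1$, $1<p\le\infty$, $\tfrac1p+\tfrac1q=1$. Let $\mathcal C\subset\mathbb R^d$ be compact and convex with $0\in\mathcal C$ and $\ell_p$-diameter $D$; let $f:\mathcal C\times\mathcal X\to\mathbb R$ be differentiable in its first argument (measurable and $P$-integrable in the second), and $F(\theta)=\mathbb E_{x\sim P}f(\theta,x)$. Assume for all $\theta,\theta'\in\mathcal C$, $x\in\mathcal X$: $F(\theta)\ge F(\theta')+\langle\nabla F(\theta'),\theta-\theta'\rangle+\frac\mu2\|\theta-\theta'\|_p^2$ with $\mu>0$; $\|\nabla f(\theta,x)-\nabla f(\theta',x)\|_q\le\beta\|\theta-\theta'\|_p$; $\|\nabla f(\theta,x)-\nabla F(\theta)\|_q\le G$; $\|\nabla f(\theta,x)\|_q\le L$; and that a minimizer $\theta^*$ of $F$ over $\mathcal C$ lies in the interior of $\mathcal C$, with $\gamma=\inf_{v\in\partial\mathcal C}\|v-\theta^*\|_p>0$. **Regular norms.** A norm $N$ is $k$-smooth if $N^2$ is $C^1$ and $N(x+y)^2\le N(x)^2+\langle\nabla N^2(x),y\rangle+kN(y)^2$. The norm $\|\cdot\|_q$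 is $\kappa$-regular with associated norm $N$ if for some $1\le\kappa_+\le\kappa$ the norm $N$ is $\kappa_+$-smooth and $\|x\|_q^2\le N(x)^2\le\frac{\kappa}{\kappa_+}\|x\|_q^2$. For $\sigma_+>0$ let $\mathcal G_N(0,\sigma_+^2)$ be the probability distribution on $\mathbb R^d$ with density proportional to $\exp(-N(z)^2/(2\sigma_+^2))$. **Algorithm (DP-TOFW).** Let $x_1,\dots,x_n$ be i.i.d. from $P$. Put $\theta_0=\theta_1=0$, and for $t=1,\dots,n$ let $g_t=(t+1)\nabla f(\theta_t,x_t)-t\nabla f(\theta_{t-1},x_t)$, $d_t=\frac1{t+1}\tilde G_t$, $v_t\in\arg\min_{v\in\mathcal C}\langle d_t,v\rangle$ (chosen by a fixed measurable rule), $\theta_{t+1}=\theta_t+\frac1{t+1}(v_t-\theta_t)$. Here $\tilde G_t$ is the noisy partial sum of $g_1,\dots,g_t$ released by the binary tree mechanism: the tree has $2^{\lceil\log_2n\rceil}$ leaves, the node of height $\ell$ and index $k\ge 0$ stores $\sum_{i=k2^\ell+1}^{(k+1)2^\ell}g_i$ plus a noise vector, the noise vectors are i.i.d. from $\mathcal G_N(0,\sigma_+^2)$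 and independent of the samples, and $\tilde G_t$ is the sum of the nodes given by the binary expansion of $t$ (one node of height $\ell$ for each binary digit $1$ of $t$ at position $\ell$, the blocks of these nodes partitioning $\{1,\dots,t\}$). **Theorem.** (a) $\|\cdot\|_q$ is $\kappa_q$-regular with associated norm $\|\cdot\|_{q,+}$, where: if $p>2$, $\kappa_q=d^{1-2/p}$ and $\|\cdot\|_{q,+}=d^{1/2-1/p}\|\cdot\|_2$; if $1<p\le2$, $\kappa_q=e^2(\log d-1)$ and $\|\cdot\|_{q,+}=\|\cdot\|_{\log d}$ when $\log d\ge2$ and $e^2(\log d-1)<q-1$, and $\kappa_q=q-1$, $\|\cdot\|_{q,+}=\|\cdot\|_q$ otherwise. (b) There is a universal constant $c>0$ such that, whenever $\|\cdot\|_q$ is $\kappa$-regular with associated norm $N$ (in particular for $\kappa=\kappa_q$, $N=\|\cdot\|_{q,+}$), for all $\sigma_+>0$ and $\alpha\in(0,1)$, with probability at least $1-\alpha$, simultaneously for all $t\in\{1,\dots,n\}$, $$F(\theta_t)-F(\theta^*)\le c\left[\frac1{\gamma^2\mu}\frac{D^2(\beta D+G)^2\big(\kappa+\log(n/\alpha)\big)}{t}+\frac1{\gamma^2\mu}\frac{\big(\beta^2D^4+dD^2\sigma_+^2\log(n\log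 n/\alpha)\log^2n\big)\log n}{t^2}\right]$$ (for $n=1$ the second term is $0$). (c) Let $1<p\le2$, and let the noise be $\mathcal G_{\|\cdot\|_{q,+}}(0,\sigma_+^2)$ with $\sigma_+^2=8(\lceil\log_2n\rceil+1)^2\kappa_q\log\big((\lceil\log_2n\rceil+1)/\delta\big)(\beta D+L)^2/\varepsilon^2$. There is a constant $c$ depending only on $p,D,\mu,\beta,G,L,\gamma$ such that for all $d,n\ge1$, $\varepsilon>0$ and $\delta,\alpha\in(0,1)$, with probability at least $1-\alpha$, for all $t\in\{1,\dots,n\}$, $$F(\theta_t)-F(\theta^*)\le c\left[\frac{1+\log(n/\alpha)}{t}+\frac{d\,\big(1+\log\frac{n}{\alpha\delta}\big)^7}{t^2\varepsilon^2}\right],$$ that is, the rate is $\tilde O\big(\frac1t+\frac{d}{t^2\varepsilon^2}\big)$. -/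

import Mathlib

open MeasureTheory ProbabilityTheory
open scoped ENNReal

noncomputable section

/-- The `ℓ_p` norm of a vector of `ℝ^d` (`p ∈ [1, ∞]`). -/
def ellNorm {d : ℕ} (p : ℝ≥0∞) (x : Fin d → ℝ) : ℝ := ‖WithLp.toLp p x‖

/-- `q = p / (p - 1)` with `1/p + 1/q = 1`; in particular `q = 1` for `p = ∞`. -/
def dualExp (p : ℝ≥0∞) : ℝ≥0∞ := ENNReal.conjExponent p

/-- The gradient (vector of coordinates of the derivative) at `θ` of a function `φ` on `C`. For a
convex set `C` with nonempty interior the derivative relative to `C` is unique on all of `C`. -/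
def gradOn {d : ℕ} (C : Set (Fin d → ℝ)) (φ : (Fin d → ℝ) → ℝ) (θ : Fin d → ℝ) : Fin d → ℝ :=
  fun i => fderivWithin ℝ φ C θ (Pi.single i 1)

/-- The population loss `F(θ) = E_{x ∼ P} f(θ, x)`. -/
def populationLoss {d : ℕ} {X : Type*} [MeasurableSpace X] (P : Measure X)
    (f : (Fin d → ℝ) → X → ℝ) (θ : Fin d → ℝ) : ℝ := ∫ x, f θ x ∂P

/-- The stochastic convex optimization problem in the `ℓ_p` setup: loss `f` over the parameter set
`C`, data distribution `P`, and `θs` the minimizer of `F` in the interior of `C`. -/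
structure StronglyConvexSCO {d : ℕ} {X : Type*} [MeasurableSpace X] (p : ℝ≥0∞)
    (C : Set (Fin d → ℝ)) (P : Measure X) (f : (Fin d → ℝ) → X → ℝ) (θs : Fin d → ℝ)
    (D μ β G L γ : ℝ) : Prop where
  isCompact : IsCompact C
  convex : Convex ℝ C
  zero_mem : (0 : Fin d → ℝ) ∈ C
  /-- `D` is the `ℓ_p` diameter of `C`. -/
  diam : IsLUB {r : ℝ | ∃ x ∈ C, ∃ y ∈ C, r = ellNorm p (x - y)} D
  measurable : ∀ θ ∈ C, Measurable (f θ)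
  integrable : ∀ θ ∈ C, Integrable (f θ) P
  differentiable : ∀ x, DifferentiableOn ℝ (fun θ => f θ x) C
  /-- Strong convexity of the population loss. -/
  mu_pos : 0 < μ
  strongly_convex : ∀ θ₁ ∈ C, ∀ θ₂ ∈ C,
    populationLoss P f θ₂ + gradOn C (populationLoss P f) θ₂ ⬝ᵥ (θ₁ - θ₂)
      + μ / 2 * ellNorm p (θ₁ - θ₂) ^ 2 ≤ populationLoss P f θ₁
  /-- Smoothness of the loss. -/
  smooth : ∀ θ₁ ∈ C, ∀ θ₂ ∈ C, ∀ x,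
    ellNorm (dualExp p) (gradOn C (fun θ => f θ x) θ₁ - gradOn C (fun θ => f θ x) θ₂)
      ≤ β * ellNorm p (θ₁ - θ₂)
  /-- Bounded deviation of the stochastic gradient. -/
  grad_bound : ∀ θ ∈ C, ∀ x,
    ellNorm (dualExp p) (gradOn C (fun θ => f θ x) θ - gradOn C (populationLoss P f) θ) ≤ G
  /-- Lipschitz loss. -/
  lipschitz : ∀ θ ∈ C, ∀ x, ellNorm (dualExp p) (gradOn C (fun θ => f θ x) θ) ≤ L
  /-- The minimizer is interior, at `ℓ_p` distance `γ > 0` from the boundary. -/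
  minimizer : IsMinOn (populationLoss P f) C θs
  mem_interior : θs ∈ interior C
  gamma_pos : 0 < γ
  boundary_dist : IsGLB {r : ℝ | ∃ v ∈ frontier C, r = ellNorm p (v - θs)} γ

/-- `N` is a norm on `ℝ^d`. -/
structure IsNormOn {d : ℕ} (N : (Fin d → ℝ) → ℝ) : Prop where
  add_le : ∀ x y, N (x + y) ≤ N x + N y
  smul_eq : ∀ (a : ℝ) x, N (a • x) = |a| * N x
  eq_zero : ∀ x, N x = 0 → x = 0

/-- A norm is `κ`-smooth if its square is `C¹` and
`N(x + y)² ≤ N(x)² + ⟨∇(N²)(x), y⟩ + κ N(y)²`. -/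
def IsSmoothNorm {d : ℕ} (N : (Fin d → ℝ) → ℝ) (κ : ℝ) : Prop :=
  ContDiff ℝ 1 (fun x => N x ^ 2) ∧
    ∀ x y, N (x + y) ^ 2 ≤ N x ^ 2 + fderiv ℝ (fun x => N x ^ 2) x y + κ * N y ^ 2

/-- The norm `nrm` is `κ`-regular with associated smooth norm `N`. -/
def IsRegularNorm {d : ℕ} (nrm N : (Fin d → ℝ) → ℝ) (κ : ℝ) : Prop :=
  IsNormOn nrm ∧ IsNormOn N ∧ ∃ κp : ℝ, 1 ≤ κp ∧ κp ≤ κ ∧ IsSmoothNorm N κp ∧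
    ∀ x, nrm x ^ 2 ≤ N x ^ 2 ∧ N x ^ 2 ≤ κ / κp * nrm x ^ 2

/-- For `1 < p ≤ 2`: whether the dimension-dependent regularity constant `e² (log d - 1)` is
available (`log d ≥ 2`) and smaller than `q - 1`. -/
def UseLogDim (p : ℝ≥0∞) (d : ℕ) : Prop :=
  2 ≤ Real.log d ∧ Real.exp 2 * (Real.log d - 1) < (dualExp p).toReal - 1

open Classical in
/-- The regularity constant of `ℓ_q` on `ℝ^d`: `min {q - 1, e² (log d - 1)}` for `1 < p ≤ 2`
(just `q - 1` when `log d < 2`), and `d^(1 - 2/p)` for `p > 2`. -/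
def kappaQ (p : ℝ≥0∞) (d : ℕ) : ℝ :=
  if p ≤ 2 then
    if UseLogDim p d then Real.exp 2 * (Real.log d - 1) else (dualExp p).toReal - 1
  else (d : ℝ) ^ (1 - 2 * (p⁻¹).toReal)

open Classical in
/-- The smooth norm associated with `ℓ_q` on `ℝ^d`: an `ℓ_r` norm, with `r = log d` or `r = q`, for
`1 < p ≤ 2`, and `d^(1/2 - 1/p) ‖·‖_2` for `p > 2`. -/
def plusNorm (p : ℝ≥0∞) {d : ℕ} (x : Fin d → ℝ) : ℝ :=
  if p ≤ 2 then
    if UseLogDim p d then ellNorm (ENNReal.ofReal (Real.log d)) x else ellNorm (dualExp p) x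
  else (d : ℝ) ^ (1 / 2 - (p⁻¹).toReal) * ellNorm 2 x

/-- The generalized Gaussian distribution `𝒢_N(0, σ²)` on `ℝ^d`: the probability measure with
density proportional to `exp (-N(z)² / (2 σ²))`. -/
def generalizedGaussian {d : ℕ} (N : (Fin d → ℝ) → ℝ) (σ : ℝ) : Measure (Fin d → ℝ) :=
  let ν : Measure (Fin d → ℝ) :=
    volume.withDensity fun z => ENNReal.ofReal (Real.exp (-(N z ^ 2) / (2 * σ ^ 2)))
  (ν Set.univ)⁻¹ • ν

/-! ### Tree-based mechanism

The binary tree over the leaves `1, …, 2^⌈log₂ n⌉`; node `(ℓ, k)` is the `k`-th node (from the left,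
starting with `0`) at height `ℓ`, above the leaves `k 2^ℓ + 1, …, (k + 1) 2^ℓ`. -/

/-- The nodes of the tree for a stream of length `n`. -/
def treeNodes (n : ℕ) : Finset (ℕ × ℕ) :=
  (Finset.range (Nat.clog 2 n + 1) ×ˢ Finset.range (2 ^ Nat.clog 2 n)).filter
    fun j => j.2 < 2 ^ (Nat.clog 2 n - j.1)

/-- The content of a completed node: the sum of the leaves below it, plus the noise that was added
once, upon its completion. -/
def nodeValue {d : ℕ} (g : ℕ → Fin d → ℝ) (Z : ℕ × ℕ → Fin d → ℝ) (j : ℕ × ℕ) : Fin d → ℝ :=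
  (∑ i ∈ Finset.Ioc (j.2 * 2 ^ j.1) ((j.2 + 1) * 2 ^ j.1), g i) + Z j

/-- The node read at height `ℓ` at time `t`: the ancestor of leaf `t` if that is a left child, and
its left sibling otherwise. -/
def readNode (t ℓ : ℕ) : ℕ × ℕ :=
  if Even ((t - 1) / 2 ^ ℓ) then (ℓ, (t - 1) / 2 ^ ℓ) else (ℓ, (t - 1) / 2 ^ ℓ - 1)

/-- The noisy partial sum of `g_1 + ⋯ + g_t` released by the mechanism at time `t`: one node for each
of the `⌈log₂ n⌉ + 1` binary digits of `t` that equals `1`. -/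
def noisySum {d : ℕ} (n : ℕ) (g : ℕ → Fin d → ℝ) (Z : ℕ × ℕ → Fin d → ℝ) (t : ℕ) : Fin d → ℝ :=
  ∑ ℓ ∈ (Finset.range (Nat.clog 2 n + 1)).filter (fun ℓ => t.testBit ℓ = true),
    nodeValue g Z (readNode t ℓ)

/-! ### The algorithm -/

/-- `argmin` is a (measurable) rule choosing a minimizer of `v ↦ ⟨u, v⟩` over `C` for each `u`. -/
def IsLinearMinimizer {d : ℕ} (C : Set (Fin d → ℝ)) (argmin : (Fin d → ℝ) → Fin d → ℝ) : Prop :=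
  Measurable argmin ∧ ∀ u, argmin u ∈ C ∧ ∀ v ∈ C, u ⬝ᵥ argmin u ≤ u ⬝ᵥ v

/-- The state after `t` iterations: `θ_t`, `θ_{t+1}`, and the summands `g_1, …, g_t`. -/
structure FWState (d : ℕ) where
  prev : Fin d → ℝ
  cur : Fin d → ℝ
  g : ℕ → Fin d → ℝ

/-- Private tree-based online Frank-Wolfe (DP-TOFW), run on the samples `x_1, x_2, …` with the noise
vectors `Z` at the nodes of the tree. -/
def dpTOFWState {d : ℕ} {X : Type*} (C : Set (Fin d → ℝ)) (f : (Fin d → ℝ) → X → ℝ)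
    (argmin : (Fin d → ℝ) → Fin d → ℝ) (n : ℕ) (x : ℕ → X) (Z : ℕ × ℕ → Fin d → ℝ) :
    ℕ → FWState d
  | 0 => ⟨0, 0, fun _ => 0⟩
  | k + 1 =>
    let s := dpTOFWState C f argmin n x Z k
    let t : ℕ := k + 1
    let gt : Fin d → ℝ :=
      ((t : ℝ) + 1) • gradOn C (fun θ => f θ (x t)) s.cur
        - (t : ℝ) • gradOn C (fun θ => f θ (x t)) s.prev
    let g := Function.update s.g t gt
    let dt : Fin d → ℝ := (1 / ((t : ℝ) + 1)) • noisySum n g Z t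
    ⟨s.cur, s.cur + (1 / ((t : ℝ) + 1)) • (argmin dt - s.cur), g⟩

/-- The iterate `θ_t` of DP-TOFW (`θ_0 = θ_1 = 0`). -/
def dpTOFW {d : ℕ} {X : Type*} (C : Set (Fin d → ℝ)) (f : (Fin d → ℝ) → X → ℝ)
    (argmin : (Fin d → ℝ) → Fin d → ℝ) (n : ℕ) (x : ℕ → X) (Z : ℕ × ℕ → Fin d → ℝ) (t : ℕ) :
    Fin d → ℝ :=
  (dpTOFWState C f argmin n x Z t).prev

/-- The randomness of a run of length `n`: the samples `x_1, …, x_n` are i.i.d. with law `P`, the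
noise vectors at the nodes of the tree are i.i.d. with law `Q`, independent of the samples. -/
structure IsRandomInput {d : ℕ} {X : Type*} [MeasurableSpace X] {Ω : Type*} [MeasurableSpace Ω]
    (P : Measure X) (Q : Measure (Fin d → ℝ)) (n : ℕ) (Pr : Measure Ω)
    (x : ℕ → Ω → X) (Z : ℕ × ℕ → Ω → Fin d → ℝ) : Prop where
  sample_law : ∀ t ∈ Finset.Icc 1 n, HasLaw (x t) P Pr
  sample_indep : iIndepFun (fun t : Finset.Icc 1 n => x t) Pr
  noise_law : ∀ j ∈ treeNodes n, HasLaw (Z j) Q Pr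
  noise_indep : iIndepFun (fun j : treeNodes n => Z j) Pr
  indep : IndepFun (fun ω (t : Finset.Icc 1 n) => x t ω) (fun ω (j : treeNodes n) => Z j ω) Pr

/-- The noise level prescribed for `(ε, δ)`-differential privacy:
`σ₊² = 8 (⌈log₂ n⌉ + 1)² κ_q log((⌈log₂ n⌉ + 1)/δ) (β D + L)² / ε²`. -/
def privateSigma (p : ℝ≥0∞) (d n : ℕ) (ε δ β D L : ℝ) : ℝ :=
  √(8 * ((Nat.clog 2 n : ℝ) + 1) ^ 2 * kappaQ p d * Real.log (((Nat.clog 2 n : ℝ) + 1) / δ)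
    * (β * D + L) ^ 2 / ε ^ 2)

end

/-! ### The `ℓ_p` norms -/

/-! The weights in `g_t` make the drift telescope: the sum over i ≤ t of (i+1)∇F(θ_i) − i∇F(θ_{i−1})
is (t+1)∇F(θ_t) − ∇F(0). Hence (t+1)(d_t − ∇F(θ_t)) equals a martingale M_t, minus ∇F(0), plus the
tree noise (`sum_recursive_grad_eq`). Here ‖∇F(0)‖_q ≤ βD because ∇F(θ*) = 0. The increments of M_t
stay below G + 2βD in spite of the growing weights, because t‖θ_t − θ_{t−1}‖_p ≤ D. So the gradient
error should be of order 1/√t plus noise/t.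

Two concentration bounds make this precise. For M_t, the norm is replaced by its infimal convolution
V with N²/(2τ), which differs from it by at most τ/2 and is κ/τ-smooth (`exists_smooth_approx`).
Then exp(l V(M_t)), up to a constant factor per step, is a supermartingale: Hoeffding's lemma
handles the linear term of V and smoothness the quadratic one. Samples and noise being independent,
the noise can be frozen and the samples integrated out from the last to the first
(`StronglyConvexSCO.lmarginal_exp_deviationSum_le`). For the tree noise, E exp(N²/(4σ²)) = √2^d by
scaling Lebesgue measure, at most ⌈log₂ n⌉ + 1 independent nodes are summed, and Markov's inequality
concludes (`measure_treeNoise_le`). A union bound over t gives both estimates at all times.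

On this event the argument is deterministic. The ℓ_p ball of radius γ about θ* lies in C, so the
Frank–Wolfe direction gains h + γ‖∇F‖_q, where h is the excess loss, and strong convexity gives
‖∇F‖_q ≥ √(2μh) (`StronglyConvexSCO.frank_wolfe_step`). With step 1/(t+1) this becomes (t+1)h_{t+1}
≤ t h_t − √2 g√h_t + a/√t + b/(t+1), where g = γ√μ, a collects the martingale and smoothness terms
and b the noise. The negative term balances the positive ones when h_t is of order a²/(g²t) +
b²/(g²t²), and `excess_recursion` shows that, up to a logarithm on b, h_t never exceeds this level.

Regularity of ℓ_q for q ≥ 2 comes from bounding the second derivative of ‖·‖_q² along lines by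
Hölder's inequality (`isSmoothNorm_ellNorm`). The exponent log d replaces a larger q at the price of
a factor d^{1/log d} = e, and for p > 2 one compares with ℓ_2. For 1 < p ≤ 2 the constant κ_q is at
most q − 1, so at the private noise level the dimension enters only through d/(t²ε²). -/

theorem ellNorm_eq_sum {d : ℕ} {p : ℝ≥0∞} (hp : 0 < p.toReal) (x : Fin d → ℝ) :
    ellNorm p x = (∑ i, |x i| ^ p.toReal) ^ (1 / p.toReal) := by
  simp [ellNorm, PiLp.norm_eq_sum hp]

theorem isNormOn_ellNorm {d : ℕ} {p : ℝ≥0∞} (hp : 1 ≤ p) :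
    IsNormOn (fun x : Fin d → ℝ => ellNorm p x) := by
  have : Fact (1 ≤ p) := ⟨hp⟩
  refine ⟨fun x y => ?_, fun a x => ?_, fun x hx => ?_⟩
  · simpa [ellNorm] using norm_add_le (WithLp.toLp p x) (WithLp.toLp p y)
  · simpa [ellNorm] using norm_smul a (WithLp.toLp p x)
  · have : WithLp.toLp p x = 0 := norm_eq_zero.1 hx
    simpa using this

theorem continuous_ellNorm {d : ℕ} {p : ℝ≥0∞} (hp : 1 ≤ p) :
    Continuous (fun x : Fin d → ℝ => ellNorm p x) := by
  have : Fact (1 ≤ p) := ⟨hp⟩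
  exact continuous_norm.comp (PiLp.continuous_toLp p _)

theorem abs_apply_le_ellNorm {d : ℕ} {p : ℝ≥0∞} (hp : 1 ≤ p) (x : Fin d → ℝ) (i : Fin d) :
    |x i| ≤ ellNorm p x := by
  have : Fact (1 ≤ p) := ⟨hp⟩
  simpa [ellNorm] using PiLp.norm_apply_le (WithLp.toLp p x) i

namespace IsNormOn

variable {d : ℕ} {N : (Fin d → ℝ) → ℝ}

theorem map_zero (hN : IsNormOn N) : N 0 = 0 := by
  simpa using hN.smul_eq 0 0

theorem map_neg (hN : IsNormOn N) (x : Fin d → ℝ) : N (-x) = N x := by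
  simpa using hN.smul_eq (-1) x

theorem nonneg (hN : IsNormOn N) (x : Fin d → ℝ) : 0 ≤ N x := by
  have h := hN.add_le x (-x)
  rw [hN.map_neg, add_neg_cancel, hN.map_zero] at h
  linarith

theorem sub_le (hN : IsNormOn N) (x y : Fin d → ℝ) : N (x - y) ≤ N x + N y := by
  rw [sub_eq_add_neg, ← hN.map_neg y]
  exact hN.add_le _ _

theorem sum_le (hN : IsNormOn N) {ι : Type*} (s : Finset ι) (f : ι → Fin d → ℝ) :
    N (∑ i ∈ s, f i) ≤ ∑ i ∈ s, N (f i) := by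
  classical
  induction s using Finset.induction_on with
  | empty => simp [hN.map_zero]
  | insert i s hi ih =>
    rw [Finset.sum_insert hi, Finset.sum_insert hi]
    exact (hN.add_le _ _).trans (by gcongr)

theorem const_mul (hN : IsNormOn N) {c : ℝ} (hc : 0 < c) : IsNormOn fun x => c * N x := by
  refine ⟨fun x y => ?_, fun a x => ?_, fun x hx => ?_⟩
  · rw [← mul_add]; exact mul_le_mul_of_nonneg_left (hN.add_le x y) hc.le
  · simp only [hN.smul_eq]; ring
  · exact hN.eq_zero x ((mul_eq_zero.1 hx).resolve_left hc.ne')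

end IsNormOn

/-- The `ℓ_p` norms decrease in `p`. -/
theorem ellNorm_anti {d : ℕ} {r s : ℝ≥0∞} (hr : 1 ≤ r) (hrs : r ≤ s) (hs : s ≠ ∞)
    (x : Fin d → ℝ) : ellNorm s x ≤ ellNorm r x := by
  have hr0 : 1 ≤ r.toReal := by
    rw [← ENNReal.toReal_one]; exact ENNReal.toReal_mono (ne_top_of_le_ne_top hs hrs) hr
  have hrs' : r.toReal ≤ s.toReal := ENNReal.toReal_mono hs hrs
  have hs0 : 0 < s.toReal := by linarith
  have hM := (isNormOn_ellNorm (d := d) hr).nonneg x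
  rw [ellNorm_eq_sum hs0]
  have key : ∑ i, |x i| ^ s.toReal ≤ ellNorm r x ^ s.toReal := by
    have h1 : ∀ i ∈ Finset.univ, |x i| ^ s.toReal
        ≤ ellNorm r x ^ (s.toReal - r.toReal) * |x i| ^ r.toReal := fun i _ => by
      have h2 : |x i| ^ s.toReal = |x i| ^ (s.toReal - r.toReal) * |x i| ^ r.toReal := by
        rw [← Real.rpow_add' (abs_nonneg _) (by linarith)]; simp
      rw [h2]
      gcongr
      exact abs_apply_le_ellNorm hr x i
    refine (Finset.sum_le_sum h1).trans (le_of_eq ?_)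
    rw [← Finset.mul_sum]
    have h3 : ∑ i, |x i| ^ r.toReal = ellNorm r x ^ r.toReal := by
      rw [ellNorm_eq_sum (by linarith), ← Real.rpow_mul
        (Finset.sum_nonneg fun i _ => Real.rpow_nonneg (abs_nonneg _) _),
        one_div_mul_cancel (by linarith), Real.rpow_one]
    rw [h3, ← Real.rpow_add' hM (by linarith)]
    simp
  calc _ ≤ (ellNorm r x ^ s.toReal) ^ (1 / s.toReal) := by
        gcongr
    _ = _ := by rw [← Real.rpow_mul hM, mul_one_div_cancel hs0.ne', Real.rpow_one]

/-- Comparison of `ℓ_r` with `ℓ_s` for `r ≤ s`. -/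
theorem ellNorm_le_card_rpow_mul {d : ℕ} {r s : ℝ≥0∞} (hr : 1 ≤ r) (hrs : r ≤ s) (hs : s ≠ ∞)
    (x : Fin d → ℝ) :
    ellNorm r x ≤ (d : ℝ) ^ (1 / r.toReal - 1 / s.toReal) * ellNorm s x := by
  have hr0 : 1 ≤ r.toReal := by
    rw [← ENNReal.toReal_one]; exact ENNReal.toReal_mono (ne_top_of_le_ne_top hs hrs) hr
  have hrs' : r.toReal ≤ s.toReal := ENNReal.toReal_mono hs hrs
  have hs0 : 0 < s.toReal := by linarith
  have hr1 : 0 < r.toReal := by linarith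
  have h := Real.rpow_sum_le_const_mul_sum_rpow_of_nonneg Finset.univ
    (f := fun i => |x i| ^ r.toReal) (p := s.toReal / r.toReal)
    ((one_le_div hr1).2 hrs') (fun i _ => by positivity)
  simp only [Finset.card_univ, Fintype.card_fin] at h
  have h2 : ∀ i, (|x i| ^ r.toReal) ^ (s.toReal / r.toReal) = |x i| ^ s.toReal := fun i => by
    rw [← Real.rpow_mul (abs_nonneg _), mul_div_cancel₀ _ hr1.ne']
  simp only [h2] at h
  have hA : 0 ≤ ∑ i, |x i| ^ r.toReal := by positivity
  rw [ellNorm_eq_sum hr1, ellNorm_eq_sum hs0]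
  calc (∑ i, |x i| ^ r.toReal) ^ (1 / r.toReal)
      = ((∑ i, |x i| ^ r.toReal) ^ (s.toReal / r.toReal)) ^ (1 / s.toReal) := by
        rw [← Real.rpow_mul hA]; congr 1; field_simp
    _ ≤ ((d : ℝ) ^ (s.toReal / r.toReal - 1) * ∑ i, |x i| ^ s.toReal) ^ (1 / s.toReal) := by
        gcongr
    _ = _ := by
        rw [Real.mul_rpow (by positivity) (by positivity), ← Real.rpow_mul (by positivity)]
        congr 2; field_simp

theorem dualExp_facts {p : ℝ≥0∞} (hp : 1 < p) :
    1 ≤ dualExp p ∧ dualExp p ≠ ∞ ∧ p⁻¹ + (dualExp p)⁻¹ = 1 := by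
  have : p.HolderConjugate (dualExp p) := .conjExponent hp.le
  have h1 : p⁻¹ + (dualExp p)⁻¹ = 1 := ENNReal.HolderConjugate.inv_add_inv_eq_one p _
  have h2 : dualExp p = 1 + (p - 1)⁻¹ := ENNReal.HolderConjugate.conj_eq
  refine ⟨by rw [h2]; exact le_self_add, ?_, h1⟩
  rw [h2]
  simp [tsub_eq_zero_iff_le, hp]

theorem dualExp_top : dualExp ∞ = 1 := by
  simp [dualExp, ENNReal.conjExponent]

/-- For `1 < p < ∞` the real exponents are Hölder conjugate. -/
theorem dualExp_holderConjugate {p : ℝ≥0∞} (hp : 1 < p) (hp' : p ≠ ∞) :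
    (dualExp p).toReal.HolderConjugate p.toReal := by
  have : p.HolderConjugate (dualExp p) := .conjExponent hp.le
  have h1 : 1 < p.toReal := by
    rw [← ENNReal.toReal_one]; exact (ENNReal.toReal_lt_toReal (by simp) hp').2 hp
  exact (ENNReal.HolderConjugate.toReal (p := p) (q := dualExp p) h1).symm

theorem dotProduct_le_ellNorm {d : ℕ} {p : ℝ≥0∞} (hp : 1 < p) (x y : Fin d → ℝ) :
    x ⬝ᵥ y ≤ ellNorm (dualExp p) x * ellNorm p y := by
  by_cases hp' : p = ∞
  · subst hp'
    rw [dualExp_top, ellNorm_eq_sum (by simp), dotProduct]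
    simp only [ENNReal.toReal_one, Real.rpow_one, div_one]
    rw [Finset.sum_mul]
    refine Finset.sum_le_sum fun i _ => (le_abs_self _).trans ?_
    rw [abs_mul]
    gcongr
    exact abs_apply_le_ellNorm hp.le y i
  · have h := dualExp_holderConjugate hp hp'
    have := Real.inner_le_Lp_mul_Lq Finset.univ x y h
    rwa [← ellNorm_eq_sum h.pos, ← ellNorm_eq_sum h.symm.pos] at this

theorem abs_dotProduct_le_ellNorm {d : ℕ} {p : ℝ≥0∞} (hp : 1 < p) (x y : Fin d → ℝ) :
    |x ⬝ᵥ y| ≤ ellNorm (dualExp p) x * ellNorm p y := by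
  refine abs_le'.2 ⟨dotProduct_le_ellNorm hp x y, ?_⟩
  rw [← neg_dotProduct]
  refine (dotProduct_le_ellNorm hp _ _).trans (le_of_eq ?_)
  rw [(isNormOn_ellNorm (d := d) (dualExp_facts hp).1).map_neg x]

/-- The `ℓ_q` norm is attained against a vector of the dual unit ball. -/
theorem exists_dotProduct_eq_ellNorm {d : ℕ} {p : ℝ≥0∞} (hp : 1 < p) (w : Fin d → ℝ) :
    ∃ u : Fin d → ℝ, ellNorm p u ≤ 1 ∧ w ⬝ᵥ u = ellNorm (dualExp p) w := by
  by_cases hp' : p = ∞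
  · subst hp'
    refine ⟨fun i => SignType.sign (w i), ?_, ?_⟩
    · have : ellNorm ∞ (fun i => ((SignType.sign (w i) : SignType) : ℝ))
          = ‖fun i => ((SignType.sign (w i) : SignType) : ℝ)‖ := by
        rw [ellNorm, PiLp.norm_toLp]
      rw [this]
      refine (pi_norm_le_iff_of_nonneg zero_le_one).2 fun i => ?_
      rcases lt_trichotomy (w i) 0 with h | h | h <;> simp [h]
    · rw [dualExp_top, ellNorm_eq_sum (by simp), dotProduct]
      simp
  · have h := dualExp_holderConjugate hp hp'
    obtain ⟨⟨g, hg, hgw⟩, -⟩ := NNReal.isGreatest_Lp Finset.univ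
      (fun i => Real.nnabs (w i)) h
    refine ⟨fun i => SignType.sign (w i) * g i, ?_, ?_⟩
    · rw [ellNorm_eq_sum h.symm.pos]
      refine Real.rpow_le_one (by positivity) ?_ (by have := h.symm.pos; positivity)
      have hg' : ∑ i, (g i : ℝ) ^ p.toReal ≤ 1 := by exact_mod_cast hg
      refine le_trans (Finset.sum_le_sum fun i _ => ?_) hg'
      refine Real.rpow_le_rpow (abs_nonneg _) ?_ h.symm.nonneg
      rw [abs_mul, abs_of_nonneg (g i).coe_nonneg]
      rcases lt_trichotomy (w i) 0 with h | h | h <;> simp [h]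
    · rw [ellNorm_eq_sum h.pos, dotProduct]
      have := congrArg (fun a : NNReal => (a : ℝ)) hgw
      simp only [NNReal.coe_sum, NNReal.coe_mul, NNReal.coe_rpow, Real.coe_nnabs] at this
      rw [← this]
      refine Finset.sum_congr rfl fun i _ => ?_
      rw [← mul_assoc, mul_comm (w i), sign_mul_self]

/-- Duality lets bounds on per-sample gradients pass to expectations through scalar integrals, one
direction `u` at a time. -/
theorem ellNorm_le_of_dotProduct_le {d : ℕ} {p : ℝ≥0∞} (hp : 1 < p) {w : Fin d → ℝ} {c : ℝ}
    (hc : 0 ≤ c) (h : ∀ u, w ⬝ᵥ u ≤ c * ellNorm p u) : ellNorm (dualExp p) w ≤ c := by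
  obtain ⟨u, hu, hwu⟩ := exists_dotProduct_eq_ellNorm hp w
  rw [← hwu]
  exact (h u).trans (mul_le_of_le_one_right hc hu)

/-! ### Smoothness of the `ℓ_q` norms -/

theorem hasDerivAt_abs_rpow_mul_self {r : ℝ} (hr : 2 ≤ r) (t : ℝ) :
    HasDerivAt (fun t : ℝ => |t| ^ (r - 2) * t) ((r - 1) * |t| ^ (r - 2)) t := by
  rcases hr.eq_or_lt with rfl | hr
  · convert! hasDerivAt_id t using 1
    · ext t; simp
    · norm_num
  rcases lt_trichotomy t 0 with ht | rfl | ht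
  · have h := ((hasDerivAt_neg t).rpow_const (p := r - 1) (Or.inr (by linarith))).neg
    have h2 : (fun t : ℝ => |t| ^ (r - 2) * t) =ᶠ[nhds t] -fun x => (-x) ^ (r - 1) := by
      filter_upwards [Iio_mem_nhds ht] with s hs
      rw [abs_of_neg hs, Pi.neg_apply, show r - 1 = r - 2 + 1 by ring,
        Real.rpow_add_one (neg_pos.2 hs).ne']
      ring
    refine (h.congr_of_eventuallyEq h2).congr_deriv ?_
    rw [abs_of_neg ht]; ring_nf
  · rw [hasDerivAt_iff_tendsto_slope_zero]
    have h : Filter.Tendsto (fun t : ℝ => |t| ^ (r - 2)) (nhdsWithin 0 {0}ᶜ) (nhds 0) := by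
      have : ContinuousAt (fun t : ℝ => |t| ^ (r - 2)) 0 :=
        continuous_abs.continuousAt.rpow_const (Or.inr (by linarith))
      have h0 := this.tendsto
      rw [abs_zero, Real.zero_rpow (by linarith)] at h0
      exact h0.mono_left nhdsWithin_le_nhds
    rw [abs_zero, Real.zero_rpow (by linarith), mul_zero]
    simp only [mul_zero]
    refine h.congr' ?_
    filter_upwards [self_mem_nhdsWithin] with s hs
    simp only [zero_add, sub_zero, smul_eq_mul]
    field_simp [show s ≠ 0 from hs]
  · have h := ((hasDerivAt_id t).rpow_const (p := r - 1) (Or.inr (by linarith)))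
    have h2 : (fun t : ℝ => |t| ^ (r - 2) * t) =ᶠ[nhds t] fun x => (id x) ^ (r - 1) := by
      filter_upwards [Ioi_mem_nhds ht] with s hs
      rw [abs_of_pos hs, id, show r - 1 = r - 2 + 1 by ring, Real.rpow_add_one (ne_of_gt hs)]
    refine (h.congr_of_eventuallyEq h2).congr_deriv ?_
    rw [abs_of_pos ht, id]; ring_nf

/-- Integrating φ'' ≤ M twice, as two monotonicity statements, so that φ'' need not be continuous.
-/
theorem taylor_le_of_second_deriv_le {φ φ' φ'' : ℝ → ℝ} {M : ℝ}
    (h1 : ∀ s, HasDerivAt φ (φ' s) s) (h2 : ∀ s, HasDerivAt φ' (φ'' s) s)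
    (h3 : ∀ s, φ'' s ≤ M) : φ 1 ≤ φ 0 + φ' 0 + M / 2 := by
  have hA : Antitone fun s => φ' s - M * s := by
    have hd : ∀ s, HasDerivAt (fun s => φ' s - M * s) (φ'' s - M * 1) s := fun s =>
      (h2 s).sub ((hasDerivAt_id s).const_mul M)
    refine antitone_of_deriv_nonpos (fun s => (hd s).differentiableAt) fun s => ?_
    rw [(hd s).deriv]; linarith [h3 s]
  have hd : ∀ s, HasDerivAt (fun s => φ s - (φ' 0 * s + M / 2 * s ^ 2))
      (φ' s - (φ' 0 * 1 + M / 2 * (2 * s))) s := fun s => by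
    refine (h1 s).sub (((hasDerivAt_id s).const_mul _).add ?_)
    simpa using ((hasDerivAt_pow 2 s).const_mul (M / 2))
  have hB : AntitoneOn (fun s => φ s - (φ' 0 * s + M / 2 * s ^ 2)) (Set.Ici 0) := by
    refine antitoneOn_of_deriv_nonpos (convex_Ici 0)
      (fun s _ => (hd s).continuousAt.continuousWithinAt)
      (fun s _ => (hd s).differentiableAt.differentiableWithinAt) fun s hs => ?_
    rw [interior_Ici] at hs
    rw [(hd s).deriv]
    have := hA (le_of_lt hs)
    simp only [mul_zero, sub_zero] at this
    linarith
  have := hB (Set.mem_Ici.2 le_rfl) (Set.mem_Ici.2 zero_le_one) zero_le_one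
  simp only at this
  linarith

/-- The gradient of `‖·‖_r²`. -/
noncomputable def ellGradSq {d : ℕ} (r : ℝ) (x : Fin d → ℝ) (i : Fin d) : ℝ :=
  2 * (∑ j, |x j| ^ r) ^ (2 / r - 1) * (|x i| ^ (r - 2) * x i)

theorem sum_abs_rpow_pos {d : ℕ} {x : Fin d → ℝ} (r : ℝ) (hx : x ≠ 0) :
    0 < ∑ j, |x j| ^ r := by
  obtain ⟨i, hi⟩ := Function.ne_iff.1 hx
  exact Finset.sum_pos' (fun j _ => by positivity)
    ⟨i, Finset.mem_univ _, Real.rpow_pos_of_pos (abs_pos.2 hi) _⟩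

theorem ellNorm_sq_eq {d : ℕ} {q : ℝ≥0∞} (hq : 0 < q.toReal) (x : Fin d → ℝ) :
    ellNorm q x ^ 2 = (∑ j, |x j| ^ q.toReal) ^ (2 / q.toReal) := by
  rw [ellNorm_eq_sum hq, ← Real.rpow_natCast, ← Real.rpow_mul (by positivity)]
  congr 1
  push_cast
  ring

theorem hasFDerivAt_sum_abs_rpow {d : ℕ} {r : ℝ} (hr : 2 ≤ r) (x : Fin d → ℝ) :
    HasFDerivAt (fun x : Fin d → ℝ => ∑ j, |x j| ^ r)
      (∑ i, (r * |x i| ^ (r - 2) * x i) • (ContinuousLinearMap.proj i : (Fin d → ℝ) →L[ℝ] ℝ)) x := by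
  refine HasFDerivAt.fun_sum fun i _ => ?_
  exact HasDerivAt.comp_hasFDerivAt (f := fun x : Fin d → ℝ => x i) x
    (hasDerivAt_abs_rpow (x i) (by linarith))
    (ContinuousLinearMap.proj i : (Fin d → ℝ) →L[ℝ] ℝ).hasFDerivAt

/-- The topology and the derivatives on `Fin d → ℝ` refer to the sup norm; this converts ℓ_q
estimates into big-O and Lipschitz estimates for it. -/
theorem ellNorm_le_opNorm_mul {d : ℕ} {q : ℝ≥0∞} (hq : 1 ≤ q) :
    ∃ C : ℝ, 0 ≤ C ∧ ∀ x : Fin d → ℝ, ellNorm q x ≤ C * ‖x‖ := by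
  have : Fact (1 ≤ q) := ⟨hq⟩
  let e := (PiLp.continuousLinearEquiv q ℝ (fun _ : Fin d => ℝ)).symm.toContinuousLinearMap
  exact ⟨‖e‖, norm_nonneg _, fun x => e.le_opNorm x⟩

theorem hasFDerivAt_ellNorm_sq {d : ℕ} {q : ℝ≥0∞} (hq : 2 ≤ q) (hq' : q ≠ ∞) (x : Fin d → ℝ) :
    HasFDerivAt (fun x : Fin d → ℝ => ellNorm q x ^ 2)
      (∑ i, ellGradSq q.toReal x i • (ContinuousLinearMap.proj i : (Fin d → ℝ) →L[ℝ] ℝ)) x := by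
  have hr : 2 ≤ q.toReal := by simpa using ENNReal.toReal_mono hq' hq
  have hr0 : 0 < q.toReal := by linarith
  by_cases hx : x = 0
  · subst hx
    have h0 : (∑ i, ellGradSq q.toReal (0 : Fin d → ℝ) i •
        (ContinuousLinearMap.proj (R := ℝ) i : (Fin d → ℝ) →L[ℝ] ℝ)) = 0 := by
      simp [ellGradSq]
    rw [h0]
    obtain ⟨C, hC, h⟩ := ellNorm_le_opNorm_mul (d := d) (q := q) (le_trans (by norm_num) hq)
    -- At the origin the chain rule fails for the power 2/q, but a function that is O(‖x‖²) has
    -- derivative zero.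
    refine Asymptotics.IsBigO.hasFDerivAt (n := 2) ?_ (by norm_num)
    refine Asymptotics.IsBigO.of_bound (C ^ 2) (Filter.Eventually.of_forall fun x => ?_)
    simp only [sub_zero, norm_pow, norm_norm, ← mul_pow]
    gcongr
    have := (isNormOn_ellNorm (d := d) (p := q) (le_trans (by norm_num) hq)).nonneg x
    rw [Real.norm_of_nonneg this]
    exact h x
  · have h := (hasFDerivAt_sum_abs_rpow hr x).rpow_const (p := 2 / q.toReal)
      (Or.inl (sum_abs_rpow_pos _ hx).ne')
    simp_rw [ellNorm_sq_eq hr0]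
    refine h.congr_fderiv ?_
    rw [Finset.smul_sum]
    refine Finset.sum_congr rfl fun i _ => ?_
    rw [smul_smul]
    congr 1
    rw [ellGradSq]
    field_simp

theorem continuous_ellGradSq {d : ℕ} {r : ℝ} (hr : 2 ≤ r) (i : Fin d) :
    Continuous fun x : Fin d → ℝ => ellGradSq r x i := by
  have hS : Continuous fun x : Fin d → ℝ => ∑ j, |x j| ^ r :=
    continuous_finsetSum _ fun j _ =>
      (continuous_apply j).abs.rpow_const fun _ => Or.inr (by linarith)
  rw [continuous_iff_continuousAt]
  intro x
  by_cases hx : x = 0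
  · subst hx
    have h0 : ellGradSq r (0 : Fin d → ℝ) i = 0 := by simp [ellGradSq]
    rw [ContinuousAt, h0]
    have hg : Filter.Tendsto (fun x : Fin d → ℝ => 2 * (∑ j, |x j| ^ r) ^ (1 / r))
        (nhds 0) (nhds 0) := by
      have : Continuous fun x : Fin d → ℝ => 2 * (∑ j, |x j| ^ r) ^ (1 / r) :=
        continuous_const.mul (hS.rpow_const fun _ => Or.inr (by positivity))
      have h1 := this.tendsto 0
      simpa [Real.zero_rpow (show r ≠ 0 by linarith),
        Real.zero_rpow (show r⁻¹ ≠ 0 by positivity)] using h1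
    refine squeeze_zero_norm (fun x => ?_) hg
    by_cases hx : x = 0
    · subst hx
      rw [h0, norm_zero]
      positivity
    have hSx := sum_abs_rpow_pos r hx
    -- Near the origin the powers of the sum combine to 2/r − 1 + (r − 1)/r = 1/r, so each
    -- coordinate of the gradient is at most 2‖x‖_r.
    have h1 : |x i| ^ (r - 2) * |x i| ≤ (∑ j, |x j| ^ r) ^ ((r - 1) / r) := by
      have h2 : |x i| ^ r ≤ ∑ j, |x j| ^ r :=
        Finset.single_le_sum (f := fun j => |x j| ^ r) (fun j _ => by positivity)
          (Finset.mem_univ i)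
      have h3 : |x i| ^ (r - 2) * |x i| = (|x i| ^ r) ^ ((r - 1) / r) := by
        rw [← Real.rpow_mul (abs_nonneg _), mul_div_cancel₀ _ (by linarith),
          show r - 1 = r - 2 + 1 by ring, Real.rpow_add' (abs_nonneg _) (by linarith),
          Real.rpow_one]
      rw [h3]
      have : 0 ≤ (r - 1) / r := div_nonneg (by linarith) (by linarith)
      gcongr
    rw [Real.norm_eq_abs, ellGradSq, abs_mul, abs_mul, abs_mul, abs_of_nonneg zero_le_two,
      abs_of_nonneg (Real.rpow_nonneg hSx.le _), abs_of_nonneg (Real.rpow_nonneg (abs_nonneg _) _)]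
    calc _ ≤ 2 * (∑ j, |x j| ^ r) ^ (2 / r - 1) * (∑ j, |x j| ^ r) ^ ((r - 1) / r) := by gcongr
      _ = _ := by
        rw [mul_assoc, ← Real.rpow_add hSx]
        congr 2
        field_simp
        ring
  · unfold ellGradSq
    refine ContinuousAt.mul (ContinuousAt.mul continuousAt_const ?_) ?_
    · exact hS.continuousAt.rpow_const (Or.inl (sum_abs_rpow_pos _ hx).ne')
    · exact ((continuous_apply i).abs.rpow_const fun _ => Or.inr (by linarith)).continuousAt.mul
        (continuous_apply i).continuousAt

theorem contDiff_ellNorm_sq {d : ℕ} {q : ℝ≥0∞} (hq : 2 ≤ q) (hq' : q ≠ ∞) :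
    ContDiff ℝ 1 fun x : Fin d → ℝ => ellNorm q x ^ 2 := by
  have hr : 2 ≤ q.toReal := by simpa using ENNReal.toReal_mono hq' hq
  refine contDiff_one_iff_hasFDerivAt.2 ⟨_, ?_, hasFDerivAt_ellNorm_sq hq hq'⟩
  exact continuous_finsetSum _ fun i _ => (continuous_ellGradSq hr i).smul continuous_const

/-- Hölder's inequality in the form used to bound the Hessian of `‖·‖_r²`. -/
theorem sum_abs_rpow_mul_sq_le {d : ℕ} {r : ℝ} (hr : 2 ≤ r) (u y : Fin d → ℝ) :
    ∑ i, |u i| ^ (r - 2) * y i ^ 2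
      ≤ (∑ i, |u i| ^ r) ^ (1 - 2 / r) * (∑ i, |y i| ^ r) ^ (2 / r) := by
  rcases hr.eq_or_lt with rfl | hr
  · norm_num
  have hc : (r / (r - 2)).HolderConjugate (r / 2) := by
    rw [Real.holderConjugate_iff]
    refine ⟨(one_lt_div (by linarith)).2 (by linarith), ?_⟩
    have : r - 2 ≠ 0 := by linarith
    field_simp
    ring
  have h := Real.inner_le_Lp_mul_Lq_of_nonneg Finset.univ hc
    (f := fun i => |u i| ^ (r - 2)) (g := fun i => y i ^ 2)
    (fun i _ => by positivity) (fun i _ => by positivity)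
  have h1 : ∀ i, (|u i| ^ (r - 2)) ^ (r / (r - 2)) = |u i| ^ r := fun i => by
    rw [← Real.rpow_mul (abs_nonneg _), mul_div_cancel₀ _ (by linarith)]
  have h2 : ∀ i, (y i ^ 2) ^ (r / 2) = |y i| ^ r := fun i => by
    rw [← sq_abs, ← Real.rpow_natCast, ← Real.rpow_mul (abs_nonneg _)]
    congr 1
    push_cast
    ring
  simp only [h1, h2] at h
  refine h.trans (le_of_eq ?_)
  have : r - 2 ≠ 0 := by linarith
  congr 2 <;> field_simp

/-- Along a line write ‖x + sy‖_r² = S^{2/r}. The second derivative consists of a term with factor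
2/r − 1 ≤ 0, which is discarded, and 2(r − 1)S^{2/r−1}Q, which Hölder's inequality bounds by 2(r −
1)‖y‖_r². Taylor's formula on [0, 1] concludes. -/
theorem isSmoothNorm_ellNorm {d : ℕ} {q : ℝ≥0∞} (hq : 2 ≤ q) (hq' : q ≠ ∞) :
    IsSmoothNorm (fun x : Fin d → ℝ => ellNorm q x) (q.toReal - 1) := by
  have hr : 2 ≤ q.toReal := by simpa using ENNReal.toReal_mono hq' hq
  have hr0 : 0 < q.toReal := by linarith
  have hN := isNormOn_ellNorm (d := d) (p := q) (le_trans (by norm_num) hq)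
  refine ⟨contDiff_ellNorm_sq hq hq', fun x y => ?_⟩
  set f := fun x : Fin d → ℝ => ellNorm q x ^ 2 with hf
  have hline : ∀ s : ℝ, HasDerivAt (fun s : ℝ => x + s • y) y s := fun s => by
    simpa using ((hasDerivAt_id s).smul_const y).const_add x
  have hφ : ∀ s : ℝ, HasDerivAt (fun s : ℝ => f (x + s • y))
      (∑ i, ellGradSq q.toReal (x + s • y) i * y i) s := fun s => by
    refine ((hasFDerivAt_ellNorm_sq hq hq' (x + s • y)).comp_hasDerivAt s (hline s)).congr_deriv ?_
    simp
  have hfd : fderiv ℝ f x y = ∑ i, ellGradSq q.toReal (x + (0 : ℝ) • y) i * y i := by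
    rw [(hasFDerivAt_ellNorm_sq hq hq' x).fderiv]
    simp
  rw [hfd]
  -- If the line meets the origin, S vanishes there and its power cannot be differentiated by the
  -- chain rule. In that case the function is exactly (a − s)²‖y‖_r², and only r − 1 ≥ 1 is needed.
  by_cases hx : ∃ s : ℝ, x + s • y = 0
  · obtain ⟨s, hs⟩ := hx
    have hx : x = (-s) • y := by rw [neg_smul]; exact eq_neg_of_add_eq_zero_left hs
    have h1 : ∀ a : ℝ, f (x + a • y) = (a - s) ^ 2 * ellNorm q y ^ 2 := fun a => by
      rw [hf, hx, ← add_smul]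
      simp only [hN.smul_eq, mul_pow, sq_abs]
      ring
    have h2 : HasDerivAt (fun a : ℝ => f (x + a • y)) (2 * (0 - s) * ellNorm q y ^ 2) 0 := by
      simp_rw [h1]
      simpa using (((hasDerivAt_id (0 : ℝ)).sub_const s).pow 2).mul_const (ellNorm q y ^ 2)
    rw [(hφ 0).unique h2]
    have h3 := h1 1
    have h4 := h1 0
    simp only [hf, one_smul, zero_smul, add_zero] at h3 h4
    rw [h3, h4]
    nlinarith [sq_nonneg (ellNorm q y)]
  · push Not at hx
    set r := q.toReal with hrdef
    set S : ℝ → ℝ := fun s => ∑ j, |(x + s • y) j| ^ r with hS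
    set T : ℝ → ℝ := fun s => ∑ i, (|(x + s • y) i| ^ (r - 2) * (x + s • y) i) * y i with hT
    set Q : ℝ → ℝ := fun s => ∑ i, |(x + s • y) i| ^ (r - 2) * y i ^ 2 with hQ
    have hSpos : ∀ s, 0 < S s := fun s => sum_abs_rpow_pos r (hx s)
    have hgrad : ∀ s, ∑ i, ellGradSq r (x + s • y) i * y i = 2 * S s ^ (2 / r - 1) * T s :=
      fun s => by
        simp only [ellGradSq, hT, Finset.mul_sum, hS]
        exact Finset.sum_congr rfl fun i _ => by ring
    have hSd : ∀ s, HasDerivAt S (r * T s) s := fun s => by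
      have := (hasFDerivAt_sum_abs_rpow hr (x + s • y)).comp_hasDerivAt s (hline s)
      refine this.congr_deriv ?_
      simp only [hT, Finset.mul_sum, sum_apply, smul_apply,
        ContinuousLinearMap.proj_apply, smul_eq_mul]
      exact Finset.sum_congr rfl fun i _ => by ring
    have hTd : ∀ s, HasDerivAt T ((r - 1) * Q s) s := fun s => by
      have : ∀ i ∈ Finset.univ, HasDerivAt
          (fun s : ℝ => (|(x + s • y) i| ^ (r - 2) * (x + s • y) i) * y i)
          ((r - 1) * |(x + s • y) i| ^ (r - 2) * y i * y i) s := fun i _ =>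
        (HasDerivAt.comp s (h := fun s : ℝ => (x + s • y) i)
          (hasDerivAt_abs_rpow_mul_self hr ((x + s • y) i))
          (hasDerivAt_pi.1 (hline s) i)).mul_const (y i)
      refine (HasDerivAt.fun_sum this).congr_deriv ?_
      simp only [hQ, Finset.mul_sum]
      exact Finset.sum_congr rfl fun i _ => by ring
    have hφ2 : ∀ s, HasDerivAt (fun s => 2 * S s ^ (2 / r - 1) * T s)
        (2 * (r * T s * (2 / r - 1) * S s ^ (2 / r - 1 - 1)) * T s
          + 2 * S s ^ (2 / r - 1) * ((r - 1) * Q s)) s := fun s =>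
      (((hSd s).rpow_const (Or.inl (hSpos s).ne')).const_mul 2).mul (hTd s)
    have key := taylor_le_of_second_deriv_le (M := 2 * ((r - 1) * ellNorm q y ^ 2))
      (fun s => by have := hφ s; rwa [hgrad] at this) hφ2 fun s => ?_
    · simp only [hf, one_smul, zero_smul, add_zero] at key
      have h0 := hgrad 0
      simp only [zero_smul, add_zero] at h0 ⊢
      rw [h0]
      linarith
    · have h1 : 2 * (r * T s * (2 / r - 1) * S s ^ (2 / r - 1 - 1)) * T s ≤ 0 := by
        have h2 : 2 / r - 1 ≤ 0 := by
          rw [sub_nonpos, div_le_one hr0]; exact hr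
        have h3 : 0 ≤ r * T s ^ 2 * S s ^ (2 / r - 1 - 1) := by
          have := (hSpos s).le
          positivity
        nlinarith
      have h2 : S s ^ (2 / r - 1) * Q s ≤ ellNorm q y ^ 2 := by
        calc S s ^ (2 / r - 1) * Q s
            ≤ S s ^ (2 / r - 1) * (S s ^ (1 - 2 / r) * (∑ i, |y i| ^ r) ^ (2 / r)) := by
              have := (hSpos s).le
              gcongr
              exact sum_abs_rpow_mul_sq_le hr _ y
          _ = _ := by
              rw [← mul_assoc, ← Real.rpow_add (hSpos s), ellNorm_sq_eq hr0]
              simp [hrdef]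
      nlinarith

theorem isSmoothNorm_const_mul_ellNorm_two {d : ℕ} (c : ℝ) :
    IsSmoothNorm (fun x : Fin d → ℝ => c * ellNorm 2 x) 1 := by
  obtain ⟨h1, h2⟩ := isSmoothNorm_ellNorm (d := d) (q := 2) le_rfl (by simp)
  have h : (fun x : Fin d → ℝ => (c * ellNorm 2 x) ^ 2)
      = fun x => c ^ 2 * (ellNorm 2 x ^ 2) := by ext; ring
  refine ⟨by rw [h]; exact contDiff_const.mul h1, fun x y => ?_⟩
  rw [h, fderiv_const_mul (h1.differentiable (by norm_num) x)]
  have := mul_le_mul_of_nonneg_left (h2 x y) (sq_nonneg c)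
  norm_num at this
  simp only [smul_apply, smul_eq_mul]
  nlinarith

/-- The norm `‖·‖_q` is regular, with the constant `kappaQ` and the smooth norm `plusNorm`. -/
theorem isRegularNorm_plusNorm {d : ℕ} {p : ℝ≥0∞} (hd : 1 ≤ d) (hp : 1 < p) :
    IsRegularNorm (fun x : Fin d → ℝ => ellNorm (dualExp p) x) (plusNorm p) (kappaQ p d) := by
  obtain ⟨hq1, hqt, hpq⟩ := dualExp_facts hp
  have hd' : (1 : ℝ) ≤ d := by exact_mod_cast hd
  have hnq := isNormOn_ellNorm (d := d) hq1
  have hpqr : (p⁻¹).toReal + 1 / (dualExp p).toReal = 1 := by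
    have h := congrArg ENNReal.toReal hpq
    rw [ENNReal.toReal_add (ENNReal.inv_ne_top.2 (by positivity))
      (ENNReal.inv_ne_top.2 (by positivity)), ENNReal.toReal_inv (dualExp p)] at h
    simpa using h
  have hq1r : 1 ≤ (dualExp p).toReal := by simpa using ENNReal.toReal_mono hqt hq1
  by_cases hp2 : p ≤ 2
  · have hq2 : 2 ≤ dualExp p := by
      have h2 : (2 : ℝ) ≤ (dualExp p).toReal := by
        have h3 : (2 : ℝ)⁻¹ ≤ (p⁻¹).toReal := by
          rw [ENNReal.toReal_inv]
          have := ENNReal.toReal_mono (by simp) hp2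
          simp only [ENNReal.toReal_ofNat] at this
          have h0 : 0 < p.toReal :=
            ENNReal.toReal_pos (by positivity) (ne_top_of_le_ne_top (by simp) hp2)
          gcongr
        have h4 : 1 / (dualExp p).toReal ≤ 1 / 2 := by linarith
        exact (one_div_le_one_div (by linarith) (by norm_num)).1 h4
      rw [← ENNReal.ofReal_toReal hqt]
      simpa using ENNReal.ofReal_le_ofReal h2
    have hq2r : 2 ≤ (dualExp p).toReal := by simpa using ENNReal.toReal_mono hqt hq2
    by_cases hU : UseLogDim p d
    · have hN : plusNorm p = fun x : Fin d → ℝ => ellNorm (ENNReal.ofReal (Real.log d)) x := by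
        ext x; simp [plusNorm, hp2, hU]
      rw [hN, kappaQ, if_pos hp2, if_pos hU]
      obtain ⟨hl, hlq⟩ := hU
      set r := ENNReal.ofReal (Real.log d) with hr
      have hrr : r.toReal = Real.log d := ENNReal.toReal_ofReal (by linarith)
      have hr2 : 2 ≤ r := by simpa [hr] using ENNReal.ofReal_le_ofReal hl
      have hrt : r ≠ ∞ := ENNReal.ofReal_ne_top
      have he : 1 ≤ Real.exp 2 := Real.one_le_exp (by norm_num)
      have hrq : r ≤ dualExp p := by
        rw [← ENNReal.ofReal_toReal hqt]
        exact ENNReal.ofReal_le_ofReal (by nlinarith)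
      have hr1 : 1 ≤ r := le_trans (by norm_num) hr2
      -- Here κ_+ = log d − 1 is the smoothness constant of ℓ_{log d}, so κ/κ_+ = e² and the norms
      -- must agree up to a factor e.
      refine ⟨hnq, isNormOn_ellNorm hr1, Real.log d - 1, by linarith, by nlinarith, ?_,
        fun x => ⟨?_, ?_⟩⟩
      · rw [← hrr]; exact isSmoothNorm_ellNorm hr2 hrt
      · exact pow_le_pow_left₀ (hnq.nonneg x) (ellNorm_anti hr1 hrq hqt x) 2
      · rw [mul_div_cancel_right₀ _ (by linarith)]
        have h := ellNorm_le_card_rpow_mul hr1 hrq hqt x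
        have hq0 : 0 < 1 / (dualExp p).toReal := by positivity
        -- The factor d^{1/r} with r = log d is exactly e, and d^{−1/q} ≤ 1.
        have h2 : (d : ℝ) ^ (1 / r.toReal - 1 / (dualExp p).toReal) ≤ Real.exp 1 := by
          rw [Real.rpow_def_of_pos (by linarith)]
          refine Real.exp_le_exp.2 ?_
          rw [hrr, mul_sub, mul_one_div_cancel (by linarith)]
          nlinarith
        have h3 : ellNorm r x ≤ Real.exp 1 * ellNorm (dualExp p) x :=
          h.trans (mul_le_mul_of_nonneg_right h2 (hnq.nonneg x))
        have h4 : Real.exp 2 = Real.exp 1 ^ 2 := by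
          rw [← Real.exp_nat_mul]; norm_num
        rw [h4, ← mul_pow]
        exact pow_le_pow_left₀ ((isNormOn_ellNorm (d := d) hr1).nonneg x) h3 2
    · have hN : plusNorm p = fun x : Fin d → ℝ => ellNorm (dualExp p) x := by
        ext x; simp [plusNorm, hp2, hU]
      rw [hN, kappaQ, if_pos hp2, if_neg hU]
      refine ⟨hnq, hnq, _, by linarith, le_rfl, isSmoothNorm_ellNorm hq2 hqt, fun x => ⟨le_rfl, ?_⟩⟩
      rw [div_self (by linarith), one_mul]
  · have hN : plusNorm p
        = fun x : Fin d → ℝ => (d : ℝ) ^ (1 / 2 - (p⁻¹).toReal) * ellNorm 2 x := by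
      ext x; simp [plusNorm, hp2]
    rw [hN, kappaQ, if_neg hp2]
    push Not at hp2
    have hpr : (p⁻¹).toReal ≤ 1 / 2 := by
      have := ENNReal.toReal_mono (by simp) (ENNReal.inv_le_inv.2 hp2.le)
      simpa using this
    have hq2r : (dualExp p).toReal ≤ 2 := by
      have h4 : 1 / 2 ≤ 1 / (dualExp p).toReal := by linarith
      exact (one_div_le_one_div (by norm_num) (by linarith)).1 h4
    have hq2 : dualExp p ≤ 2 := by
      rw [← ENNReal.ofReal_toReal hqt]
      simpa using ENNReal.ofReal_le_ofReal hq2r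
    have hc : 0 < (d : ℝ) ^ (1 / 2 - (p⁻¹).toReal) := by positivity
    have hc2 : ((d : ℝ) ^ (1 / 2 - (p⁻¹).toReal)) ^ 2 = (d : ℝ) ^ (1 - 2 * (p⁻¹).toReal) := by
      rw [← Real.rpow_natCast, ← Real.rpow_mul (by positivity)]
      congr 1; push_cast; ring
    have hn2 := isNormOn_ellNorm (d := d) (p := 2) (by norm_num)
    refine ⟨hnq, hn2.const_mul hc, 1, le_rfl, Real.one_le_rpow hd' (by linarith),
      isSmoothNorm_const_mul_ellNorm_two _, fun x => ⟨?_, ?_⟩⟩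
    · refine pow_le_pow_left₀ (hnq.nonneg x) ?_ 2
      have h := ellNorm_le_card_rpow_mul hq1 hq2 (by simp) x
      rwa [show 1 / (dualExp p).toReal - 1 / (2 : ℝ≥0∞).toReal = 1 / 2 - (p⁻¹).toReal by
        rw [ENNReal.toReal_ofNat]; linarith] at h
    · rw [mul_pow, hc2, div_one]
      gcongr
      · exact hn2.nonneg x
      · exact ellNorm_anti hq1 hq2 (by simp) x

/-! ### Smoothing of a regular norm and exponential moments -/

theorem clm_apply_eq_dotProduct {d : ℕ} (l : (Fin d → ℝ) →L[ℝ] ℝ) (x : Fin d → ℝ) :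
    l x = (fun i => l (Pi.single i 1)) ⬝ᵥ x := by
  have := LinearMap.pi_apply_eq_sum_univ l.toLinearMap x
  simp only [ContinuousLinearMap.coe_coe, smul_eq_mul] at this
  rw [this, dotProduct]
  refine Finset.sum_congr rfl fun i _ => ?_
  rw [mul_comm]
  congr 2
  ext j
  simp [Pi.single_apply, eq_comm]

theorem IsSmoothNorm.continuous {d : ℕ} {N : (Fin d → ℝ) → ℝ} {κ : ℝ} (hN : IsNormOn N)
    (h : IsSmoothNorm N κ) : Continuous N := by
  have h1 : N = fun x => √(N x ^ 2) := by
    ext x; rw [Real.sqrt_sq (hN.nonneg x)]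
  rw [h1]
  exact Real.continuous_sqrt.comp h.1.continuous

/-- A regular norm is within `τ / 2` of a `1`-Lipschitz function (its infimal convolution with the
square of the smooth norm) that is `κ / τ`-smooth. -/
theorem exists_smooth_approx {d : ℕ} {q : ℝ≥0∞} (hq : 1 ≤ q) {N : (Fin d → ℝ) → ℝ} {κ τ : ℝ}
    (hreg : IsRegularNorm (fun x : Fin d → ℝ => ellNorm q x) N κ) (hτ : 0 < τ) :
    ∃ V : (Fin d → ℝ) → ℝ, Continuous V ∧ (∀ ξ, V ξ ≤ ellNorm q ξ) ∧
      (∀ ξ, ellNorm q ξ - τ / 2 ≤ V ξ) ∧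
      ∀ ξ, ∃ η : Fin d → ℝ, (∀ ζ, η ⬝ᵥ ζ ≤ ellNorm q ζ) ∧
        ∀ ζ, V (ξ + ζ) ≤ V ξ + η ⬝ᵥ ζ + κ / (2 * τ) * ellNorm q ζ ^ 2 := by
  obtain ⟨hn, hN, κp, hκp, hκ, hsm, hcmp⟩ := hreg
  have hnc : Continuous fun x : Fin d → ℝ => ellNorm q x := continuous_ellNorm hq
  have hNc : Continuous N := hsm.continuous hN
  have hex : ∀ ξ : Fin d → ℝ, ∃ u, ∀ v, ellNorm q u + N (ξ - u) ^ 2 / (2 * τ)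
      ≤ ellNorm q v + N (ξ - v) ^ 2 / (2 * τ) := fun ξ => by
    have hc : Continuous fun v => ellNorm q v + N (ξ - v) ^ 2 / (2 * τ) :=
      hnc.add (((hNc.comp (continuous_const.sub continuous_id)).pow 2).div_const _)
    refine hc.exists_forall_le (Filter.tendsto_atTop_mono (fun v => ?_)
      (tendsto_norm_cocompact_atTop (E := Fin d → ℝ)))
    have h1 : ‖v‖ ≤ ellNorm q v :=
      (pi_norm_le_iff_of_nonneg (hn.nonneg v)).2 fun i => abs_apply_le_ellNorm hq v i
    have h2 : 0 ≤ N (ξ - v) ^ 2 / (2 * τ) := by positivity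
    linarith
  choose u hu using hex
  set V : (Fin d → ℝ) → ℝ := fun ξ => ellNorm q (u ξ) + N (ξ - u ξ) ^ 2 / (2 * τ) with hV
  -- The translated minimizer u(ξ) + ζ is a competitor at ξ + ζ and leaves the N² term unchanged.
  -- For the quadratic bound below the competitor is u(ξ) itself, which leaves the ℓ_q term
  -- unchanged.
  have hLip : ∀ ξ ζ, V (ξ + ζ) ≤ V ξ + ellNorm q ζ := fun ξ ζ => by
    have h1 := hu (ξ + ζ) (u ξ + ζ)
    rw [add_sub_add_right_eq_sub] at h1
    have h2 := hn.add_le (u ξ) ζ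
    simp only [hV]
    linarith
  have hquad : ∀ ξ ζ, V (ξ + ζ) ≤ V ξ
      + (fun i => (1 / (2 * τ)) * fderiv ℝ (fun x => N x ^ 2) (ξ - u ξ) (Pi.single i 1)) ⬝ᵥ ζ
      + κ / (2 * τ) * ellNorm q ζ ^ 2 := fun ξ ζ => by
    have h1 := hu (ξ + ζ) (u ξ)
    have h2 := hsm.2 (ξ - u ξ) ζ
    have h3 : κp * N ζ ^ 2 ≤ κ * ellNorm q ζ ^ 2 := by
      have := mul_le_mul_of_nonneg_left (hcmp ζ).2 (by linarith : 0 ≤ κp)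
      rwa [← mul_assoc, mul_div_cancel₀ _ (by linarith)] at this
    rw [show ξ - u ξ + ζ = ξ + ζ - u ξ by abel] at h2
    have h4 : (fun i => (1 / (2 * τ)) * fderiv ℝ (fun x => N x ^ 2) (ξ - u ξ) (Pi.single i 1)) ⬝ᵥ ζ
        = (1 / (2 * τ)) * fderiv ℝ (fun x => N x ^ 2) (ξ - u ξ) ζ := by
      rw [clm_apply_eq_dotProduct _ ζ]
      simp only [dotProduct, Finset.mul_sum, mul_assoc]
    rw [h4]
    have h5 : N (ξ + ζ - u ξ) ^ 2 / (2 * τ) ≤ N (ξ - u ξ) ^ 2 / (2 * τ)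
        + (1 / (2 * τ)) * fderiv ℝ (fun x => N x ^ 2) (ξ - u ξ) ζ
        + κ / (2 * τ) * ellNorm q ζ ^ 2 := by
      rw [show N (ξ - u ξ) ^ 2 / (2 * τ)
        + (1 / (2 * τ)) * fderiv ℝ (fun x => N x ^ 2) (ξ - u ξ) ζ
        + κ / (2 * τ) * ellNorm q ζ ^ 2 = (N (ξ - u ξ) ^ 2
        + fderiv ℝ (fun x => N x ^ 2) (ξ - u ξ) ζ + κ * ellNorm q ζ ^ 2) / (2 * τ) by ring]
      gcongr
      linarith
    simp only [hV]
    linarith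
  refine ⟨V, ?_, fun ξ => ?_, fun ξ => ?_, fun ξ => ⟨_, fun ζ => ?_, hquad ξ⟩⟩
  · obtain ⟨C, hC, h⟩ := ellNorm_le_opNorm_mul (d := d) hq
    refine (LipschitzWith.of_le_add_mul ⟨C, hC⟩ fun x y => ?_).continuous
    have h1 := hLip y (x - y)
    rw [add_sub_cancel] at h1
    rw [dist_eq_norm]
    exact h1.trans (by gcongr; exact h _)
  · have := hu ξ ξ
    rw [sub_self, hN.map_zero] at this
    simpa using this
  · have h1 := hn.add_le (u ξ) (ξ - u ξ)
    rw [add_sub_cancel] at h1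
    -- This is r − τ/2 ≤ r²/(2τ), that is (r − τ)² ≥ 0.
    have h2 : ellNorm q (ξ - u ξ) - τ / 2 ≤ N (ξ - u ξ) ^ 2 / (2 * τ) := by
      rw [le_div_iff₀ (by linarith)]
      have := (hcmp (ξ - u ξ)).1
      simp only at this
      nlinarith [sq_nonneg (ellNorm q (ξ - u ξ) - τ)]
    simp only [hV]
    linarith
  · set η := fun i => (1 / (2 * τ)) * fderiv ℝ (fun x => N x ^ 2) (ξ - u ξ) (Pi.single i 1)
    -- The Lipschitz bound and the quadratic bound at −sζ confine the slope up to an error of order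
    -- s; letting s tend to 0 puts η in the dual unit ball.
    have h1 : ∀ s : ℝ, 0 < s →
        η ⬝ᵥ ζ ≤ ellNorm q ζ + s * (κ / (2 * τ) * ellNorm q ζ ^ 2) := fun s hs => by
      have h2 := hquad ξ (-(s • ζ))
      have h3 := hLip (ξ + -(s • ζ)) (s • ζ)
      rw [neg_add_cancel_right] at h3
      have h4 : ellNorm q (-(s • ζ)) = s * ellNorm q ζ := by
        rw [hn.map_neg, hn.smul_eq, abs_of_pos hs]
      have h5 : ellNorm q (s • ζ) = s * ellNorm q ζ := by
        rw [hn.smul_eq, abs_of_pos hs]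
      rw [h4, dotProduct_neg, dotProduct_smul, smul_eq_mul] at h2
      rw [h5] at h3
      refine le_of_mul_le_mul_left ?_ hs
      linarith
    have hlim : Filter.Tendsto (fun s : ℝ => ellNorm q ζ + s * (κ / (2 * τ) * ellNorm q ζ ^ 2))
        (nhdsWithin 0 (Set.Ioi 0)) (nhds (ellNorm q ζ + 0 * (κ / (2 * τ) * ellNorm q ζ ^ 2))) :=
      ((continuous_const.add (continuous_id.mul continuous_const)).tendsto 0).mono_left
        nhdsWithin_le_nhds
    rw [zero_mul, add_zero] at hlim
    exact ge_of_tendsto hlim (by filter_upwards [self_mem_nhdsWithin] with s hs using h1 s hs)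

/-- One step of the exponential supermartingale. -/
theorem lintegral_exp_smooth_approx_le {d : ℕ} {q : ℝ≥0∞} (hq : 1 ≤ q) {V : (Fin d → ℝ) → ℝ}
    {κ τ b l : ℝ} (hκ : 0 ≤ κ) (hτ : 0 < τ) (hl : 0 ≤ l) (ξ : Fin d → ℝ) {η : Fin d → ℝ}
    (hη : ∀ ζ, η ⬝ᵥ ζ ≤ ellNorm q ζ)
    (hV : ∀ ζ, V (ξ + ζ) ≤ V ξ + η ⬝ᵥ ζ + κ / (2 * τ) * ellNorm q ζ ^ 2)
    {Y : Type*} [MeasurableSpace Y] {μ : Measure Y} [IsProbabilityMeasure μ]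
    {ζ : Y → Fin d → ℝ} (hζ : Measurable ζ) (hb : ∀ y, ellNorm q (ζ y) ≤ b)
    (h0 : ∀ i, ∫ y, ζ y i ∂μ = 0) :
    ∫⁻ y, ENNReal.ofReal (Real.exp (l * V (ξ + ζ y))) ∂μ ≤
      ENNReal.ofReal (Real.exp (l * (κ * b ^ 2 / (2 * τ)) + l ^ 2 * b ^ 2 / 2))
        * ENNReal.ofReal (Real.exp (l * V ξ)) := by
  have hn := isNormOn_ellNorm (d := d) hq
  obtain ⟨y0⟩ := nonempty_of_isProbabilityMeasure μ
  have hb0 : 0 ≤ b := (hn.nonneg _).trans (hb y0)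
  have hXm : Measurable fun y => η ⬝ᵥ ζ y := by
    simp only [dotProduct]
    exact Finset.measurable_sum _ fun i _ => ((measurable_pi_apply i).comp hζ).const_mul _
  have hX : ∀ y, η ⬝ᵥ ζ y ∈ Set.Icc (-b) b := fun y => by
    have h1 := hη (-(ζ y))
    rw [dotProduct_neg, hn.map_neg] at h1
    exact ⟨by linarith [hb y], (hη _).trans (hb y)⟩
  have hX0 : ∫ y, η ⬝ᵥ ζ y ∂μ = 0 := by
    simp only [dotProduct]
    rw [integral_finsetSum]
    · simp [integral_const_mul, h0]
    · intro i _
      refine Integrable.const_mul (Integrable.of_bound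
        ((measurable_pi_apply i).comp hζ).aestronglyMeasurable b (Filter.Eventually.of_forall
          fun y => (abs_apply_le_ellNorm hq (ζ y) i).trans (hb y))) _
  -- Hoeffding's lemma for the centered variable η·ζ in [−b, b], with variance proxy b².
  have hsub := hasSubgaussianMGF_of_mem_Icc_of_integral_eq_zero hXm.aemeasurable
    (Filter.Eventually.of_forall hX) hX0
  have hmgf := hsub.mgf_le l
  have hint := hsub.integrable_exp_mul l
  have hc : (((‖b - -b‖₊ / 2) ^ 2 : NNReal) : ℝ) = b ^ 2 := by
    push_cast
    rw [Real.norm_of_nonneg (by linarith)]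
    ring
  rw [hc, mgf] at hmgf
  have hpt : ∀ y, Real.exp (l * V (ξ + ζ y)) ≤
      Real.exp (l * (κ * b ^ 2 / (2 * τ)) + l * V ξ) * Real.exp (l * (η ⬝ᵥ ζ y)) := fun y => by
    rw [← Real.exp_add]
    refine Real.exp_le_exp.2 ?_
    have h1 : κ / (2 * τ) * ellNorm q (ζ y) ^ 2 ≤ κ / (2 * τ) * b ^ 2 := by
      have := hn.nonneg (ζ y)
      gcongr
      exact hb y
    have h2 : κ / (2 * τ) * b ^ 2 = κ * b ^ 2 / (2 * τ) := by ring
    have := mul_le_mul_of_nonneg_left (hV (ζ y)) hl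
    nlinarith
  calc ∫⁻ y, ENNReal.ofReal (Real.exp (l * V (ξ + ζ y))) ∂μ
      ≤ ∫⁻ y, ENNReal.ofReal (Real.exp (l * (κ * b ^ 2 / (2 * τ)) + l * V ξ)
          * Real.exp (l * (η ⬝ᵥ ζ y))) ∂μ :=
        lintegral_mono fun y => ENNReal.ofReal_le_ofReal (hpt y)
    _ = ENNReal.ofReal (∫ y, Real.exp (l * (κ * b ^ 2 / (2 * τ)) + l * V ξ)
          * Real.exp (l * (η ⬝ᵥ ζ y)) ∂μ) :=
        (ofReal_integral_eq_lintegral_ofReal (hint.const_mul _)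
          (Filter.Eventually.of_forall fun y => by positivity)).symm
    _ ≤ _ := by
        rw [← ENNReal.ofReal_mul (by positivity), integral_const_mul]
        refine ENNReal.ofReal_le_ofReal ?_
        refine (mul_le_mul_of_nonneg_left hmgf (by positivity)).trans (le_of_eq ?_)
        rw [← Real.exp_add, ← Real.exp_add]
        congr 1
        ring

/-! ### The stochastic convex optimization problem -/

namespace StronglyConvexSCO

variable {d : ℕ} {X : Type*} [MeasurableSpace X] {p : ℝ≥0∞} {C : Set (Fin d → ℝ)} {P : Measure X}
  {f : (Fin d → ℝ) → X → ℝ} {θs : Fin d → ℝ} {D μ β G L γ : ℝ}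

theorem uniqueDiffOn (h : StronglyConvexSCO p C P f θs D μ β G L γ) : UniqueDiffOn ℝ C :=
  uniqueDiffOn_convex h.convex ⟨θs, h.mem_interior⟩

theorem minimizer_mem (h : StronglyConvexSCO p C P f θs D μ β G L γ) : θs ∈ C :=
  interior_subset h.mem_interior

theorem ellNorm_sub_le (h : StronglyConvexSCO p C P f θs D μ β G L γ) {x y : Fin d → ℝ}
    (hx : x ∈ C) (hy : y ∈ C) : ellNorm p (x - y) ≤ D :=
  h.diam.1 ⟨x, hx, y, hy, rfl⟩

/-- An empty frontier would make the set of distances empty, and the empty set has no greatest lower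
bound in ℝ. The resulting point at distance at least γ from θ* excludes degenerate C and yields D >
0 and, through μ ≤ 2β, β > 0. -/
theorem exists_frontier (h : StronglyConvexSCO p C P f θs D μ β G L γ) :
    ∃ v ∈ C, γ ≤ ellNorm p (v - θs) := by
  have hne : {r : ℝ | ∃ v ∈ frontier C, r = ellNorm p (v - θs)}.Nonempty := by
    by_contra hne
    rw [Set.not_nonempty_iff_eq_empty] at hne
    have := h.boundary_dist
    rw [hne, isGLB_empty_iff] at this
    exact not_isTop _ this
  obtain ⟨r, v, hv, rfl⟩ := hne
  exact ⟨v, h.isCompact.isClosed.frontier_subset hv, h.boundary_dist.1 ⟨v, hv, rfl⟩⟩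

theorem gamma_le_diam (h : StronglyConvexSCO p C P f θs D μ β G L γ) : γ ≤ D := by
  obtain ⟨v, hv, hγ⟩ := h.exists_frontier
  exact hγ.trans (h.ellNorm_sub_le hv h.minimizer_mem)

theorem diam_pos (h : StronglyConvexSCO p C P f θs D μ β G L γ) : 0 < D :=
  h.gamma_pos.trans_le h.gamma_le_diam

theorem nonempty [IsProbabilityMeasure P] (_ : StronglyConvexSCO p C P f θs D μ β G L γ) :
    Nonempty X := nonempty_of_isProbabilityMeasure P

theorem smooth_nonneg [IsProbabilityMeasure P] (hp : 1 < p)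
    (h : StronglyConvexSCO p C P f θs D μ β G L γ) : 0 ≤ β := by
  obtain ⟨x⟩ := h.nonempty
  obtain ⟨v, hv, hγ⟩ := h.exists_frontier
  have h1 := ((isNormOn_ellNorm (d := d) (dualExp_facts hp).1).nonneg _).trans
    (h.smooth v hv θs h.minimizer_mem x)
  exact nonneg_of_mul_nonneg_left h1 (h.gamma_pos.trans_le hγ)

theorem grad_bound_nonneg [IsProbabilityMeasure P] (hp : 1 < p)
    (h : StronglyConvexSCO p C P f θs D μ β G L γ) : 0 ≤ G := by
  obtain ⟨x⟩ := h.nonempty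
  exact ((isNormOn_ellNorm (d := d) (dualExp_facts hp).1).nonneg _).trans
    (h.grad_bound θs h.minimizer_mem x)

theorem lipschitz_nonneg [IsProbabilityMeasure P] (hp : 1 < p)
    (h : StronglyConvexSCO p C P f θs D μ β G L γ) : 0 ≤ L := by
  obtain ⟨x⟩ := h.nonempty
  exact ((isNormOn_ellNorm (d := d) (dualExp_facts hp).1).nonneg _).trans
    (h.lipschitz θs h.minimizer_mem x)

theorem hasFDerivWithinAt_loss (h : StronglyConvexSCO p C P f θs D μ β G L γ) (x : X)
    {θ : Fin d → ℝ} (hθ : θ ∈ C) :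
    HasFDerivWithinAt (fun θ => f θ x) (fderivWithin ℝ (fun θ => f θ x) C θ) C θ :=
  (h.differentiable x θ hθ).hasFDerivWithinAt

/-- By the mean value theorem the increment is the gradient at a point of the segment, which
smoothness compares with the gradient at θ₂. This gives β instead of β/2, at the cost of constants
only. -/
theorem abs_taylor_loss_le [IsProbabilityMeasure P] (hp : 1 < p)
    (h : StronglyConvexSCO p C P f θs D μ β G L γ) (x : X) {θ₁ θ₂ : Fin d → ℝ}
    (h₁ : θ₁ ∈ C) (h₂ : θ₂ ∈ C) :
    |f θ₁ x - f θ₂ x - gradOn C (fun θ => f θ x) θ₂ ⬝ᵥ (θ₁ - θ₂)|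
      ≤ β * ellNorm p (θ₁ - θ₂) ^ 2 := by
  have hn := isNormOn_ellNorm (d := d) hp.le
  obtain ⟨z, hz, hfz⟩ := domain_mvt (fun θ hθ => h.hasFDerivWithinAt_loss x hθ) h.convex h₂ h₁
  have hzC : z ∈ C := h.convex.segment_subset h₂ h₁ hz
  rw [clm_apply_eq_dotProduct] at hfz
  change f θ₁ x - f θ₂ x = gradOn C (fun θ => f θ x) z ⬝ᵥ (θ₁ - θ₂) at hfz
  rw [hfz, ← sub_dotProduct]
  have hzd : ellNorm p (z - θ₂) ≤ ellNorm p (θ₁ - θ₂) := by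
    obtain ⟨a, b, ha, hb, hab, rfl⟩ := hz
    have : a • θ₂ + b • θ₁ - θ₂ = b • (θ₁ - θ₂) := by
      rw [show a = 1 - b by linarith]; module
    rw [this, hn.smul_eq, abs_of_nonneg hb]
    exact mul_le_of_le_one_left (hn.nonneg _) (by linarith)
  have hβ := h.smooth_nonneg hp
  calc _ ≤ _ := abs_dotProduct_le_ellNorm hp _ _
    _ ≤ β * ellNorm p (z - θ₂) * ellNorm p (θ₁ - θ₂) :=
      mul_le_mul_of_nonneg_right (h.smooth z hzC θ₂ h₂ x) (hn.nonneg _)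
    _ ≤ β * ellNorm p (θ₁ - θ₂) * ellNorm p (θ₁ - θ₂) := by
      have := hn.nonneg (θ₁ - θ₂)
      gcongr
    _ = _ := by ring

/-! ### Measurability of the gradients and differentiation under the expectation -/

theorem measurable_grad_dotProduct (h : StronglyConvexSCO p C P f θs D μ β G L γ)
    {θ θ' : Fin d → ℝ} (hθ : θ ∈ C) (hθ' : θ' ∈ C) :
    Measurable fun x => gradOn C (fun θ => f θ x) θ ⬝ᵥ (θ' - θ) := by
  have hmem : ∀ n : ℕ, θ + (1 / ((n : ℝ) + 1)) • (θ' - θ) ∈ C := fun n => by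
    have h1 : 1 / ((n : ℝ) + 1) ≤ 1 := by
      rw [div_le_one (by positivity)]; linarith [Nat.cast_nonneg (α := ℝ) n]
    exact h.convex.add_smul_sub_mem hθ hθ' ⟨by positivity, h1⟩
  refine measurable_of_tendsto_metrizable (f := fun (n : ℕ) x =>
    ((n : ℝ) + 1) • (f (θ + (1 / ((n : ℝ) + 1)) • (θ' - θ)) x - f θ x)) (fun n => ?_) ?_
  · exact ((h.measurable _ (hmem n)).sub (h.measurable θ hθ)).const_smul ((n : ℝ) + 1)
  · rw [tendsto_pi_nhds]
    intro x
    have h1 := (h.hasFDerivWithinAt_loss x hθ).lim (l := Filter.atTop)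
      (c := fun n : ℕ => (n : ℝ) + 1) (d := fun n : ℕ => (1 / ((n : ℝ) + 1)) • (θ' - θ))
      (v := θ' - θ) ?_ (Filter.Eventually.of_forall hmem) ?_
    · rw [clm_apply_eq_dotProduct] at h1
      exact h1
    · simpa using (tendsto_one_div_add_atTop_nhds_zero_nat (𝕜 := ℝ)).smul_const (θ' - θ)
    · refine tendsto_const_nhds.congr fun n => ?_
      rw [smul_smul, mul_one_div_cancel (by positivity), one_smul]

/-- At a boundary point only difference quotients in directions that stay in C are available. Each
coordinate direction is a multiple of the difference of two of them, pointing to θ* and to θ* + s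
e_i, both in C because θ* is interior. -/
theorem measurable_grad (h : StronglyConvexSCO p C P f θs D μ β G L γ) {θ : Fin d → ℝ}
    (hθ : θ ∈ C) : Measurable fun x => gradOn C (fun θ => f θ x) θ := by
  refine measurable_pi_lambda _ fun i => ?_
  obtain ⟨s, hs, hsC⟩ : ∃ s : ℝ, 0 < s ∧ θs + s • Pi.single i (1 : ℝ) ∈ C := by
    have hc : Filter.Tendsto (fun s : ℝ => θs + s • (Pi.single i (1 : ℝ) : Fin d → ℝ))
        (nhdsWithin 0 (Set.Ioi 0)) (nhds θs) := by
      have : Continuous fun s : ℝ => θs + s • (Pi.single i (1 : ℝ) : Fin d → ℝ) := by fun_prop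
      have h1 := this.tendsto 0
      rw [zero_smul, add_zero] at h1
      exact h1.mono_left nhdsWithin_le_nhds
    have h1 := hc.eventually (mem_interior_iff_mem_nhds.1 h.mem_interior)
    obtain ⟨s, hs1, hs2⟩ := (h1.and self_mem_nhdsWithin).exists
    exact ⟨s, hs2, hs1⟩
  have heq : (fun x => gradOn C (fun θ => f θ x) θ i) = fun x => s⁻¹ *
      (gradOn C (fun θ => f θ x) θ ⬝ᵥ (θs + s • Pi.single i (1 : ℝ) - θ)
        - gradOn C (fun θ => f θ x) θ ⬝ᵥ (θs - θ)) := by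
    ext x
    rw [← dotProduct_sub, show θs + s • Pi.single i (1 : ℝ) - θ - (θs - θ)
      = s • (Pi.single i (1 : ℝ) : Fin d → ℝ) by abel, dotProduct_smul, dotProduct_single,
      mul_one, smul_eq_mul, inv_mul_cancel_left₀ hs.ne']
  rw [heq]
  exact ((h.measurable_grad_dotProduct hθ hsC).sub
    (h.measurable_grad_dotProduct hθ h.minimizer_mem)).const_mul _

theorem integrable_grad [IsProbabilityMeasure P] (hp : 1 < p)
    (h : StronglyConvexSCO p C P f θs D μ β G L γ) {θ : Fin d → ℝ} (hθ : θ ∈ C) (i : Fin d) :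
    Integrable (fun x => gradOn C (fun θ => f θ x) θ i) P :=
  Integrable.of_bound ((measurable_pi_apply i).comp (h.measurable_grad hθ)).aestronglyMeasurable L
    (Filter.Eventually.of_forall fun x =>
      (abs_apply_le_ellNorm (dualExp_facts hp).1 _ i).trans (h.lipschitz θ hθ x))

theorem integrable_grad_dotProduct [IsProbabilityMeasure P] (hp : 1 < p)
    (h : StronglyConvexSCO p C P f θs D μ β G L γ) {θ : Fin d → ℝ} (hθ : θ ∈ C)
    (v : Fin d → ℝ) : Integrable (fun x => gradOn C (fun θ => f θ x) θ ⬝ᵥ v) P := by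
  simp only [dotProduct]
  exact integrable_finsetSum _ fun i _ => (h.integrable_grad hp hθ i).mul_const _

theorem integral_grad_dotProduct [IsProbabilityMeasure P] (hp : 1 < p)
    (h : StronglyConvexSCO p C P f θs D μ β G L γ) {θ : Fin d → ℝ} (hθ : θ ∈ C)
    (v : Fin d → ℝ) : ∫ x, gradOn C (fun θ => f θ x) θ ⬝ᵥ v ∂P
      = (fun i => ∫ x, gradOn C (fun θ => f θ x) θ i ∂P) ⬝ᵥ v := by
  simp only [dotProduct]
  rw [integral_finsetSum _ fun i _ => (h.integrable_grad hp hθ i).mul_const _]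
  simp only [integral_mul_const]

theorem abs_taylor_integral_le [IsProbabilityMeasure P] (hp : 1 < p)
    (h : StronglyConvexSCO p C P f θs D μ β G L γ) {θ₁ θ₂ : Fin d → ℝ}
    (h₁ : θ₁ ∈ C) (h₂ : θ₂ ∈ C) :
    |populationLoss P f θ₁ - populationLoss P f θ₂
      - (fun i => ∫ x, gradOn C (fun θ => f θ x) θ₂ i ∂P) ⬝ᵥ (θ₁ - θ₂)|
      ≤ β * ellNorm p (θ₁ - θ₂) ^ 2 := by
  have hi : Integrable (fun x => f θ₁ x - f θ₂ x) P :=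
    (h.integrable θ₁ h₁).sub (h.integrable θ₂ h₂)
  have hg := h.integrable_grad_dotProduct hp h₂ (θ₁ - θ₂)
  rw [← h.integral_grad_dotProduct hp h₂, populationLoss, populationLoss,
    ← integral_sub (h.integrable θ₁ h₁) (h.integrable θ₂ h₂), ← integral_sub hi hg,
    ← Real.norm_eq_abs]
  refine (norm_integral_le_of_norm_le_const (μ := P) (C := β * ellNorm p (θ₁ - θ₂) ^ 2)
    (Filter.Eventually.of_forall fun x => h.abs_taylor_loss_le hp x h₁ h₂)).trans (le_of_eq ?_)
  simp

/-- The quadratic Taylor bound is uniform in the sample, so it survives integration and gives the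
derivative directly. -/
theorem hasFDerivWithinAt_populationLoss [IsProbabilityMeasure P] (hp : 1 < p)
    (h : StronglyConvexSCO p C P f θs D μ β G L γ) {θ : Fin d → ℝ} (hθ : θ ∈ C) :
    HasFDerivWithinAt (populationLoss P f)
      (∑ i, (∫ x, gradOn C (fun θ => f θ x) θ i ∂P)
        • (ContinuousLinearMap.proj i : (Fin d → ℝ) →L[ℝ] ℝ)) C θ := by
  set l := ∑ i, (∫ x, gradOn C (fun θ => f θ x) θ i ∂P)
    • (ContinuousLinearMap.proj i : (Fin d → ℝ) →L[ℝ] ℝ) with hl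
  have hlv : ∀ v, l v = (fun i => ∫ x, gradOn C (fun θ => f θ x) θ i ∂P) ⬝ᵥ v := fun v => by
    simp [hl, dotProduct]
  obtain ⟨K, hK, hKn⟩ := ellNorm_le_opNorm_mul (d := d) hp.le
  have hβ := h.smooth_nonneg hp
  have h1 : HasFDerivWithinAt
      (fun θ' => populationLoss P f θ' - populationLoss P f θ - l (θ' - θ))
      (0 : (Fin d → ℝ) →L[ℝ] ℝ) C θ := by
    refine Asymptotics.IsBigO.hasFDerivWithinAt (n := 2) ?_ hθ (by norm_num)
    refine Asymptotics.IsBigO.of_bound (β * K ^ 2) ?_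
    filter_upwards [self_mem_nhdsWithin] with θ' hθ'
    rw [hlv]
    refine (h.abs_taylor_integral_le hp hθ' hθ).trans ?_
    rw [norm_pow, norm_norm, mul_assoc, ← mul_pow]
    have := (isNormOn_ellNorm (d := d) hp.le).nonneg (θ' - θ)
    gcongr
    exact hKn _
  have h2 : HasFDerivWithinAt (fun θ' => populationLoss P f θ + l (θ' - θ)) l C θ :=
    ((l.hasFDerivAt.comp θ ((hasFDerivAt_id θ).sub_const θ)).const_add _).hasFDerivWithinAt
  have h3 := h1.add h2
  rw [zero_add] at h3
  refine HasFDerivWithinAt.congr h3 (fun θ' _ => ?_) ?_ <;> simp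

theorem gradOn_populationLoss [IsProbabilityMeasure P] (hp : 1 < p)
    (h : StronglyConvexSCO p C P f θs D μ β G L γ) {θ : Fin d → ℝ} (hθ : θ ∈ C) :
    gradOn C (populationLoss P f) θ = fun i => ∫ x, gradOn C (fun θ => f θ x) θ i ∂P := by
  ext i
  rw [gradOn, (h.hasFDerivWithinAt_populationLoss hp hθ).fderivWithin (h.uniqueDiffOn θ hθ)]
  simp [Pi.single_apply]

theorem abs_taylor_populationLoss_le [IsProbabilityMeasure P] (hp : 1 < p)
    (h : StronglyConvexSCO p C P f θs D μ β G L γ) {θ₁ θ₂ : Fin d → ℝ}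
    (h₁ : θ₁ ∈ C) (h₂ : θ₂ ∈ C) :
    |populationLoss P f θ₁ - populationLoss P f θ₂
      - gradOn C (populationLoss P f) θ₂ ⬝ᵥ (θ₁ - θ₂)| ≤ β * ellNorm p (θ₁ - θ₂) ^ 2 := by
  rw [h.gradOn_populationLoss hp h₂]
  exact h.abs_taylor_integral_le hp h₁ h₂

theorem ellNorm_grad_populationLoss_sub_le [IsProbabilityMeasure P] (hp : 1 < p)
    (h : StronglyConvexSCO p C P f θs D μ β G L γ) {θ₁ θ₂ : Fin d → ℝ}
    (h₁ : θ₁ ∈ C) (h₂ : θ₂ ∈ C) :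
    ellNorm (dualExp p) (gradOn C (populationLoss P f) θ₁ - gradOn C (populationLoss P f) θ₂)
      ≤ β * ellNorm p (θ₁ - θ₂) := by
  have hn := isNormOn_ellNorm (d := d) hp.le
  have hβ := h.smooth_nonneg hp
  have hc : 0 ≤ β * ellNorm p (θ₁ - θ₂) := mul_nonneg hβ (hn.nonneg _)
  refine ellNorm_le_of_dotProduct_le hp hc fun u => ?_
  rw [h.gradOn_populationLoss hp h₁, h.gradOn_populationLoss hp h₂, sub_dotProduct,
    ← h.integral_grad_dotProduct hp h₁, ← h.integral_grad_dotProduct hp h₂,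
    ← integral_sub (h.integrable_grad_dotProduct hp h₁ u) (h.integrable_grad_dotProduct hp h₂ u)]
  refine (Real.le_norm_self _).trans ((norm_integral_le_of_norm_le_const (μ := P)
    (C := β * ellNorm p (θ₁ - θ₂) * ellNorm p u)
    (Filter.Eventually.of_forall fun x => ?_)).trans ?_)
  · rw [← sub_dotProduct]
    exact (abs_dotProduct_le_ellNorm hp _ _).trans
      (mul_le_mul_of_nonneg_right (h.smooth _ h₁ _ h₂ x) (hn.nonneg _))
  · simp

/-! ### The interior minimizer and the inexact Frank–Wolfe step -/

theorem grad_minimizer (h : StronglyConvexSCO p C P f θs D μ β G L γ) :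
    gradOn C (populationLoss P f) θs = 0 := by
  have hn := mem_interior_iff_mem_nhds.1 h.mem_interior
  have h1 : IsLocalMin (populationLoss P f) θs := h.minimizer.isLocalMin hn
  ext i
  rw [gradOn, fderivWithin_of_mem_nhds hn, h1.fderiv_eq_zero]
  simp

theorem ellNorm_grad_populationLoss_le [IsProbabilityMeasure P] (hp : 1 < p)
    (h : StronglyConvexSCO p C P f θs D μ β G L γ) {θ : Fin d → ℝ} (hθ : θ ∈ C) :
    ellNorm (dualExp p) (gradOn C (populationLoss P f) θ) ≤ β * D := by
  have h1 := h.ellNorm_grad_populationLoss_sub_le hp hθ h.minimizer_mem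
  rw [h.grad_minimizer, sub_zero] at h1
  exact h1.trans (mul_le_mul_of_nonneg_left (h.ellNorm_sub_le hθ h.minimizer_mem)
    (h.smooth_nonneg hp))

theorem excess_nonneg (h : StronglyConvexSCO p C P f θs D μ β G L γ) {θ : Fin d → ℝ}
    (hθ : θ ∈ C) : 0 ≤ populationLoss P f θ - populationLoss P f θs :=
  sub_nonneg.2 (h.minimizer hθ)

theorem excess_le [IsProbabilityMeasure P] (hp : 1 < p)
    (h : StronglyConvexSCO p C P f θs D μ β G L γ) {θ : Fin d → ℝ} (hθ : θ ∈ C) :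
    populationLoss P f θ - populationLoss P f θs ≤ β * D ^ 2 := by
  have h1 := h.abs_taylor_populationLoss_le hp hθ h.minimizer_mem
  rw [h.grad_minimizer, zero_dotProduct, sub_zero] at h1
  have h2 := (isNormOn_ellNorm (d := d) hp.le).nonneg (θ - θs)
  refine (le_abs_self _).trans (h1.trans ?_)
  have := h.smooth_nonneg hp
  gcongr
  exact h.ellNorm_sub_le hθ h.minimizer_mem

theorem mu_le [IsProbabilityMeasure P] (hp : 1 < p)
    (h : StronglyConvexSCO p C P f θs D μ β G L γ) : μ ≤ 2 * β := by
  obtain ⟨v, hv, hγ⟩ := h.exists_frontier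
  have h1 := h.strongly_convex v hv θs h.minimizer_mem
  have h2 := (abs_le.1 (h.abs_taylor_populationLoss_le hp hv h.minimizer_mem)).2
  have h3 : 0 < ellNorm p (v - θs) ^ 2 := pow_pos (h.gamma_pos.trans_le hγ) 2
  have h4 : μ / 2 ≤ β := le_of_mul_le_mul_right (by linarith) h3
  linarith

theorem smooth_pos [IsProbabilityMeasure P] (hp : 1 < p)
    (h : StronglyConvexSCO p C P f θs D μ β G L γ) : 0 < β := by
  linarith [h.mu_le hp, h.mu_pos]

/-- The γ-ball about θ* lies in C: a segment from the interior to a point outside C crosses the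
frontier before its end, hence at distance less than γ from θ*. -/
theorem add_smul_mem (hp : 1 < p) (h : StronglyConvexSCO p C P f θs D μ β G L γ)
    {u : Fin d → ℝ} (hu : ellNorm p u ≤ 1) : θs + γ • u ∈ C := by
  have hn := isNormOn_ellNorm (d := d) hp.le
  by_contra hout
  have hpre : IsPreconnected (segment ℝ θs (θs + γ • u)) := (convex_segment _ _).isPreconnected
  have hcl := h.isCompact.isClosed.closure_eq
  obtain ⟨v, hvs, hvf⟩ : (segment ℝ θs (θs + γ • u) ∩ frontier C).Nonempty := by
    by_contra hne
    have hsub : segment ℝ θs (θs + γ • u) ⊆ interior C ∪ (closure C)ᶜ := fun w hw => by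
      by_contra hw'
      rw [Set.mem_union, not_or, Set.mem_compl_iff, not_not] at hw'
      exact hne ⟨w, hw, hw'.2, hw'.1⟩
    obtain ⟨w, -, hw1, hw2⟩ := hpre (interior C) (closure C)ᶜ isOpen_interior
      isClosed_closure.isOpen_compl hsub ⟨θs, left_mem_segment ℝ _ _, h.mem_interior⟩
      ⟨θs + γ • u, right_mem_segment ℝ _ _, by rwa [hcl]⟩
    exact hw2 (subset_closure (interior_subset hw1))
  have hvC : v ∈ C := h.isCompact.isClosed.frontier_subset hvf
  have hγ : γ ≤ ellNorm p (v - θs) := h.boundary_dist.1 ⟨v, hvf, rfl⟩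
  obtain ⟨a, b, ha, hb, hab, rfl⟩ := hvs
  have h1 : a • θs + b • (θs + γ • u) - θs = (b * γ) • u := by
    rw [show a = 1 - b by linarith]; module
  rw [h1, hn.smul_eq, abs_of_nonneg (mul_nonneg hb h.gamma_pos.le)] at hγ
  have hb1 : b ≠ 1 := by
    rintro rfl
    apply hout
    have : a = 0 := by linarith
    simpa [this] using hvC
  have hb2 : b < 1 := lt_of_le_of_ne (by linarith) hb1
  have hγ0 := h.gamma_pos
  have h2 : b * γ * ellNorm p u ≤ b * γ * 1 := by gcongr
  nlinarith

/-- Strong convexity and Hölder's inequality bound the excess loss by ‖∇F‖_q r − μr²/2, where r is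
the distance to θ*; the maximum over r is ‖∇F‖_q²/(2μ). -/
theorem sqrt_excess_le [IsProbabilityMeasure P] (hp : 1 < p)
    (h : StronglyConvexSCO p C P f θs D μ β G L γ) {θ : Fin d → ℝ} (hθ : θ ∈ C) :
    √(2 * μ * (populationLoss P f θ - populationLoss P f θs))
      ≤ ellNorm (dualExp p) (gradOn C (populationLoss P f) θ) := by
  have hq := (isNormOn_ellNorm (d := d) (dualExp_facts hp).1).nonneg
    (gradOn C (populationLoss P f) θ)
  refine Real.sqrt_le_iff.2 ⟨hq, ?_⟩
  have h1 := h.strongly_convex θs h.minimizer_mem θ hθ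
  have h2 := (abs_le.1 (abs_dotProduct_le_ellNorm hp (gradOn C (populationLoss P f) θ)
    (θs - θ))).1
  have hμ := h.mu_pos
  nlinarith [sq_nonneg (μ * ellNorm p (θs - θ)
    - ellNorm (dualExp p) (gradOn C (populationLoss P f) θ))]

/-- One step of the Frank–Wolfe method with an inexact gradient. -/
theorem frank_wolfe_step [IsProbabilityMeasure P] (hp : 1 < p)
    (h : StronglyConvexSCO p C P f θs D μ β G L γ) {θ v δ : Fin d → ℝ} {s : ℝ} (hθ : θ ∈ C)
    (hv : v ∈ C) (hmin : ∀ w ∈ C, δ ⬝ᵥ v ≤ δ ⬝ᵥ w) (hs : s ∈ Set.Icc (0 : ℝ) 1) :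
    populationLoss P f (θ + s • (v - θ)) - populationLoss P f θs ≤
      (populationLoss P f θ - populationLoss P f θs)
      + s * (-(populationLoss P f θ - populationLoss P f θs)
        - γ * √(2 * μ * (populationLoss P f θ - populationLoss P f θs))
        + D * ellNorm (dualExp p) (δ - gradOn C (populationLoss P f) θ)) + β * D ^ 2 * s ^ 2 := by
  have hn := isNormOn_ellNorm (d := d) hp.le
  have hnq := isNormOn_ellNorm (d := d) (dualExp_facts hp).1
  have hβ := h.smooth_nonneg hp
  set g := gradOn C (populationLoss P f) θ with hg
  have hmem : θ + s • (v - θ) ∈ C := h.convex.add_smul_sub_mem hθ hv hs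
  have h1 := (abs_le.1 (h.abs_taylor_populationLoss_le hp hmem hθ)).2
  rw [add_sub_cancel_left, dotProduct_smul, hn.smul_eq, abs_of_nonneg hs.1, smul_eq_mul] at h1
  -- The comparison point θ* + γu, with u norming −∇F(θ), earns the additional decrease γ‖∇F(θ)‖_q
  -- over θ* itself.
  obtain ⟨u, hu, hgu⟩ := exists_dotProduct_eq_ellNorm hp (-g)
  rw [hnq.map_neg, neg_dotProduct] at hgu
  have hw : θs + γ • u ∈ C := h.add_smul_mem hp hu
  have h2 : g ⬝ᵥ (v - θ) ≤ g ⬝ᵥ (θs + γ • u - θ)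
      + (δ - g) ⬝ᵥ (θs + γ • u - v) := by
    have := hmin _ hw
    simp only [sub_dotProduct, dotProduct_sub]
    linarith
  have h3 : (δ - g) ⬝ᵥ (θs + γ • u - v) ≤ D * ellNorm (dualExp p) (δ - g) := by
    refine (dotProduct_le_ellNorm hp _ _).trans ?_
    rw [mul_comm]
    exact mul_le_mul_of_nonneg_right (h.ellNorm_sub_le hw hv) (hnq.nonneg _)
  have h4 : g ⬝ᵥ (θs + γ • u - θ) = g ⬝ᵥ (θs - θ) - γ * ellNorm (dualExp p) g := by
    rw [show θs + γ • u - θ = (θs - θ) + γ • u by abel, dotProduct_add, dotProduct_smul,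
      smul_eq_mul, ← hgu]
    ring
  have h5 := h.strongly_convex θs h.minimizer_mem θ hθ
  have h6 : 0 ≤ μ / 2 * ellNorm p (θs - θ) ^ 2 := by have := h.mu_pos; positivity
  have h7 := mul_le_mul_of_nonneg_left (h.sqrt_excess_le hp hθ) h.gamma_pos.le
  have h8 : s * (g ⬝ᵥ (v - θ)) ≤ s * (-(populationLoss P f θ - populationLoss P f θs)
        - γ * √(2 * μ * (populationLoss P f θ - populationLoss P f θs))
        + D * ellNorm (dualExp p) (δ - g)) := by
    refine mul_le_mul_of_nonneg_left ?_ hs.1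
    linarith
  have h9 : β * (s * ellNorm p (v - θ)) ^ 2 ≤ β * D ^ 2 * s ^ 2 := by
    rw [mul_pow, mul_comm (s ^ 2), ← mul_assoc]
    have := hn.nonneg (v - θ)
    gcongr
    exact h.ellNorm_sub_le hv hθ
  linarith

/-- Regroup as the deviation at θ plus a times the difference of the deviations at θ and θ'.
Smoothness makes the latter at most 2aβ‖θ − θ'‖_p, and `had` absorbs the factor a. -/
theorem ellNorm_recursive_gradient_error_le [IsProbabilityMeasure P] (hp : 1 < p)
    (h : StronglyConvexSCO p C P f θs D μ β G L γ) {θ θ' : Fin d → ℝ} (hθ : θ ∈ C)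
    (hθ' : θ' ∈ C) {a : ℝ} (ha : 0 ≤ a) (had : a * ellNorm p (θ - θ') ≤ D) (x : X) :
    ellNorm (dualExp p)
      (((a + 1) • gradOn C (fun θ => f θ x) θ - a • gradOn C (fun θ => f θ x) θ')
        - ((a + 1) • gradOn C (populationLoss P f) θ - a • gradOn C (populationLoss P f) θ'))
      ≤ G + 2 * β * D := by
  have hnq := isNormOn_ellNorm (d := d) (dualExp_facts hp).1
  have hβ := h.smooth_nonneg hp
  have h1 : ((a + 1) • gradOn C (fun θ => f θ x) θ - a • gradOn C (fun θ => f θ x) θ')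
        - ((a + 1) • gradOn C (populationLoss P f) θ - a • gradOn C (populationLoss P f) θ')
      = (gradOn C (fun θ => f θ x) θ - gradOn C (populationLoss P f) θ)
        + a • ((gradOn C (fun θ => f θ x) θ - gradOn C (fun θ => f θ x) θ')
          - (gradOn C (populationLoss P f) θ - gradOn C (populationLoss P f) θ')) := by module
  rw [h1]
  have h2 := h.grad_bound θ hθ x
  have h3 := h.smooth θ hθ θ' hθ' x
  have h4 := h.ellNorm_grad_populationLoss_sub_le hp hθ hθ'
  have h5 := hnq.sub_le (gradOn C (fun θ => f θ x) θ - gradOn C (fun θ => f θ x) θ')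
    (gradOn C (populationLoss P f) θ - gradOn C (populationLoss P f) θ')
  refine (hnq.add_le _ _).trans ?_
  simp only [hnq.smul_eq, abs_of_nonneg ha]
  have h6 := mul_le_mul_of_nonneg_left (h5.trans (add_le_add h3 h4)) ha
  nlinarith

theorem integral_recursive_gradient_error [IsProbabilityMeasure P] (hp : 1 < p)
    (h : StronglyConvexSCO p C P f θs D μ β G L γ) {θ θ' : Fin d → ℝ} (hθ : θ ∈ C)
    (hθ' : θ' ∈ C) (a : ℝ) (i : Fin d) :
    ∫ x, (((a + 1) • gradOn C (fun θ => f θ x) θ - a • gradOn C (fun θ => f θ x) θ')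
        - ((a + 1) • gradOn C (populationLoss P f) θ
          - a • gradOn C (populationLoss P f) θ')) i ∂P = 0 := by
  have hi := (h.integrable_grad hp hθ i).const_mul (a + 1)
  have hi' := (h.integrable_grad hp hθ' i).const_mul a
  have hii : Integrable (fun x => (a + 1) * gradOn C (fun θ => f θ x) θ i
    - a * gradOn C (fun θ => f θ x) θ' i) P := hi.sub hi'
  simp only [Pi.sub_apply, Pi.smul_apply, smul_eq_mul]
  rw [integral_sub hii (integrable_const _), integral_sub hi hi', integral_const_mul,
    integral_const_mul, h.gradOn_populationLoss hp hθ, h.gradOn_populationLoss hp hθ']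
  simp

theorem continuous_grad_loss [IsProbabilityMeasure P] (hp : 1 < p)
    (h : StronglyConvexSCO p C P f θs D μ β G L γ) (x : X) :
    Continuous fun θ : C => gradOn C (fun θ => f θ x) θ := by
  refine continuous_pi fun i => ?_
  obtain ⟨K, hK, hKn⟩ := ellNorm_le_opNorm_mul (d := d) hp.le
  have hβ := h.smooth_nonneg hp
  refine (LipschitzWith.of_le_add_mul' (β * K) fun θ₁ θ₂ => ?_).continuous
  have h1 := (le_abs_self _).trans ((abs_apply_le_ellNorm (dualExp_facts hp).1 _ i).trans
    (h.smooth θ₁ θ₁.2 θ₂ θ₂.2 x))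
  have h2 := mul_le_mul_of_nonneg_left (hKn (θ₁ - θ₂ : Fin d → ℝ)) hβ
  have h3 : dist θ₁ θ₂ = ‖(θ₁ - θ₂ : Fin d → ℝ)‖ := by rw [Subtype.dist_eq, dist_eq_norm]
  rw [h3]
  simp only [Pi.sub_apply] at h1 ⊢
  linarith

/-- The gradient is a Carathéodory function on C × X: continuous in θ and measurable in the sample,
hence jointly measurable. -/
theorem measurable_grad_comp [IsProbabilityMeasure P] (hp : 1 < p)
    (h : StronglyConvexSCO p C P f θs D μ β G L γ) {Y : Type*} [MeasurableSpace Y]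
    {a : Y → Fin d → ℝ} {b : Y → X} (ha : Measurable a) (hb : Measurable b)
    (haC : ∀ y, a y ∈ C) :
    Measurable fun y => gradOn C (fun θ => f θ (b y)) (a y) := by
  refine measurable_pi_lambda _ fun i => ?_
  have h1 : Measurable (Function.uncurry fun (θ : C) (x : X) => gradOn C (fun θ => f θ x) θ i) :=
    measurable_uncurry_of_continuous_of_measurable
      (fun x => (continuous_apply i).comp (h.continuous_grad_loss hp x))
      fun θ => (measurable_pi_apply i).comp (h.measurable_grad θ.2)
  exact h1.comp ((ha.subtype_mk (h := haC)).prodMk hb)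

theorem measurable_grad_populationLoss_comp [IsProbabilityMeasure P] (hp : 1 < p)
    (h : StronglyConvexSCO p C P f θs D μ β G L γ) {Y : Type*} [MeasurableSpace Y]
    {a : Y → Fin d → ℝ} (ha : Measurable a) (haC : ∀ y, a y ∈ C) :
    Measurable fun y => gradOn C (populationLoss P f) (a y) := by
  have h1 : Continuous fun θ : C => gradOn C (populationLoss P f) θ := by
    refine continuous_pi fun i => ?_
    obtain ⟨K, hK, hKn⟩ := ellNorm_le_opNorm_mul (d := d) hp.le
    have hβ := h.smooth_nonneg hp
    refine (LipschitzWith.of_le_add_mul' (β * K) fun θ₁ θ₂ => ?_).continuous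
    have h1 := (le_abs_self _).trans ((abs_apply_le_ellNorm (dualExp_facts hp).1 _ i).trans
      (h.ellNorm_grad_populationLoss_sub_le hp θ₁.2 θ₂.2))
    have h2 := mul_le_mul_of_nonneg_left (hKn (θ₁ - θ₂ : Fin d → ℝ)) hβ
    have h3 : dist θ₁ θ₂ = ‖(θ₁ - θ₂ : Fin d → ℝ)‖ := by rw [Subtype.dist_eq, dist_eq_norm]
    rw [h3]
    simp only [Pi.sub_apply] at h1 ⊢
    linarith
  exact h1.measurable.comp (ha.subtype_mk (h := haC))

end StronglyConvexSCO

/-! ### The recursion of the excess loss -/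

/-- The negative square-root term is dropped and the rest summed, with 1/√t ≤ 3(√(t+1) − √t) and
1/(t+1) ≤ log(t+1) − log t. The bound serves for the initial times, when the noise term dominates.
-/
theorem excess_recursion_crude {h : ℕ → ℝ} {n : ℕ} {g a b : ℝ} (hg : 0 < g) (ha : 0 ≤ a)
    (hb : 0 ≤ b) (h1 : h 1 ≤ a)
    (hrec : ∀ t : ℕ, 1 ≤ t → t < n → ((t : ℝ) + 1) * h (t + 1)
      ≤ t * h t - √2 * g * √(h t) + a / √t + b / ((t : ℝ) + 1)) :
    ∀ t : ℕ, 1 ≤ t → t ≤ n → t * h t ≤ 3 * a * √t + b * Real.log t := by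
  intro t ht
  induction t, ht using Nat.le_induction with
  | base => intro _; simp; linarith
  | succ t ht ih =>
    intro htn
    have ih := ih (by omega)
    have hr := hrec t ht (by omega)
    have ht1 : (1 : ℝ) ≤ t := by exact_mod_cast ht
    have hst : 0 < √(t : ℝ) := Real.sqrt_pos.2 (by linarith)
    have h0 : 0 ≤ √2 * g * √(h t) := by positivity
    have hlog : 1 / ((t : ℝ) + 1) ≤ Real.log ((t : ℝ) + 1) - Real.log t := by
      rw [← Real.log_div (by positivity) (by positivity)]
      have := Real.one_sub_inv_le_log_of_pos (x := ((t : ℝ) + 1) / t) (by positivity)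
      refine le_trans (le_of_eq ?_) this
      field_simp
      ring
    have hsq : a / √(t : ℝ) ≤ 3 * a * (√((t : ℝ) + 1) - √t) := by
      have h2 : √((t : ℝ) + 1) ≤ 2 * √t := by
        rw [Real.sqrt_le_left (by positivity), mul_pow, Real.sq_sqrt (by linarith)]
        linarith
      have h3 : √((t : ℝ) + 1) ^ 2 = t + 1 := Real.sq_sqrt (by linarith)
      have h4 : √(t : ℝ) ^ 2 = t := Real.sq_sqrt (by linarith)
      have h5 : √(t : ℝ) ≤ √((t : ℝ) + 1) := Real.sqrt_le_sqrt (by linarith)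
      rw [div_le_iff₀ hst]
      have h6 : 1 ≤ 3 * (√((t : ℝ) + 1) - √t) * √t := by nlinarith
      nlinarith
    push_cast
    have := mul_le_mul_of_nonneg_left hlog hb
    rw [mul_one_div] at this
    linarith

/-- Induction step once t is large (`hT`): the map s ↦ ts² − √2gs increases on the range that
matters, so s = √H may be replaced by the value S that the induction hypothesis allows. There √2gS
pays for the two error terms and for the decrease of the barrier from t to t + 1. -/
theorem excess_barrier {t g a b l H : ℝ} (hg : 0 < g) (hga : g ^ 2 ≤ a) (hb : 0 ≤ b)
    (hl : 1 ≤ l) (ht1 : 1 ≤ t) (hht : 0 ≤ H) (hT : 16 * l * b < g ^ 2 * (t + 1))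
    (ih : t * H ≤ 64 * a ^ 2 / g ^ 2 + 64 * b ^ 2 * l ^ 2 / g ^ 2 / t) :
    t * H - √2 * g * √H + a / √t + b / (t + 1)
      ≤ 64 * a ^ 2 / g ^ 2 + 64 * b ^ 2 * l ^ 2 / g ^ 2 / (t + 1) := by
  have hg2 : 0 < g ^ 2 := by positivity
  have ha : 0 < a := hg2.trans_le hga
  set S := √(64 * a ^ 2 / g ^ 2 / t + 64 * b ^ 2 * l ^ 2 / g ^ 2 / t ^ 2) with hS
  have hS2 : S ^ 2 = 64 * a ^ 2 / g ^ 2 / t + 64 * b ^ 2 * l ^ 2 / g ^ 2 / t ^ 2 :=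
    Real.sq_sqrt (by positivity)
  set s := √H with hs
  have hs2 : s ^ 2 = H := Real.sq_sqrt hht
  have hs0 : 0 ≤ s := Real.sqrt_nonneg _
  have hS0 : 0 ≤ S := Real.sqrt_nonneg _
  have hsS : s ≤ S := by
    refine Real.sqrt_le_sqrt ?_
    rw [show 64 * a ^ 2 / g ^ 2 / t + 64 * b ^ 2 * l ^ 2 / g ^ 2 / t ^ 2
      = (64 * a ^ 2 / g ^ 2 + 64 * b ^ 2 * l ^ 2 / g ^ 2 / t) / t by field_simp,
      le_div_iff₀ (by linarith)]
    linarith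
  have hst1 : 1 ≤ √t := Real.one_le_sqrt.2 ht1
  have hst2 : √t ^ 2 = t := Real.sq_sqrt (by linarith)
  by_cases hcase : t * s ≤ √2 * g
  -- For small s the first two terms are nonpositive together, and the errors a/√t and b/(t+1) are
  -- below the barrier by themselves.
  · have e1 : t * H - √2 * g * s ≤ 0 := by
      have := mul_le_mul_of_nonneg_left hcase hs0
      rw [← hs2]
      linarith
    have e2 : a / √t ≤ a ^ 2 / g ^ 2 := by
      rw [div_le_div_iff₀ (by linarith) hg2]
      have := mul_le_mul_of_nonneg_left hga ha.le
      have := mul_le_mul_of_nonneg_left hst1 (sq_nonneg a)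
      linarith
    have e3 : b / (t + 1) ≤ a ^ 2 / g ^ 2 + b ^ 2 * l ^ 2 / g ^ 2 / (t + 1) := by
      rw [show a ^ 2 / g ^ 2 + b ^ 2 * l ^ 2 / g ^ 2 / (t + 1)
        = (a ^ 2 / g ^ 2 * (t + 1) + b ^ 2 * l ^ 2 / g ^ 2) / (t + 1) by
          field_simp]
      gcongr
      have f1 : b ≤ g ^ 2 + b ^ 2 / g ^ 2 := by
        rw [← sub_le_iff_le_add', le_div_iff₀ hg2]
        nlinarith [sq_nonneg (b - g ^ 2)]
      have f2 : g ^ 2 ≤ a ^ 2 / g ^ 2 := by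
        rw [le_div_iff₀ hg2]; nlinarith
      have f3 : b ^ 2 / g ^ 2 ≤ b ^ 2 * l ^ 2 / g ^ 2 := by
        gcongr
        exact le_mul_of_one_le_right (sq_nonneg b) (one_le_pow₀ hl)
      have f4 : a ^ 2 / g ^ 2 ≤ a ^ 2 / g ^ 2 * (t + 1) :=
        le_mul_of_one_le_right (by positivity) (by linarith)
      linarith
    have e4 : 0 ≤ a ^ 2 / g ^ 2 := by positivity
    have e5 : 0 ≤ b ^ 2 * l ^ 2 / g ^ 2 / (t + 1) := by positivity
    have e6 : 64 * a ^ 2 / g ^ 2 = 64 * (a ^ 2 / g ^ 2) := by ring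
    have e7 : 64 * b ^ 2 * l ^ 2 / g ^ 2 / (t + 1)
      = 64 * (b ^ 2 * l ^ 2 / g ^ 2 / (t + 1)) := by ring
    rw [e6, e7]
    linarith
  · push Not at hcase
    have e1 : t * H - √2 * g * s ≤ t * S ^ 2 - √2 * g * S := by
      have : s * (t * s - √2 * g) ≤ S * (t * S - √2 * g) := by
        have : t * s ≤ t * S := by gcongr
        apply mul_le_mul hsS (by linarith) (by linarith) hS0
      rw [← hs2]
      nlinarith
    -- S² is a sum of two squares x² + y², and (x + y)² ≤ 2(x² + y²).
    have e2 : 8 * a / (g * √t) + 8 * b * l / (g * t) ≤ √2 * S := by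
      refine le_of_sq_le_sq ?_ (by positivity)
      rw [mul_pow, Real.sq_sqrt (by norm_num), hS2]
      have f1 : 64 * a ^ 2 / g ^ 2 / t = (8 * a / (g * √t)) ^ 2 := by
        rw [div_pow, mul_pow g, hst2]; field_simp; norm_num
      have f2 : 64 * b ^ 2 * l ^ 2 / g ^ 2 / t ^ 2 = (8 * b * l / (g * t)) ^ 2 := by
        field_simp; ring
      rw [f1, f2]
      nlinarith [sq_nonneg (8 * a / (g * √t) - 8 * b * l / (g * t))]
    have e3 := mul_le_mul_of_nonneg_left e2 hg.le
    have e4 : g * (8 * a / (g * √t) + 8 * b * l / (g * t))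
        = 8 * (a / √t) + 8 * (b * l / t) := by
      field_simp
    rw [e4] at e3
    have e5 : b / (t + 1) ≤ b * l / t := by
      gcongr
      · nlinarith
      · linarith
    have e6 : 64 * b ^ 2 * l ^ 2 / g ^ 2 / t - 64 * b ^ 2 * l ^ 2 / g ^ 2 / (t + 1)
        ≤ 4 * (b * l / t) := by
      have : 64 * b ^ 2 * l ^ 2 / g ^ 2 / t - 64 * b ^ 2 * l ^ 2 / g ^ 2 / (t + 1)
        = (64 * b ^ 2 * l ^ 2 / (g ^ 2 * (t + 1))) / t := by field_simp; ring
      rw [this, mul_div_assoc']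
      gcongr
      rw [div_le_iff₀ (by positivity)]
      have := mul_le_mul_of_nonneg_left hT.le (show 0 ≤ 4 * (b * l) by positivity)
      linarith
    have e7 : 0 ≤ a / √t := by positivity
    have e8 : 0 ≤ b * l / t := by positivity
    have e9 : t * S ^ 2 = 64 * a ^ 2 / g ^ 2 + 64 * b ^ 2 * l ^ 2 / g ^ 2 / t := by
      rw [hS2]; field_simp
    linarith

theorem excess_recursion {h : ℕ → ℝ} {n : ℕ} {g a b l : ℝ} (hg : 0 < g) (hga : g ^ 2 ≤ a)
    (hb : 0 ≤ b) (hl : 1 ≤ l) (hln : Real.log n ≤ l)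
    (h0 : ∀ t : ℕ, 1 ≤ t → t ≤ n → 0 ≤ h t) (h1 : h 1 ≤ a)
    (hrec : ∀ t : ℕ, 1 ≤ t → t < n → ((t : ℝ) + 1) * h (t + 1)
      ≤ t * h t - √2 * g * √(h t) + a / √t + b / ((t : ℝ) + 1)) :
    ∀ t : ℕ, 1 ≤ t → t ≤ n →
      h t ≤ 64 * (a ^ 2 / (g ^ 2 * t) + b ^ 2 * l ^ 2 / (g ^ 2 * t ^ 2)) := by
  have hg2 : 0 < g ^ 2 := by positivity
  have ha : 0 < a := hg2.trans_le hga
  have hcrude := excess_recursion_crude hg ha.le hb h1 hrec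
  have key : ∀ t : ℕ, 1 ≤ t → t ≤ n →
      t * h t ≤ 64 * a ^ 2 / g ^ 2 + 64 * b ^ 2 * l ^ 2 / g ^ 2 / t := by
    intro t ht
    induction t, ht using Nat.le_induction with
    | base =>
      intro _
      have : a ≤ 64 * a ^ 2 / g ^ 2 := by
        rw [le_div_iff₀ hg2]; nlinarith
      have : 0 ≤ 64 * b ^ 2 * l ^ 2 / g ^ 2 := by positivity
      norm_num
      linarith
    | succ t ht ih =>
      intro htn
      have ih := ih (by omega)
      have ht1 : (1 : ℝ) ≤ t := by exact_mod_cast ht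
      have htp : (0 : ℝ) < (t : ℝ) + 1 := by linarith
      push_cast
      -- While t + 1 ≤ 16lb/g², the term 64b²l²/(g²(t+1)) is at least 4bl, so the crude bound
      -- suffices after an AM–GM step on 3a√(t+1).
      by_cases hT : g ^ 2 * ((t : ℝ) + 1) ≤ 16 * l * b
      · have hc := hcrude (t + 1) (by omega) htn
        push_cast at hc
        refine hc.trans ?_
        have hlogt : Real.log ((t : ℝ) + 1) ≤ l := by
          refine le_trans (Real.log_le_log htp ?_) hln
          exact_mod_cast htn
        have hbl : b * Real.log ((t : ℝ) + 1) ≤ b * l := by gcongr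
        refine (add_le_add_right hbl _).trans ?_
        have hy : √((t : ℝ) + 1) ^ 2 = (t : ℝ) + 1 := Real.sq_sqrt htp.le
        set y := √((t : ℝ) + 1)
        have e1 : 64 * a ^ 2 / g ^ 2 + 64 * b ^ 2 * l ^ 2 / g ^ 2 / ((t : ℝ) + 1)
            = (64 * a ^ 2 + 64 * b ^ 2 * l ^ 2 / ((t : ℝ) + 1)) / g ^ 2 := by
          field_simp
        rw [e1, le_div_iff₀ hg2]
        have e2 : 4 * b * l * g ^ 2 ≤ 64 * b ^ 2 * l ^ 2 / ((t : ℝ) + 1) := by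
          rw [le_div_iff₀ htp]
          have := mul_le_mul_of_nonneg_left hT (show 0 ≤ 4 * b * l by positivity)
          linarith
        have e3 : 3 * a * y * g ^ 2 ≤ 36 * a ^ 2 + g ^ 2 * (g ^ 2 * ((t : ℝ) + 1)) / 16 := by
          have : 3 * a * y * g ^ 2 ≤ 36 * a ^ 2 + (g ^ 2 * y) ^ 2 / 16 := by
            nlinarith [sq_nonneg (6 * a - g ^ 2 * y / 4)]
          rw [mul_pow, hy] at this
          linarith
        have e4 := mul_le_mul_of_nonneg_left hT hg2.le
        have e5 : 0 ≤ a ^ 2 := by positivity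
        have e6 : 0 ≤ b * l * g ^ 2 := by positivity
        linarith
      · push Not at hT
        have hr := hrec t ht (by omega)
        have hht := h0 t ht (by omega)
        exact hr.trans <| excess_barrier hg hga hb hl ht1 hht hT ih
  intro t ht htn
  have ht1 : (0 : ℝ) < t := by exact_mod_cast ht
  have := key t ht htn
  rw [mul_comm, ← le_div_iff₀ ht1] at this
  refine this.trans (le_of_eq ?_)
  field_simp

/-! ### The tree-based mechanism -/

/-- Bit l of t is 1 exactly when t / 2^l is odd, say 2c + 1. The block over leaf t at height l has
index 2c if all lower bits of t vanish, and 2c + 1 otherwise; in the second case its left sibling is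
read, so the node is 2c in both cases. -/
theorem readNode_eq {t l : ℕ} (h : t.testBit l = true) :
    readNode t l = (l, 2 * (t / 2 ^ (l + 1))) ∧
      t / 2 ^ l = 2 * (t / 2 ^ (l + 1)) + 1 := by
  rw [Nat.testBit_eq_decide_div_mod_eq, decide_eq_true_eq] at h
  have h2 : t / 2 ^ (l + 1) = t / 2 ^ l / 2 := by rw [pow_succ, Nat.div_div_eq_div_mul]
  have h3 : t / 2 ^ l = 2 * (t / 2 ^ (l + 1)) + 1 := by omega
  refine ⟨?_, h3⟩
  set c := t / 2 ^ (l + 1)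
  have hm : 0 < 2 ^ l := by positivity
  have h4 := Nat.div_add_mod t (2 ^ l)
  rw [h3] at h4
  have h5 := Nat.mod_lt t hm
  rw [readNode]
  rcases Nat.eq_zero_or_pos (t % 2 ^ l) with h0 | h0
  · have h6 : (t - 1) / 2 ^ l = 2 * c := by
      refine Nat.div_eq_of_lt_le ?_ ?_
      · have : 2 * c * 2 ^ l + 2 ^ l = t := by rw [← h4, h0]; ring
        omega
      · have : (2 * c + 1) * 2 ^ l = t := by rw [← h4, h0]; ring
        have : 2 * c * 2 ^ l + 2 ^ l = t := by rw [← h4, h0]; ring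
        omega
    simp [h6]
  · have h6 : (t - 1) / 2 ^ l = 2 * c + 1 := by
      have e : 2 ^ l * (2 * c + 1) = (2 * c + 1) * 2 ^ l := by ring
      have e2 : (2 * c + 1 + 1) * 2 ^ l = (2 * c + 1) * 2 ^ l + 2 ^ l := by ring
      refine Nat.div_eq_of_lt_le ?_ ?_
      · omega
      · omega
    simp [h6]

theorem readNode_fst (t l : ℕ) : (readNode t l).1 = l := by
  unfold readNode; split_ifs <;> rfl

theorem readNode_mem_treeNodes {n t l : ℕ} (htn : t ≤ n) (hl : l < Nat.clog 2 n + 1)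
    (h : t.testBit l = true) : readNode t l ∈ treeNodes n := by
  obtain ⟨h1, h2⟩ := readNode_eq h
  have h3 : t ≤ 2 ^ Nat.clog 2 n := htn.trans (Nat.le_pow_clog (by norm_num) n)
  have h4 : 2 * (t / 2 ^ (l + 1)) < 2 ^ (Nat.clog 2 n - l) := by
    have h5 : t / 2 ^ l ≤ 2 ^ Nat.clog 2 n / 2 ^ l := Nat.div_le_div_right h3
    rw [Nat.pow_div (by omega) (by norm_num)] at h5
    omega
  rw [h1, treeNodes]
  simp only [Finset.mem_filter, Finset.mem_product, Finset.mem_range]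
  exact ⟨⟨hl, h4.trans_le (Nat.pow_le_pow_right (by norm_num) (Nat.sub_le _ _))⟩, h4⟩

/-- The lowest K bits account for the last t mod 2^K leaves. If bit K is 1, its block is the one
immediately to the left of those already covered. -/
theorem sum_Ioc_binary_blocks {M : Type*} [AddCommMonoid M] (g : ℕ → M) (t K : ℕ) :
    ∑ l ∈ (Finset.range K).filter (fun l => t.testBit l = true),
      ∑ i ∈ Finset.Ioc ((readNode t l).2 * 2 ^ (readNode t l).1)
        (((readNode t l).2 + 1) * 2 ^ (readNode t l).1), g i
      = ∑ i ∈ Finset.Ioc (2 ^ K * (t / 2 ^ K)) t, g i := by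
  induction K with
  | zero => simp
  | succ K ih =>
    rw [Finset.range_add_one, Finset.filter_insert]
    have h2 : t / 2 ^ (K + 1) = t / 2 ^ K / 2 := by rw [pow_succ, Nat.div_div_eq_div_mul]
    split_ifs with hb
    · rw [Finset.sum_insert (by simp), ih]
      obtain ⟨h1, h3⟩ := readNode_eq hb
      rw [h1]
      simp only
      have e1 : 2 * (t / 2 ^ (K + 1)) * 2 ^ K = 2 ^ (K + 1) * (t / 2 ^ (K + 1)) := by ring
      have e2 : (2 * (t / 2 ^ (K + 1)) + 1) * 2 ^ K = 2 ^ K * (t / 2 ^ K) := by rw [h3]; ring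
      rw [e1, e2]
      have hle : 2 ^ (K + 1) * (t / 2 ^ (K + 1)) ≤ 2 ^ K * (t / 2 ^ K) := by
        rw [← e1, ← e2]; gcongr; omega
      have hle2 : 2 ^ K * (t / 2 ^ K) ≤ t := Nat.mul_div_le _ _
      rw [← Finset.Ioc_union_Ioc_eq_Ioc hle hle2, Finset.sum_union]
      exact Finset.Ioc_disjoint_Ioc_of_le le_rfl
    · rw [ih]
      rw [Nat.testBit_eq_decide_div_mod_eq, decide_eq_true_eq] at hb
      have : 2 ^ (K + 1) * (t / 2 ^ (K + 1)) = 2 ^ K * (t / 2 ^ K) := by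
        rw [h2, pow_succ, mul_assoc]
        congr 1
        omega
      rw [this]

/-- The accumulated noise in the partial sum released at time `t`. -/
noncomputable def treeNoise {d : ℕ} (n : ℕ) (Z : ℕ × ℕ → Fin d → ℝ) (t : ℕ) : Fin d → ℝ :=
  ∑ l ∈ (Finset.range (Nat.clog 2 n + 1)).filter (fun l => t.testBit l = true), Z (readNode t l)

theorem noisySum_eq {d n t : ℕ} (htn : t ≤ n) (g : ℕ → Fin d → ℝ) (Z : ℕ × ℕ → Fin d → ℝ) :
    noisySum n g Z t = ∑ i ∈ Finset.Icc 1 t, g i + treeNoise n Z t := by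
  have h1 : t / 2 ^ (Nat.clog 2 n + 1) = 0 := by
    refine Nat.div_eq_of_lt ?_
    calc t ≤ 2 ^ Nat.clog 2 n := htn.trans (Nat.le_pow_clog (by norm_num) n)
      _ < 2 ^ (Nat.clog 2 n + 1) := Nat.pow_lt_pow_right (by norm_num) (Nat.lt_succ_self _)
  have h2 := sum_Ioc_binary_blocks g t (Nat.clog 2 n + 1)
  rw [h1, mul_zero] at h2
  simp only [noisySum, nodeValue, Finset.sum_add_distrib]
  rw [h2, treeNoise]
  rfl

theorem treeNoise_congr {d n t : ℕ} (htn : t ≤ n) {Z Z' : ℕ × ℕ → Fin d → ℝ}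
    (h : ∀ j ∈ treeNodes n, Z j = Z' j) : treeNoise n Z t = treeNoise n Z' t := by
  refine Finset.sum_congr rfl fun l hl => ?_
  rw [Finset.mem_filter, Finset.mem_range] at hl
  exact h _ (readNode_mem_treeNodes htn hl.1 hl.2)

/-! ### The iterates -/

section Iterates

variable {d : ℕ} {X : Type*} {C : Set (Fin d → ℝ)} {f : (Fin d → ℝ) → X → ℝ}
  {argmin : (Fin d → ℝ) → Fin d → ℝ} {n : ℕ}

/-- The summand `g_t`. -/
noncomputable def recursiveGrad (C : Set (Fin d → ℝ)) (f : (Fin d → ℝ) → X → ℝ)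
    (argmin : (Fin d → ℝ) → Fin d → ℝ) (n : ℕ) (x : ℕ → X) (Z : ℕ × ℕ → Fin d → ℝ) (t : ℕ) :
    Fin d → ℝ :=
  ((t : ℝ) + 1) • gradOn C (fun θ => f θ (x t)) (dpTOFW C f argmin n x Z t)
    - (t : ℝ) • gradOn C (fun θ => f θ (x t)) (dpTOFW C f argmin n x Z (t - 1))

/-- The gradient estimate `d_t`. -/
noncomputable def gradEstimate (C : Set (Fin d → ℝ)) (f : (Fin d → ℝ) → X → ℝ)
    (argmin : (Fin d → ℝ) → Fin d → ℝ) (n : ℕ) (x : ℕ → X) (Z : ℕ × ℕ → Fin d → ℝ) (t : ℕ) :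
    Fin d → ℝ :=
  (1 / ((t : ℝ) + 1)) • (∑ i ∈ Finset.Icc 1 t, recursiveGrad C f argmin n x Z i + treeNoise n Z t)

variable (x : ℕ → X) (Z : ℕ × ℕ → Fin d → ℝ)

theorem dpTOFW_zero : dpTOFW C f argmin n x Z 0 = 0 := rfl

theorem dpTOFW_one : dpTOFW C f argmin n x Z 1 = 0 := rfl

theorem dpTOFWState_g {t i : ℕ} (hi : 1 ≤ i) (hit : i ≤ t) :
    (dpTOFWState C f argmin n x Z t).g i = recursiveGrad C f argmin n x Z i := by
  induction t with
  | zero => omega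
  | succ t ih =>
    rw [dpTOFWState]
    by_cases h : i = t + 1
    · subst h
      simp only [Function.update_self]
      rfl
    · simp only [Function.update_of_ne h]
      exact ih (by omega)

theorem dpTOFW_succ {t : ℕ} (ht : 1 ≤ t) (htn : t ≤ n) :
    dpTOFW C f argmin n x Z (t + 1) = dpTOFW C f argmin n x Z t
      + (1 / ((t : ℝ) + 1)) • (argmin (gradEstimate C f argmin n x Z t)
        - dpTOFW C f argmin n x Z t) := by
  obtain ⟨k, rfl⟩ : ∃ k, t = k + 1 := ⟨t - 1, by omega⟩
  have h1 : gradEstimate C f argmin n x Z (k + 1) = (1 / (((k + 1 : ℕ) : ℝ) + 1)) •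
      noisySum n (dpTOFWState C f argmin n x Z (k + 1)).g Z (k + 1) := by
    rw [gradEstimate, noisySum_eq htn]
    congr 2
    refine Finset.sum_congr rfl fun i hi => ?_
    rw [Finset.mem_Icc] at hi
    rw [dpTOFWState_g x Z hi.1 hi.2]
  rw [h1]
  rfl

theorem dpTOFW_mem (hC : Convex ℝ C) (h0 : (0 : Fin d → ℝ) ∈ C)
    (hargmin : IsLinearMinimizer C argmin) (t : ℕ) : dpTOFW C f argmin n x Z t ∈ C := by
  suffices h : (dpTOFWState C f argmin n x Z t).prev ∈ C
      ∧ (dpTOFWState C f argmin n x Z t).cur ∈ C from h.1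
  induction t with
  | zero => exact ⟨h0, h0⟩
  | succ t ih =>
    refine ⟨ih.2, ?_⟩
    refine hC.add_smul_sub_mem ih.2 (hargmin.2 _).1 ⟨by positivity, ?_⟩
    push_cast
    rw [div_le_one (by positivity)]
    linarith [Nat.cast_nonneg (α := ℝ) t]

variable {x Z}

/-- The iterates up to time `t + 1` depend on the first `t` samples and the noise in the tree. -/
theorem dpTOFW_congr {x' : ℕ → X} {Z' : ℕ × ℕ → Fin d → ℝ} {m : ℕ} (hmn : m ≤ n)
    (hx : ∀ i ∈ Finset.Icc 1 m, x i = x' i) (hZ : ∀ j ∈ treeNodes n, Z j = Z' j) :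
    ∀ t ≤ m + 1, dpTOFW C f argmin n x Z t = dpTOFW C f argmin n x' Z' t := by
  intro t
  induction t using Nat.strong_induction_on with
  | _ t ih =>
    intro htm
    rcases t with _ | _ | t
    · rw [dpTOFW_zero, dpTOFW_zero]
    · rw [zero_add, dpTOFW_one, dpTOFW_one]
    have hn : t + 1 ≤ n := by omega
    rw [dpTOFW_succ x Z (by omega) hn, dpTOFW_succ x' Z' (by omega) hn,
      ih (t + 1) (by omega) (by omega)]
    have h1 : gradEstimate C f argmin n x Z (t + 1) = gradEstimate C f argmin n x' Z' (t + 1) := by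
      rw [gradEstimate, gradEstimate, treeNoise_congr hn hZ]
      congr 2
      refine Finset.sum_congr rfl fun i hi => ?_
      rw [Finset.mem_Icc] at hi
      rw [recursiveGrad, recursiveGrad, ih i (by omega) (by omega), ih (i - 1) (by omega)
        (by omega), hx i (Finset.mem_Icc.2 (by omega))]
    rw [h1]

end Iterates

/-! ### From the errors of the gradient estimates to the excess loss of the iterates -/

namespace StronglyConvexSCO

variable {d : ℕ} {X : Type*} [MeasurableSpace X] {p : ℝ≥0∞} {C : Set (Fin d → ℝ)} {P : Measure X}
  {f : (Fin d → ℝ) → X → ℝ} {θs : Fin d → ℝ} {D μ β G L γ : ℝ}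
  {argmin : (Fin d → ℝ) → Fin d → ℝ} {n : ℕ}

/-- The step that produces θ_t has length 1/t times the distance of two points of C; at t = 1 both
iterates are 0. -/
theorem mul_ellNorm_iterate_sub_le (hp : 1 < p) (h : StronglyConvexSCO p C P f θs D μ β G L γ)
    (hargmin : IsLinearMinimizer C argmin) (x : ℕ → X) (Z : ℕ × ℕ → Fin d → ℝ) {t : ℕ}
    (ht : 1 ≤ t) (htn : t ≤ n + 1) :
    (t : ℝ) * ellNorm p (dpTOFW C f argmin n x Z t - dpTOFW C f argmin n x Z (t - 1)) ≤ D := by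
  have hn := isNormOn_ellNorm (d := d) hp.le
  rcases t with _ | _ | t
  · omega
  · simp only [zero_add, Nat.sub_self, dpTOFW_one, dpTOFW_zero, sub_self, hn.map_zero, mul_zero]
    exact h.diam_pos.le
  · rw [Nat.add_sub_cancel, dpTOFW_succ x Z (by omega) (by omega), add_sub_cancel_left,
      hn.smul_eq, abs_of_nonneg (by positivity), ← mul_assoc]
    push_cast
    rw [mul_one_div_cancel (by positivity), one_mul]
    exact h.ellNorm_sub_le (hargmin.2 _).1 (dpTOFW_mem x Z h.convex h.zero_mem hargmin _)

/-- The deviation of `g_t` from its conditional expectation, as a function of the sample. -/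
noncomputable def _root_.gradDeviation (C : Set (Fin d → ℝ)) (P : Measure X)
    (f : (Fin d → ℝ) → X → ℝ)
    (t : ℕ) (θ θ' : Fin d → ℝ) (x : X) : Fin d → ℝ :=
  (((t : ℝ) + 1) • gradOn C (fun θ => f θ x) θ - (t : ℝ) • gradOn C (fun θ => f θ x) θ')
    - (((t : ℝ) + 1) • gradOn C (populationLoss P f) θ
      - (t : ℝ) • gradOn C (populationLoss P f) θ')

/-- The sum of the deviations of `g_1, …, g_t`. -/
noncomputable def _root_.deviationSum (C : Set (Fin d → ℝ)) (P : Measure X)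
    (f : (Fin d → ℝ) → X → ℝ) (argmin : (Fin d → ℝ) → Fin d → ℝ) (n : ℕ) (x : ℕ → X)
    (Z : ℕ × ℕ → Fin d → ℝ) (t : ℕ) : Fin d → ℝ :=
  ∑ i ∈ Finset.Icc 1 t, gradDeviation C P f i (dpTOFW C f argmin n x Z i)
    (dpTOFW C f argmin n x Z (i - 1)) (x i)

theorem _root_.sum_recursive_grad_eq (x : ℕ → X) (Z : ℕ × ℕ → Fin d → ℝ) (t : ℕ) :
    ∑ i ∈ Finset.Icc 1 t, recursiveGrad C f argmin n x Z i
      = deviationSum C P f argmin n x Z t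
        + ((t : ℝ) + 1) • gradOn C (populationLoss P f) (dpTOFW C f argmin n x Z t)
        - gradOn C (populationLoss P f) 0 := by
  induction t with
  | zero => simp [deviationSum, dpTOFW_zero]
  | succ t ih =>
    rw [deviationSum, Finset.sum_Icc_succ_top (by omega), Finset.sum_Icc_succ_top (by omega), ih,
      deviationSum, gradDeviation, recursiveGrad]
    push_cast
    module

theorem ellNorm_gradEstimate_sub_le [IsProbabilityMeasure P] (hp : 1 < p)
    (h : StronglyConvexSCO p C P f θs D μ β G L γ)
    (x : ℕ → X) (Z : ℕ × ℕ → Fin d → ℝ) (t : ℕ) :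
    ((t : ℝ) + 1) * ellNorm (dualExp p) (gradEstimate C f argmin n x Z t
        - gradOn C (populationLoss P f) (dpTOFW C f argmin n x Z t))
      ≤ ellNorm (dualExp p) (deviationSum C P f argmin n x Z t) + β * D
        + ellNorm (dualExp p) (treeNoise n Z t) := by
  have hn := isNormOn_ellNorm (d := d) (dualExp_facts hp).1
  have ht : (0 : ℝ) < (t : ℝ) + 1 := by positivity
  have h1 := hn.smul_eq ((t : ℝ) + 1) (gradEstimate C f argmin n x Z t
        - gradOn C (populationLoss P f) (dpTOFW C f argmin n x Z t))
  rw [abs_of_pos ht] at h1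
  rw [← h1]
  have h2 : ((t : ℝ) + 1) • (gradEstimate C f argmin n x Z t
        - gradOn C (populationLoss P f) (dpTOFW C f argmin n x Z t))
      = (deviationSum C P f argmin n x Z t - gradOn C (populationLoss P f) 0)
        + treeNoise n Z t := by
    rw [smul_sub, gradEstimate, smul_smul, mul_one_div_cancel ht.ne', one_smul,
      sum_recursive_grad_eq (P := P)]
    module
  rw [h2]
  refine (hn.add_le _ _).trans (add_le_add ((hn.sub_le _ _).trans ?_) le_rfl)
  exact add_le_add le_rfl (h.ellNorm_grad_populationLoss_le hp h.zero_mem)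

/-- The excess loss of the iterates, given bounds on the martingale part and on the noise. -/
theorem excess_iterate_le [IsProbabilityMeasure P] (hp : 1 < p)
    (h : StronglyConvexSCO p C P f θs D μ β G L γ) (hargmin : IsLinearMinimizer C argmin)
    (x : ℕ → X) (Z : ℕ × ℕ → Fin d → ℝ) {A B l : ℝ} (hA : 0 ≤ A) (hB : 0 ≤ B) (hl : 1 ≤ l)
    (hln : Real.log n ≤ l)
    (hdev : ∀ t ∈ Finset.Icc 1 n,
      ellNorm (dualExp p) (deviationSum C P f argmin n x Z t) ≤ A * √t)
    (hnoise : ∀ t ∈ Finset.Icc 1 n, ellNorm (dualExp p) (treeNoise n Z t) ≤ B) :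
    ∀ t ∈ Finset.Icc 1 n,
      populationLoss P f (dpTOFW C f argmin n x Z t) - populationLoss P f θs
        ≤ 64 * ((D * A + 2 * β * D ^ 2) ^ 2 / (γ ^ 2 * μ * t)
          + (D * B) ^ 2 * l ^ 2 / (γ ^ 2 * μ * t ^ 2)) := by
  have hβ := h.smooth_nonneg hp
  have hD := h.diam_pos
  have hγ := h.gamma_pos
  have hμ := h.mu_pos
  have hmem : ∀ t, dpTOFW C f argmin n x Z t ∈ C := dpTOFW_mem x Z h.convex h.zero_mem hargmin
  have hg2 : (γ * √μ) ^ 2 = γ ^ 2 * μ := by rw [mul_pow, Real.sq_sqrt hμ.le]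
  have hβD : 0 ≤ β * D ^ 2 := by positivity
  -- Besides D·A from the martingale, `a` contains βD² twice: once from ∇F(0) in the gradient error
  -- and once from the curvature term of the Frank–Wolfe step. Both are of order 1/(t+1) and are
  -- absorbed into a/√t.
  have key := excess_recursion (n := n) (g := γ * √μ) (a := D * A + 2 * β * D ^ 2) (b := D * B)
    (l := l) (h := fun t => populationLoss P f (dpTOFW C f argmin n x Z t) - populationLoss P f θs)
    (by positivity) ?_ (by positivity) hl hln (fun t _ _ => h.excess_nonneg (hmem t)) ?_ ?_
  · intro t ht
    rw [Finset.mem_Icc] at ht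
    have := key t ht.1 ht.2
    rwa [hg2] at this
  · rw [hg2]
    have h1 : γ ^ 2 ≤ D ^ 2 := pow_le_pow_left₀ hγ.le h.gamma_le_diam 2
    have h2 : γ ^ 2 * μ ≤ D ^ 2 * (2 * β) := by
      gcongr
      exact h.mu_le hp
    have : 0 ≤ D * A := by positivity
    linarith
  · have := h.excess_le hp (hmem 1)
    have : 0 ≤ D * A := by positivity
    linarith
  · intro t ht htn
    have htp : (0 : ℝ) < (t : ℝ) + 1 := by positivity
    have ht1 : (1 : ℝ) ≤ t := by exact_mod_cast ht
    have hmemt : t ∈ Finset.Icc 1 n := Finset.mem_Icc.2 ⟨ht, htn.le⟩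
    have hs : 1 / ((t : ℝ) + 1) ∈ Set.Icc (0 : ℝ) 1 :=
      ⟨by positivity, by rw [div_le_one htp]; linarith⟩
    have h1 := h.frank_wolfe_step hp (hmem t) (hargmin.2 (gradEstimate C f argmin n x Z t)).1
      (hargmin.2 (gradEstimate C f argmin n x Z t)).2 hs
    rw [← dpTOFW_succ x Z ht htn.le] at h1
    set F0 := populationLoss P f (dpTOFW C f argmin n x Z t) - populationLoss P f θs
    have h2 : √(2 * μ * F0) = √2 * √μ * √F0 := by
      rw [Real.sqrt_mul (by positivity), Real.sqrt_mul (by norm_num)]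
    have h3 := h.ellNorm_gradEstimate_sub_le (argmin := argmin) (n := n) hp x Z t
    have h4 := hdev t hmemt
    have h5 := hnoise t hmemt
    set E := ellNorm (dualExp p) (gradEstimate C f argmin n x Z t
        - gradOn C (populationLoss P f) (dpTOFW C f argmin n x Z t))
    have h6 : E ≤ (A * √t + β * D + B) / ((t : ℝ) + 1) := by
      rw [le_div_iff₀ htp]; linarith
    have h7 := mul_le_mul_of_nonneg_left h1 htp.le
    have h8 := mul_le_mul_of_nonneg_left h6 hD.le
    have e1 : ((t : ℝ) + 1) * (F0 + 1 / ((t : ℝ) + 1) * (-F0 - γ * √(2 * μ * F0) + D * E)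
        + β * D ^ 2 * (1 / ((t : ℝ) + 1)) ^ 2)
        = t * F0 - √2 * (γ * √μ) * √F0 + D * E + β * D ^ 2 / ((t : ℝ) + 1) := by
      rw [h2]
      field_simp
      ring
    rw [e1] at h7
    have hst : 0 < √(t : ℝ) := Real.sqrt_pos.2 (by linarith)
    have hst2 : √(t : ℝ) ^ 2 = t := Real.sq_sqrt (by linarith)
    have hst1 : 1 ≤ √(t : ℝ) := Real.one_le_sqrt.2 ht1
    have e2 : D * ((A * √t + β * D + B) / ((t : ℝ) + 1)) + β * D ^ 2 / ((t : ℝ) + 1)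
        = (D * A * √t + 2 * β * D ^ 2) / ((t : ℝ) + 1) + D * B / ((t : ℝ) + 1) := by
      field_simp
      ring
    have e3 : (D * A * √t + 2 * β * D ^ 2) / ((t : ℝ) + 1) ≤ (D * A + 2 * β * D ^ 2) / √t := by
      rw [div_le_div_iff₀ htp hst]
      have f1 : 0 ≤ D * A := by positivity
      have f2 : √(t : ℝ) ≤ t := by
        calc √(t : ℝ) ≤ √(t : ℝ) * √t := le_mul_of_one_le_right hst.le hst1
          _ = t := Real.mul_self_sqrt (by linarith)
      have f3 : β * D ^ 2 * √t ≤ β * D ^ 2 * t := by gcongr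
      have f4 : D * A * √t * √t = D * A * t := by rw [mul_assoc, ← sq, hst2]
      linarith
    linarith

end StronglyConvexSCO

/-! ### The martingale part -/

section Measurability

variable {d : ℕ} {X : Type*} [MeasurableSpace X] {p : ℝ≥0∞} {C : Set (Fin d → ℝ)} {P : Measure X}
  {f : (Fin d → ℝ) → X → ℝ} {θs : Fin d → ℝ} {D μ β G L γ : ℝ}
  {argmin : (Fin d → ℝ) → Fin d → ℝ} {n : ℕ} {Y : Type*} [MeasurableSpace Y]
  {x : ℕ → Y → X} {Z : ℕ × ℕ → Y → Fin d → ℝ}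

theorem measurable_treeNoise (hZ : ∀ j, Measurable (Z j)) (t : ℕ) :
    Measurable fun y => treeNoise n (fun j => Z j y) t :=
  Finset.measurable_sum _ fun _ _ => hZ _

theorem StronglyConvexSCO.measurable_dpTOFW [IsProbabilityMeasure P] (hp : 1 < p)
    (h : StronglyConvexSCO p C P f θs D μ β G L γ) (hargmin : IsLinearMinimizer C argmin)
    (hx : ∀ i, Measurable (x i)) (hZ : ∀ j, Measurable (Z j)) :
    ∀ t ≤ n + 1, Measurable fun y => dpTOFW C f argmin n (fun i => x i y) (fun j => Z j y) t := by
  intro t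
  induction t using Nat.strong_induction_on with
  | _ t ih =>
    intro htn
    rcases t with _ | _ | t
    · simp only [dpTOFW_zero]; exact measurable_const
    · simp only [zero_add, dpTOFW_one]; exact measurable_const
    have hmem : ∀ s y, dpTOFW C f argmin n (fun i => x i y) (fun j => Z j y) s ∈ C :=
      fun s y => dpTOFW_mem _ _ h.convex h.zero_mem hargmin s
    have hg : Measurable fun y =>
        gradEstimate C f argmin n (fun i => x i y) (fun j => Z j y) (t + 1) := by
      refine ((Finset.measurable_sum _ fun i hi => ?_).add
        (measurable_treeNoise hZ _)).const_smul (1 / (((t + 1 : ℕ) : ℝ) + 1))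
      rw [Finset.mem_Icc] at hi
      exact ((h.measurable_grad_comp hp (ih i (by omega) (by omega)) (hx i)
        (hmem i)).const_smul ((i : ℝ) + 1)).sub
        ((h.measurable_grad_comp hp (ih (i - 1) (by omega) (by omega)) (hx i)
        (hmem (i - 1))).const_smul (i : ℝ))
    have hθ := ih (t + 1) (by omega) (by omega)
    simp only [dpTOFW_succ _ _ (show 1 ≤ t + 1 by omega) (show t + 1 ≤ n by omega)]
    exact hθ.add (((hargmin.1.comp hg).sub hθ).const_smul (1 / (((t + 1 : ℕ) : ℝ) + 1)))

theorem StronglyConvexSCO.measurable_deviationSum [IsProbabilityMeasure P] (hp : 1 < p)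
    (h : StronglyConvexSCO p C P f θs D μ β G L γ) (hargmin : IsLinearMinimizer C argmin)
    (hx : ∀ i, Measurable (x i)) (hZ : ∀ j, Measurable (Z j)) {t : ℕ} (ht : t ≤ n) :
    Measurable fun y => deviationSum C P f argmin n (fun i => x i y) (fun j => Z j y) t := by
  refine Finset.measurable_sum _ fun i hi => ?_
  rw [Finset.mem_Icc] at hi
  have hmem : ∀ s y, dpTOFW C f argmin n (fun i => x i y) (fun j => Z j y) s ∈ C :=
    fun s y => dpTOFW_mem _ _ h.convex h.zero_mem hargmin s
  have h1 := h.measurable_dpTOFW (n := n) hp hargmin hx hZ i (by omega)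
  have h2 := h.measurable_dpTOFW (n := n) hp hargmin hx hZ (i - 1) (by omega)
  exact (((h.measurable_grad_comp hp h1 (hx i) (hmem i)).const_smul ((i : ℝ) + 1)).sub
    ((h.measurable_grad_comp hp h2 (hx i) (hmem (i - 1))).const_smul (i : ℝ))).sub
    (((h.measurable_grad_populationLoss_comp hp h1 (hmem i)).const_smul ((i : ℝ) + 1)).sub
    ((h.measurable_grad_populationLoss_comp hp h2 (hmem (i - 1))).const_smul (i : ℝ)))

end Measurability

section Concentration

variable {d : ℕ} {X : Type*} [MeasurableSpace X] {p : ℝ≥0∞} {C : Set (Fin d → ℝ)} {P : Measure X}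
  {f : (Fin d → ℝ) → X → ℝ} {θs : Fin d → ℝ} {D μ β G L γ : ℝ}
  {argmin : (Fin d → ℝ) → Fin d → ℝ} {n : ℕ}

theorem deviationSum_congr {x x' : ℕ → X} {Z Z' : ℕ × ℕ → Fin d → ℝ} {t : ℕ} (htn : t ≤ n)
    (hx : ∀ i ∈ Finset.Icc 1 t, x i = x' i) (hZ : ∀ j ∈ treeNodes n, Z j = Z' j) :
    deviationSum C P f argmin n x Z t = deviationSum C P f argmin n x' Z' t := by
  refine Finset.sum_congr rfl fun i hi => ?_
  have hi' := Finset.mem_Icc.1 hi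
  rw [dpTOFW_congr htn hx hZ i (by omega), dpTOFW_congr htn hx hZ (i - 1) (by omega), hx i hi]

/-- θ_t and θ_{t+1} are determined by the noise and the first t samples, so resampling the last
point affects only the last increment. This is the martingale property in terms of functions of the
samples. -/
theorem deviationSum_update (x : ℕ → X) (Z : ℕ × ℕ → Fin d → ℝ) {t : ℕ} (htn : t < n) (y : X) :
    deviationSum C P f argmin n (Function.update x (t + 1) y) Z (t + 1)
      = deviationSum C P f argmin n x Z t + gradDeviation C P f (t + 1)
          (dpTOFW C f argmin n x Z (t + 1)) (dpTOFW C f argmin n x Z t) y := by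
  have hx : ∀ i ∈ Finset.Icc 1 t, Function.update x (t + 1) y i = x i := fun i hi => by
    rw [Finset.mem_Icc] at hi
    rw [Function.update_of_ne (by omega)]
  rw [← deviationSum_congr htn.le hx (fun _ _ => rfl), deviationSum,
    Finset.sum_Icc_succ_top (by omega), deviationSum, Function.update_self, Nat.add_sub_cancel,
    dpTOFW_congr htn.le hx (fun _ _ => rfl) (t + 1) le_rfl,
    dpTOFW_congr htn.le hx (fun _ _ => rfl) t (by omega)]

/-- With the noise frozen, conditional expectations are integrals over one sample at a time, with no
filtration. The newest sample is integrated first, and each integration costs one factor `K`. -/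
theorem StronglyConvexSCO.lmarginal_exp_deviationSum_le [IsProbabilityMeasure P] (hp : 1 < p)
    (h : StronglyConvexSCO p C P f θs D μ β G L γ) (hargmin : IsLinearMinimizer C argmin)
    {V : (Fin d → ℝ) → ℝ} {κ τ l : ℝ} (hκ : 0 ≤ κ) (hτ : 0 < τ) (hl : 0 ≤ l) (hVc : Continuous V)
    (hV : ∀ ξ, ∃ η : Fin d → ℝ, (∀ ζ, η ⬝ᵥ ζ ≤ ellNorm (dualExp p) ζ) ∧
        ∀ ζ, V (ξ + ζ) ≤ V ξ + η ⬝ᵥ ζ + κ / (2 * τ) * ellNorm (dualExp p) ζ ^ 2)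
    (Z : ℕ × ℕ → Fin d → ℝ) {t : ℕ} (htn : t ≤ n) (x₀ : ℕ → X) :
    lmarginal (fun _ : ℕ => P) (Finset.Icc 1 t)
      (fun x => ENNReal.ofReal (Real.exp (l * V (deviationSum C P f argmin n x Z t)))) x₀ ≤
      ENNReal.ofReal (Real.exp (l * (κ * (G + 2 * β * D) ^ 2 / (2 * τ))
        + l ^ 2 * (G + 2 * β * D) ^ 2 / 2)) ^ t * ENNReal.ofReal (Real.exp (l * V 0)) := by
  have hmeas : ∀ t ≤ n, Measurable fun x : ℕ → X =>
      ENNReal.ofReal (Real.exp (l * V (deviationSum C P f argmin n x Z t))) := fun t ht => by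
    have := h.measurable_deviationSum (Y := ℕ → X) (x := fun i y => y i) (Z := fun j _ => Z j) hp
      hargmin (fun i => measurable_pi_apply i) (fun j => measurable_const) ht
    exact (Real.measurable_exp.comp ((hVc.measurable.comp this).const_mul l)).ennreal_ofReal
  induction t generalizing x₀ with
  | zero => simp [deviationSum]
  | succ t ih =>
    have hins : Finset.Icc 1 (t + 1) = insert (t + 1) (Finset.Icc 1 t) := by
      ext i; simp only [Finset.mem_Icc, Finset.mem_insert]; omega
    rw [hins, lmarginal_insert' _ (hmeas (t + 1) htn) (by simp)]
    set K := ENNReal.ofReal (Real.exp (l * (κ * (G + 2 * β * D) ^ 2 / (2 * τ))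
        + l ^ 2 * (G + 2 * β * D) ^ 2 / 2)) with hK
    have hstep : (fun x : ℕ → X => ∫⁻ y, ENNReal.ofReal (Real.exp (l * V (deviationSum C P f argmin
        n (Function.update x (t + 1) y) Z (t + 1)))) ∂P) ≤ fun x =>
        K * ENNReal.ofReal (Real.exp (l * V (deviationSum C P f argmin n x Z t))) := fun x => by
      simp only [deviationSum_update x Z (show t < n by omega)]
      obtain ⟨η, hη1, hη2⟩ := hV (deviationSum C P f argmin n x Z t)
      have hm := dpTOFW_mem (f := f) (n := n) x Z h.convex h.zero_mem hargmin
      refine lintegral_exp_smooth_approx_le (dualExp_facts hp).1 hκ hτ hl _ hη1 hη2 ?_ ?_ ?_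
      · exact (((h.measurable_grad (hm _)).const_smul (_ : ℝ)).sub
          ((h.measurable_grad (hm _)).const_smul (_ : ℝ))).sub_const _
      · intro y
        exact h.ellNorm_recursive_gradient_error_le hp (hm _) (hm _) (Nat.cast_nonneg _)
          (h.mul_ellNorm_iterate_sub_le hp hargmin x Z (t := t + 1) (by omega) (by omega)) y
      · intro i
        exact h.integral_recursive_gradient_error hp (hm _) (hm _) _ i
    refine (lmarginal_mono hstep x₀).trans ?_
    have hcm : lmarginal (fun _ : ℕ => P) (Finset.Icc 1 t)
        (fun x => K * ENNReal.ofReal (Real.exp (l * V (deviationSum C P f argmin n x Z t)))) x₀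
        = K * lmarginal (fun _ : ℕ => P) (Finset.Icc 1 t)
        (fun x => ENNReal.ofReal (Real.exp (l * V (deviationSum C P f argmin n x Z t)))) x₀ :=
      lintegral_const_mul _ ((hmeas t (by omega)).comp measurable_updateFinset)
    rw [hcm, pow_succ', mul_assoc]
    gcongr
    exact ih (by omega) x₀

/-- Samples later than t do not enter and integrate to 1; this puts all times t ≤ n on the same
product space. -/
theorem StronglyConvexSCO.lmarginal_exp_deviationSum_le' [IsProbabilityMeasure P] (hp : 1 < p)
    (h : StronglyConvexSCO p C P f θs D μ β G L γ) (hargmin : IsLinearMinimizer C argmin)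
    {V : (Fin d → ℝ) → ℝ} {κ τ l : ℝ} (hκ : 0 ≤ κ) (hτ : 0 < τ) (hl : 0 ≤ l) (hVc : Continuous V)
    (hV : ∀ ξ, ∃ η : Fin d → ℝ, (∀ ζ, η ⬝ᵥ ζ ≤ ellNorm (dualExp p) ζ) ∧
        ∀ ζ, V (ξ + ζ) ≤ V ξ + η ⬝ᵥ ζ + κ / (2 * τ) * ellNorm (dualExp p) ζ ^ 2)
    (Z : ℕ × ℕ → Fin d → ℝ) {t m : ℕ} (htm : t ≤ m) (hmn : m ≤ n) (x₀ : ℕ → X) :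
    lmarginal (fun _ : ℕ => P) (Finset.Icc 1 m)
      (fun x => ENNReal.ofReal (Real.exp (l * V (deviationSum C P f argmin n x Z t)))) x₀ ≤
      ENNReal.ofReal (Real.exp (l * (κ * (G + 2 * β * D) ^ 2 / (2 * τ))
        + l ^ 2 * (G + 2 * β * D) ^ 2 / 2)) ^ t * ENNReal.ofReal (Real.exp (l * V 0)) := by
  induction m, htm using Nat.le_induction with
  | base => exact h.lmarginal_exp_deviationSum_le hp hargmin hκ hτ hl hVc hV Z hmn x₀
  | succ m hm ih =>
    have hins : Finset.Icc 1 (m + 1) = insert (m + 1) (Finset.Icc 1 m) := by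
      ext i; simp only [Finset.mem_Icc, Finset.mem_insert]; omega
    have hmeas := h.measurable_deviationSum (Y := ℕ → X) (x := fun i y => y i) (Z := fun j _ => Z j)
      (n := n) (t := t) hp hargmin (fun i => measurable_pi_apply i) (fun j => measurable_const)
      (by omega)
    have hmeas' : Measurable fun x : ℕ → X =>
        ENNReal.ofReal (Real.exp (l * V (deviationSum C P f argmin n x Z t))) :=
      (Real.measurable_exp.comp ((hVc.measurable.comp hmeas).const_mul l)).ennreal_ofReal
    rw [hins, lmarginal_insert' _ hmeas' (by simp)]
    have hup : ∀ (x : ℕ → X) y, deviationSum C P f argmin n (Function.update x (m + 1) y) Z t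
        = deviationSum C P f argmin n x Z t := fun x y =>
      deviationSum_congr (by omega) (fun i hi => by
        rw [Finset.mem_Icc] at hi
        rw [Function.update_of_ne (by omega)]) (fun _ _ => rfl)
    simp only [hup, lintegral_const, measure_univ, mul_one]
    exact ih (by omega)

/-- Concentration of the martingale part, for fixed noise. -/
theorem StronglyConvexSCO.measure_pi_deviationSum_le [IsProbabilityMeasure P] (hp : 1 < p)
    (h : StronglyConvexSCO p C P f θs D μ β G L γ) (hargmin : IsLinearMinimizer C argmin)
    {N : (Fin d → ℝ) → ℝ} {κ : ℝ}
    (hreg : IsRegularNorm (fun x : Fin d → ℝ => ellNorm (dualExp p) x) N κ)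
    (Z : ℕ × ℕ → Fin d → ℝ) {t : ℕ} (ht : 1 ≤ t) (htn : t ≤ n) (x₀ : ℕ → X) {Λ : ℝ} (hΛ : 0 < Λ) :
    Measure.pi (fun _ : Finset.Icc 1 n => P) {u | (G + 2 * β * D) * (√κ + √(2 * Λ)) * √t
      < ellNorm (dualExp p)
        (deviationSum C P f argmin n (Function.updateFinset x₀ (Finset.Icc 1 n) u) Z t)}
      ≤ ENNReal.ofReal (Real.exp (-Λ)) := by
  set b := G + 2 * β * D with hb
  have hκ1 : 1 ≤ κ := by
    obtain ⟨-, -, κp, h1, h2, -⟩ := hreg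
    exact h1.trans h2
  have hb0 : 0 < b := by
    have h1 := h.grad_bound_nonneg hp
    have h2 := h.smooth_pos hp
    have h3 := h.diam_pos
    positivity
  have ht0 : (0 : ℝ) < t := by exact_mod_cast ht
  have hst : 0 < √(t : ℝ) := Real.sqrt_pos.2 ht0
  have hsκ : 0 < √κ := Real.sqrt_pos.2 (by linarith)
  set s := √(2 * Λ) with hs
  have hs0 : 0 < s := Real.sqrt_pos.2 (by linarith)
  have hs2 : s ^ 2 = 2 * Λ := Real.sq_sqrt (by linarith)
  have hκ2 : √κ ^ 2 = κ := Real.sq_sqrt (by linarith)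
  have ht2 : √(t : ℝ) ^ 2 = t := Real.sq_sqrt ht0.le
  -- This τ minimizes τ/2 + tκb²/(2τ), the smoothing error plus the accumulated smoothness terms.
  set τ := b * √κ * √t with hτ
  have hτ0 : 0 < τ := by positivity
  -- The optimal Chernoff parameter for a deviation sb√t with variance proxy tb²; the exponents
  -- below then differ by exactly Λ.
  set l := s / (b * √t) with hl
  have hl0 : 0 < l := by positivity
  obtain ⟨V, hVc, hV1, hV2, hV3⟩ := exists_smooth_approx (dualExp_facts hp).1 hreg hτ0
  have hmain := h.lmarginal_exp_deviationSum_le' hp hargmin (l := l) (κ := κ) (by linarith) hτ0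
    hl0.le hVc hV3 Z htn le_rfl x₀
  rw [← hb] at hmain
  have hV0 : V 0 ≤ 0 :=
    (hV1 0).trans (isNormOn_ellNorm (d := d) (dualExp_facts hp).1).map_zero.le
  set r := b * (√κ + s) * √t with hr
  set W : (Finset.Icc 1 n → X) → ℝ≥0∞ := fun u => ENNReal.ofReal (Real.exp (l * V
    (deviationSum C P f argmin n (Function.updateFinset x₀ (Finset.Icc 1 n) u) Z t))) with hW
  have hWm : Measurable W := by
    have hmeas := h.measurable_deviationSum (Y := ℕ → X) (x := fun i y => y i) (Z := fun j _ => Z j)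
      (n := n) (t := t) hp hargmin (fun i => measurable_pi_apply i) (fun j => measurable_const) htn
    exact ((Real.measurable_exp.comp
      ((hVc.measurable.comp hmeas).const_mul l)).ennreal_ofReal).comp measurable_updateFinset
  set e := ENNReal.ofReal (Real.exp (l * (r - τ / 2))) with he
  have he0 : e ≠ 0 := by rw [he]; simp [Real.exp_pos]
  have hmarkov := mul_meas_ge_le_lintegral (μ := Measure.pi (fun _ : Finset.Icc 1 n => P)) hWm e
  have hsub : {u : Finset.Icc 1 n → X | r < ellNorm (dualExp p)
        (deviationSum C P f argmin n (Function.updateFinset x₀ (Finset.Icc 1 n) u) Z t)}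
      ⊆ {u | e ≤ W u} := fun u hu => by
    refine ENNReal.ofReal_le_ofReal (Real.exp_le_exp.2 (mul_le_mul_of_nonneg_left ?_ hl0.le))
    have := hV2 (deviationSum C P f argmin n (Function.updateFinset x₀ (Finset.Icc 1 n) u) Z t)
    have hu' : r < ellNorm (dualExp p)
        (deviationSum C P f argmin n (Function.updateFinset x₀ (Finset.Icc 1 n) u) Z t) := hu
    linarith
  refine (measure_mono hsub).trans ?_
  have h1 : e * Measure.pi (fun _ : Finset.Icc 1 n => P) {u | e ≤ W u}
      ≤ e * ENNReal.ofReal (Real.exp (-Λ)) := by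
    refine (hmarkov.trans hmain).trans ?_
    rw [← ENNReal.ofReal_pow (Real.exp_nonneg _), ← ENNReal.ofReal_mul (by positivity), he,
      ← ENNReal.ofReal_mul (by positivity), ← Real.exp_nat_mul, ← Real.exp_add, ← Real.exp_add]
    refine ENNReal.ofReal_le_ofReal (Real.exp_le_exp.2 ?_)
    have e1 : (t : ℝ) * (l * (κ * b ^ 2 / (2 * τ)) + l ^ 2 * b ^ 2 / 2) = s * √κ / 2 + Λ := by
      have f1 : (t : ℝ) * (l * (κ * b ^ 2 / (2 * τ))) = s * √κ / 2 := by
        rw [hl, hτ]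
        nth_rw 1 [← ht2, ← hκ2]
        field_simp
      have f2 : (t : ℝ) * (l ^ 2 * b ^ 2 / 2) = Λ := by
        rw [hl, div_pow, mul_pow, ht2, hs2]
        field_simp
      rw [mul_add, f1, f2]
    have e2 : l * (r - τ / 2) = s * √κ / 2 + 2 * Λ := by
      rw [← hs2, hl, hr, hτ]
      field_simp
      ring
    rw [e1, e2]
    have := mul_nonpos_of_nonneg_of_nonpos hl0.le hV0
    linarith
  exact (ENNReal.mul_le_mul_iff_right he0 ENNReal.ofReal_ne_top).1 h1

/-- Concentration of the martingale part of a run of the algorithm. -/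
theorem StronglyConvexSCO.measure_deviationSum_le [IsProbabilityMeasure P] (hp : 1 < p)
    (h : StronglyConvexSCO p C P f θs D μ β G L γ) (hargmin : IsLinearMinimizer C argmin)
    {N : (Fin d → ℝ) → ℝ} {κ : ℝ}
    (hreg : IsRegularNorm (fun x : Fin d → ℝ => ellNorm (dualExp p) x) N κ)
    {Ω : Type*} [MeasurableSpace Ω] {Pr : Measure Ω} [IsProbabilityMeasure Pr]
    {Q : Measure (Fin d → ℝ)} {x : ℕ → Ω → X} {Z : ℕ × ℕ → Ω → Fin d → ℝ}
    (hin : IsRandomInput P Q n Pr x Z) {t : ℕ} (ht : 1 ≤ t) (htn : t ≤ n) {Λ : ℝ} (hΛ : 0 < Λ) :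
    Pr {ω | (G + 2 * β * D) * (√κ + √(2 * Λ)) * √t < ellNorm (dualExp p)
        (deviationSum C P f argmin n (fun i => x i ω) (fun j => Z j ω) t)}
      ≤ ENNReal.ofReal (Real.exp (-Λ)) := by
  -- Arbitrary values fill the samples and nodes outside the run; the deviation sum does not see
  -- them.
  obtain ⟨a₀⟩ := h.nonempty
  set r := (G + 2 * β * D) * (√κ + √(2 * Λ)) * √t
  set x₀ : ℕ → X := fun _ => a₀
  set Z₀ : ℕ × ℕ → Fin d → ℝ := fun _ => 0
  set U : Ω → Finset.Icc 1 n → X := fun ω i => x i ω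
  set W : Ω → treeNodes n → Fin d → ℝ := fun ω j => Z j ω
  have hUm : AEMeasurable U Pr := aemeasurable_pi_lambda _ fun i =>
    (hin.sample_law i i.2).aemeasurable
  have hWm : AEMeasurable W Pr := aemeasurable_pi_lambda _ fun j =>
    (hin.noise_law j j.2).aemeasurable
  have hUlaw : Pr.map U = Measure.pi fun _ : Finset.Icc 1 n => P := by
    have := hin.sample_indep.map_fun_eq_pi_map
      fun i : Finset.Icc 1 n => (hin.sample_law i i.2).aemeasurable
    refine this.trans ?_
    congr 1
    ext1 i
    exact (hin.sample_law i i.2).map_eq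
  have hjoint : Pr.map (fun ω => (U ω, W ω))
      = (Measure.pi fun _ : Finset.Icc 1 n => P).prod (Pr.map W) := by
    rw [← hUlaw]
    exact (indepFun_iff_map_prod_eq_prod_map_map hUm hWm).1 hin.indep
  set B : Set ((Finset.Icc 1 n → X) × (treeNodes n → Fin d → ℝ)) :=
    {y | r < ellNorm (dualExp p) (deviationSum C P f argmin n
      (Function.updateFinset x₀ (Finset.Icc 1 n) y.1)
      (Function.updateFinset Z₀ (treeNodes n) y.2) t)} with hB
  have hBm : MeasurableSet B := by
    refine measurableSet_lt measurable_const ((continuous_ellNorm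
      (dualExp_facts hp).1).measurable.comp (h.measurable_deviationSum (n := n)
      (Y := (Finset.Icc 1 n → X) × (treeNodes n → Fin d → ℝ))
      (x := fun i y => Function.updateFinset x₀ (Finset.Icc 1 n) y.1 i)
      (Z := fun j y => Function.updateFinset Z₀ (treeNodes n) y.2 j)
      hp hargmin (fun i => ?_) (fun j => ?_) htn))
    · have hu : Measurable fun y : (Finset.Icc 1 n → X) × (treeNodes n → Fin d → ℝ) =>
          Function.updateFinset x₀ (Finset.Icc 1 n) y.1 :=
        measurable_updateFinset.comp measurable_fst
      exact (measurable_pi_apply i).comp hu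
    · have hu : Measurable fun y : (Finset.Icc 1 n → X) × (treeNodes n → Fin d → ℝ) =>
          Function.updateFinset Z₀ (treeNodes n) y.2 :=
        measurable_updateFinset.comp measurable_snd
      exact (measurable_pi_apply j).comp hu
  have hpre : {ω | r < ellNorm (dualExp p)
        (deviationSum C P f argmin n (fun i => x i ω) (fun j => Z j ω) t)}
      = (fun ω => (U ω, W ω)) ⁻¹' B := by
    ext ω
    simp only [hB, Set.mem_ofPred_eq, Set.mem_preimage]
    rw [deviationSum_congr (Z := fun j => Z j ω)
      (Z' := Function.updateFinset Z₀ (treeNodes n) (W ω)) htn (x := fun i => x i ω)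
      (x' := Function.updateFinset x₀ (Finset.Icc 1 n) (U ω)) (fun i hi => ?_) (fun j hj => ?_)]
    · rw [Function.updateFinset, dif_pos (Finset.Icc_subset_Icc le_rfl htn hi)]
    · rw [Function.updateFinset, dif_pos hj]
  rw [hpre]
  -- The random inputs are only almost everywhere measurable, so the event is bounded by its image
  -- law, which is a product measure; the bound for frozen noise is then integrated.
  refine (Measure.le_map_apply (hUm.prodMk hWm) B).trans ?_
  have hWp : IsProbabilityMeasure (Pr.map W) := Measure.isProbabilityMeasure_map hWm
  rw [hjoint, Measure.prod_apply_symm hBm]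
  refine (lintegral_mono fun w => h.measure_pi_deviationSum_le hp hargmin hreg
    (Function.updateFinset Z₀ (treeNodes n) w) ht htn x₀ hΛ).trans ?_
  simp

end Concentration

/-! ### The noise -/

section Noise

/-- Multiplying the density by exp(N²/(4σ²)) halves its exponent, which by homogeneity evaluates it
at z/√2; the change of variables gives √2^d. That the law is a probability measure makes the
normalizing constant finite and nonzero. -/
theorem lintegral_exp_sq_generalizedGaussian {d : ℕ} {N : (Fin d → ℝ) → ℝ} (hN : IsNormOn N)
    (hNc : Continuous N) {σ : ℝ} [IsProbabilityMeasure (generalizedGaussian N σ)] :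
    ∫⁻ z, ENNReal.ofReal (Real.exp (N z ^ 2 / (4 * σ ^ 2))) ∂(generalizedGaussian N σ)
      = ENNReal.ofReal (√2 ^ d) := by
  set w : (Fin d → ℝ) → ℝ≥0∞ := fun z => ENNReal.ofReal (Real.exp (-(N z ^ 2) / (2 * σ ^ 2)))
    with hw
  have hwm : Measurable w := by fun_prop
  have hE : Measurable fun z => ENNReal.ofReal (Real.exp (N z ^ 2 / (4 * σ ^ 2))) := by fun_prop
  have hQ : generalizedGaussian N σ
      = (volume.withDensity w Set.univ)⁻¹ • volume.withDensity w := rfl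
  have hone : (volume.withDensity w Set.univ)⁻¹ * volume.withDensity w Set.univ = 1 := by
    have := measure_univ (μ := generalizedGaussian N σ)
    rwa [hQ, Measure.smul_apply, smul_eq_mul] at this
  rw [hQ, lintegral_smul_measure, lintegral_withDensity_eq_lintegral_mul _ hwm hE, smul_eq_mul]
  have h2 : (√2)⁻¹ ≠ 0 := by positivity
  have hprod : (w * fun z => ENNReal.ofReal (Real.exp (N z ^ 2 / (4 * σ ^ 2))))
      = fun z => w ((√2)⁻¹ • z) := by
    ext z
    simp only [hw, Pi.mul_apply]
    rw [← ENNReal.ofReal_mul (by positivity), ← Real.exp_add, hN.smul_eq, mul_pow, sq_abs, inv_pow,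
      Real.sq_sqrt (by norm_num)]
    congr 2
    by_cases hσ : σ = 0
    · simp [hσ]
    · field_simp
      ring
  have hmap : ∫⁻ z, w ((√2)⁻¹ • z) = ENNReal.ofReal (√2 ^ d) * ∫⁻ z, w z := by
    rw [← lintegral_map hwm (measurable_const_smul _), Measure.map_addHaar_smul _ h2,
      lintegral_smul_measure, smul_eq_mul]
    congr 2
    rw [Module.finrank_fin_fun, inv_pow, inv_inv, abs_of_nonneg (by positivity)]
  rw [hprod, hmap]
  rw [withDensity_apply _ MeasurableSet.univ, setLIntegral_univ] at hone ⊢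
  rw [mul_left_comm, hone, mul_one]

theorem measure_treeNoise_le {d n : ℕ} {q : ℝ≥0∞} {N : (Fin d → ℝ) → ℝ} {κ σ : ℝ}
    (hreg : IsRegularNorm (fun x : Fin d → ℝ => ellNorm q x) N κ) (hσ : 0 < σ)
    {X : Type*} [MeasurableSpace X] {P : Measure X}
    {Ω : Type*} [MeasurableSpace Ω] {Pr : Measure Ω} [IsProbabilityMeasure Pr]
    {x : ℕ → Ω → X} {Z : ℕ × ℕ → Ω → Fin d → ℝ}
    (hin : IsRandomInput P (generalizedGaussian N σ) n Pr x Z) {t : ℕ} (htn : t ≤ n) {Λ : ℝ} :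
    Pr {ω | √(((Nat.clog 2 n : ℝ) + 1) * (4 * σ ^ 2 * (((Nat.clog 2 n : ℝ) + 1) * d + Λ)))
        < ellNorm q (treeNoise n (fun j => Z j ω) t)}
      ≤ ENNReal.ofReal (Real.exp (-Λ)) := by
  obtain ⟨hn, hN, κp, hκp, hκ, hsm, hcmp⟩ := hreg
  have hNc : Continuous N := hsm.continuous hN
  set F := (Finset.range (Nat.clog 2 n + 1)).filter (fun l => t.testBit l = true) with hF
  set m : ℝ := (Nat.clog 2 n : ℝ) + 1 with hm
  have hFm : (F.card : ℝ) ≤ m := by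
    have := Finset.card_filter_le (Finset.range (Nat.clog 2 n + 1)) (fun l => t.testBit l = true)
    rw [Finset.card_range] at this
    rw [hm]
    exact_mod_cast this
  have hnode : ∀ l : F, readNode t l ∈ treeNodes n := fun l => by
    have := Finset.mem_filter.1 l.2
    exact readNode_mem_treeNodes htn (Finset.mem_range.1 this.1) this.2
  have hinj : Function.Injective fun l : F => (⟨readNode t l, hnode l⟩ : treeNodes n) :=
    fun l l' hll => by
      have h1 := congrArg (fun j : treeNodes n => (j : ℕ × ℕ).1) hll
      simp only [readNode_fst] at h1
      exact Subtype.ext h1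
  set E : (Fin d → ℝ) → ℝ≥0∞ := fun z => ENNReal.ofReal (Real.exp (N z ^ 2 / (4 * σ ^ 2))) with hE
  have hEm : Measurable E := by fun_prop
  set Y : F → Ω → ℝ≥0∞ := fun l ω => E (Z (readNode t l) ω) with hY
  have hYi : iIndepFun Y Pr :=
    (hin.noise_indep.precomp hinj).comp (fun _ => E) (fun _ => hEm)
  have hYm : ∀ l, AEMeasurable (Y l) Pr := fun l =>
    hEm.comp_aemeasurable (hin.noise_law _ (hnode l)).aemeasurable
  have hYint : ∀ l, ∫⁻ ω, Y l ω ∂Pr = ENNReal.ofReal (√2 ^ d) := fun l => by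
    have hlaw := hin.noise_law _ (hnode l)
    have : IsProbabilityMeasure (generalizedGaussian N σ) := by
      rw [← hlaw.map_eq]; exact Measure.isProbabilityMeasure_map hlaw.aemeasurable
    rw [← lintegral_exp_sq_generalizedGaussian hN hNc (σ := σ), ← hlaw.map_eq,
      lintegral_map' hEm.aemeasurable hlaw.aemeasurable]
  have hprod : ∫⁻ ω, ∏ l, Y l ω ∂Pr = ENNReal.ofReal (√2 ^ d) ^ F.card := by
    have hae : ∀ᵐ ω ∂Pr, ∀ l, Y l ω = (hYm l).mk (Y l) ω :=
      ae_all_iff.2 fun l => (hYm l).ae_eq_mk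
    have h1 : ∫⁻ ω, ∏ l, Y l ω ∂Pr = ∫⁻ ω, ∏ l, (hYm l).mk (Y l) ω ∂Pr :=
      lintegral_congr_ae (by filter_upwards [hae] with ω hω; simp only [hω])
    rw [h1, lintegral_prod_eq_prod_lintegral_of_indepFun Finset.univ _
      (hYi.congr fun l => (hYm l).ae_eq_mk) fun l => (hYm l).measurable_mk]
    have h2 : ∀ l, ∫⁻ ω, (hYm l).mk (Y l) ω ∂Pr = ENNReal.ofReal (√2 ^ d) := fun l => by
      rw [← lintegral_congr_ae (hYm l).ae_eq_mk, hYint]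
    simp [h2]
  have hprod' : ∀ ω, ∏ l, Y l ω
      = ENNReal.ofReal (Real.exp (∑ l ∈ F, N (Z (readNode t l) ω) ^ 2 / (4 * σ ^ 2))) := fun ω => by
    rw [Real.exp_sum, ENNReal.ofReal_prod_of_nonneg fun _ _ => (Real.exp_nonneg _)]
    exact Finset.prod_coe_sort F fun l =>
      ENNReal.ofReal (Real.exp (N (Z (readNode t l) ω) ^ 2 / (4 * σ ^ 2)))
  set e := ENNReal.ofReal (Real.exp (m * d + Λ)) with he
  have he0 : e ≠ 0 := by rw [he]; simp [Real.exp_pos]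
  have hmarkov := mul_meas_ge_le_lintegral₀ (μ := Pr) (f := fun ω => ∏ l, Y l ω)
    (Finset.aemeasurable_fun_prod _ fun l _ => hYm l) e
  rw [hprod] at hmarkov
  have hsub : {ω | √(m * (4 * σ ^ 2 * (m * d + Λ)))
      < ellNorm q (treeNoise n (fun j => Z j ω) t)} ⊆ {ω | e ≤ ∏ l, Y l ω} := fun ω hω => by
    change e ≤ ∏ l, Y l ω
    rw [hprod']
    refine ENNReal.ofReal_le_ofReal (Real.exp_le_exp.2 ?_)
    -- Cauchy–Schwarz over the at most m nodes reduces the noise to a sum of independent N², whose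
    -- exponential moments multiply.
    have h1 : ellNorm q (treeNoise n (fun j => Z j ω) t) ^ 2
        ≤ m * ∑ l ∈ F, N (Z (readNode t l) ω) ^ 2 := by
      calc ellNorm q (treeNoise n (fun j => Z j ω) t) ^ 2
          ≤ N (treeNoise n (fun j => Z j ω) t) ^ 2 := (hcmp _).1
        _ ≤ (∑ l ∈ F, N (Z (readNode t l) ω)) ^ 2 :=
          pow_le_pow_left₀ (hN.nonneg _) (hN.sum_le _ _) 2
        _ ≤ F.card * ∑ l ∈ F, N (Z (readNode t l) ω) ^ 2 := sq_sum_le_card_mul_sum_sq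
        _ ≤ _ := by gcongr
    have h2 : m * (4 * σ ^ 2 * (m * d + Λ)) < ellNorm q (treeNoise n (fun j => Z j ω) t) ^ 2 :=
      Real.lt_sq_of_sqrt_lt hω
    have hm0 : 0 < m := by positivity
    have h3 := lt_of_mul_lt_mul_left (h2.trans_le h1) hm0.le
    rw [← Finset.sum_div, le_div_iff₀ (by positivity)]
    linarith
  refine (measure_mono hsub).trans ?_
  have h1 : e * Pr {ω | e ≤ ∏ l, Y l ω} ≤ e * ENNReal.ofReal (Real.exp (-Λ)) := by
    refine hmarkov.trans ?_
    rw [he, ← ENNReal.ofReal_mul (by positivity), ← Real.exp_add, add_neg_cancel_right,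
      ← ENNReal.ofReal_pow (by positivity)]
    refine ENNReal.ofReal_le_ofReal ?_
    have h2 : √2 ≤ Real.exp 1 := by
      have := Real.exp_one_gt_d9
      rw [Real.sqrt_le_left (by positivity)]
      nlinarith
    calc (√2 ^ d) ^ F.card ≤ (Real.exp 1 ^ d) ^ F.card := by gcongr
      _ = Real.exp (F.card * d) := by
        rw [← Real.exp_nat_mul, ← Real.exp_nat_mul, mul_one]
      _ ≤ _ := by gcongr
  exact (ENNReal.mul_le_mul_iff_right he0 ENNReal.ofReal_ne_top).1 h1

end Noise

/-! ### The convergence guarantees -/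

theorem natCast_clog_add_one_le {n : ℕ} (hn : 1 ≤ n) :
    (Nat.clog 2 n : ℝ) + 1 ≤ 2 + 2 * Real.log n := by
  have hu : 0 ≤ Real.log n := Real.log_nonneg (by exact_mod_cast hn)
  rcases Nat.lt_or_ge 1 n with h | h
  · have h1 : 2 ^ (Nat.clog 2 n - 1) < n := Nat.pow_pred_clog_lt_self one_lt_two h
    have h2 : 1 ≤ Nat.clog 2 n := Nat.clog_pos one_lt_two h
    have h3 : ((2 : ℝ) ^ (Nat.clog 2 n - 1)) ≤ n := by exact_mod_cast h1.le
    have h4 := Real.log_le_log (by positivity) h3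
    rw [Real.log_pow, Nat.cast_sub h2, Nat.cast_one] at h4
    have h5 : (1 : ℝ) ≤ Nat.clog 2 n := by exact_mod_cast h2
    nlinarith [Real.log_two_gt_d9]
  · have : n = 1 := le_antisymm h hn
    subst this
    simp

/-- For small n, log log n is negative, but it is at least 1 − 1/log 2 > −0.45, and 3 · 0.45 < 2 log
2. -/
theorem log_div_le_three_mul {n : ℕ} (hn : 2 ≤ n) {α : ℝ} (hα : 0 < α) (hα1 : α < 1) :
    Real.log (n / α) ≤ 3 * Real.log (n * Real.log n / α) := by
  have hn0 : (0 : ℝ) < n := by exact_mod_cast (by omega : 0 < n)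
  have hu : Real.log 2 ≤ Real.log n :=
    Real.log_le_log (by norm_num) (by exact_mod_cast hn)
  have h2 := Real.log_two_gt_d9
  have hu0 : 0 < Real.log n := by linarith
  have hα' : Real.log α ≤ 0 := Real.log_nonpos hα.le hα1.le
  rw [Real.log_div (by positivity) hα.ne', Real.log_div (by positivity) hα.ne',
    Real.log_mul hn0.ne' hu0.ne']
  have h3 := Real.one_sub_inv_le_log_of_pos hu0
  have h4 : (Real.log n)⁻¹ ≤ 1.45 := by
    rw [inv_le_comm₀ hu0 (by norm_num)]
    norm_num
    linarith
  linarith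

/-- Subadditivity alone is used, so the event need not be measurable. -/
theorem ofReal_one_sub_le_measure {Ω : Type*} [MeasurableSpace Ω] {Pr : Measure Ω}
    [IsProbabilityMeasure Pr] {S : Set Ω} {α : ℝ} (hα : 0 ≤ α) (h : Pr Sᶜ ≤ ENNReal.ofReal α) :
    ENNReal.ofReal (1 - α) ≤ Pr S := by
  rw [ENNReal.ofReal_sub _ hα, ENNReal.ofReal_one, tsub_le_iff_right]
  calc (1 : ℝ≥0∞) = Pr Set.univ := measure_univ.symm
    _ ≤ Pr S + Pr Sᶜ := measure_univ_le_add_compl S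
    _ ≤ _ := by gcongr

section

variable {d n : ℕ} {X : Type*} [MeasurableSpace X] {p : ℝ≥0∞} {C : Set (Fin d → ℝ)} {P : Measure X}
  {f : (Fin d → ℝ) → X → ℝ} {θs : Fin d → ℝ} {D μ β G L γ : ℝ}
  {argmin : (Fin d → ℝ) → Fin d → ℝ} {N : (Fin d → ℝ) → ℝ} {κ σ : ℝ}
  {Ω : Type*} [MeasurableSpace Ω] {Pr : Measure Ω} [IsProbabilityMeasure Pr]
  {x : ℕ → Ω → X} {Z : ℕ × ℕ → Ω → Fin d → ℝ}

theorem StronglyConvexSCO.measure_compl_le [IsProbabilityMeasure P] (hp : 1 < p)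
    (h : StronglyConvexSCO p C P f θs D μ β G L γ)
    (hreg : IsRegularNorm (fun x : Fin d → ℝ => ellNorm (dualExp p) x) N κ) (hσ : 0 < σ)
    (hargmin : IsLinearMinimizer C argmin)
    (hin : IsRandomInput P (generalizedGaussian N σ) n Pr x Z) {Λ : ℝ} (hΛ : 0 < Λ) :
    Pr {ω | (∀ t ∈ Finset.Icc 1 n, ellNorm (dualExp p)
          (deviationSum C P f argmin n (fun i => x i ω) (fun j => Z j ω) t)
            ≤ (G + 2 * β * D) * (√κ + √(2 * Λ)) * √t) ∧
        ∀ t ∈ Finset.Icc 1 n, ellNorm (dualExp p) (treeNoise n (fun j => Z j ω) t)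
          ≤ √(((Nat.clog 2 n : ℝ) + 1) * (4 * σ ^ 2 * (((Nat.clog 2 n : ℝ) + 1) * d + Λ)))}ᶜ
      ≤ ENNReal.ofReal (2 * n * Real.exp (-Λ)) := by
  set a := ENNReal.ofReal (Real.exp (-Λ)) with ha
  set E₁ : ℕ → Set Ω := fun t => {ω | (G + 2 * β * D) * (√κ + √(2 * Λ)) * √t < ellNorm (dualExp p)
    (deviationSum C P f argmin n (fun i => x i ω) (fun j => Z j ω) t)} with hE₁
  set E₂ : ℕ → Set Ω := fun t => {ω | √(((Nat.clog 2 n : ℝ) + 1)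
    * (4 * σ ^ 2 * (((Nat.clog 2 n : ℝ) + 1) * d + Λ)))
      < ellNorm (dualExp p) (treeNoise n (fun j => Z j ω) t)} with hE₂
  have hE : ∀ t ∈ Finset.Icc 1 n, Pr (E₁ t ∪ E₂ t) ≤ 2 * a := fun t ht => by
    rw [Finset.mem_Icc] at ht
    rw [two_mul]
    exact (measure_union_le _ _).trans (add_le_add
      (h.measure_deviationSum_le hp hargmin hreg hin ht.1 ht.2 hΛ)
      (measure_treeNoise_le hreg hσ hin ht.2))
  calc _ ≤ Pr (⋃ t ∈ Finset.Icc 1 n, E₁ t ∪ E₂ t) := by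
        refine measure_mono fun ω hω => ?_
        by_contra hcon
        simp only [Set.mem_iUnion, not_exists, Set.mem_union, not_or, hE₁, hE₂,
          Set.mem_ofPred_eq, not_lt] at hcon
        exact hω ⟨fun t ht => (hcon t ht).1, fun t ht => (hcon t ht).2⟩
    _ ≤ ∑ t ∈ Finset.Icc 1 n, Pr (E₁ t ∪ E₂ t) := measure_biUnion_finset_le _ _
    _ ≤ ∑ t ∈ Finset.Icc 1 n, 2 * a := Finset.sum_le_sum hE
    _ = _ := by
      rw [Finset.sum_const, Nat.card_Icc, Nat.add_sub_cancel, nsmul_eq_mul, ha,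
        mul_comm (2 : ℝ) (n : ℝ), mul_assoc, ENNReal.ofReal_mul (Nat.cast_nonneg _),
        ENNReal.ofReal_mul zero_le_two, ENNReal.ofReal_natCast, ENNReal.ofReal_ofNat]

/-- The high-probability convergence guarantee of DP-TOFW. -/
theorem StronglyConvexSCO.measure_excess_le [IsProbabilityMeasure P] (hd : 1 ≤ d) (hn : 1 ≤ n)
    (hp : 1 < p) (h : StronglyConvexSCO p C P f θs D μ β G L γ)
    (hreg : IsRegularNorm (fun x : Fin d → ℝ => ellNorm (dualExp p) x) N κ) (hσ : 0 < σ)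
    (hargmin : IsLinearMinimizer C argmin)
    (hin : IsRandomInput P (generalizedGaussian N σ) n Pr x Z) {α : ℝ} (hα : 0 < α) (hα1 : α < 1) :
    ENNReal.ofReal (1 - α) ≤ Pr {ω | ∀ t ∈ Finset.Icc 1 n,
      populationLoss P f (dpTOFW C f argmin n (fun i => x i ω) (fun j => Z j ω) t)
          - populationLoss P f θs ≤
        64 * 2304 * (1 / (γ ^ 2 * μ) * (D ^ 2 * (β * D + G) ^ 2 * (κ + Real.log (n / α)) / t)
          + 1 / (γ ^ 2 * μ) * ((β ^ 2 * D ^ 4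
              + d * D ^ 2 * σ ^ 2 * Real.log (n * Real.log n / α) * Real.log n ^ 2)
                * Real.log n / (t : ℝ) ^ 2))} := by
  have hD := h.diam_pos
  have hβ := h.smooth_pos hp
  have hG := h.grad_bound_nonneg hp
  have hμ := h.mu_pos
  have hγ := h.gamma_pos
  have hκ : 1 ≤ κ := by
    obtain ⟨-, -, κp, h1, h2, -⟩ := hreg
    exact h1.trans h2
  have hgm : 0 < γ ^ 2 * μ := by positivity
  have hn0 : (0 : ℝ) < n := by exact_mod_cast hn
  have hd1 : (1 : ℝ) ≤ d := by exact_mod_cast hd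
  have hα' : Real.log α ≤ 0 := Real.log_nonpos hα.le hα1.le
  set u := Real.log n with hu
  set y := Real.log (n / α) with hy
  have hu0 : 0 ≤ u := Real.log_nonneg (by exact_mod_cast hn)
  have huy : u ≤ y := by
    rw [hy, Real.log_div hn0.ne' hα.ne']
    linarith
  -- For n = 1 every log n factor vanishes and only t = 1 remains, where the deterministic bound βD²
  -- on the excess loss suffices.
  rcases Nat.lt_or_ge 1 n with hn2 | hn2
  · have h2 := Real.log_two_gt_d9
    have hu2 : Real.log 2 ≤ u := Real.log_le_log (by norm_num) (by exact_mod_cast hn2)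
    set W := Real.log (n * u / α) with hW
    have hyW : y ≤ 3 * W := log_div_le_three_mul hn2 hα hα1
    -- The union bound is over two events at each of n times, so 2n·exp(−Λ) must equal α.
    set Λ := Real.log 2 + y with hΛ
    have hΛ0 : 0 < Λ := by linarith
    have hexp : 2 * n * Real.exp (-Λ) = α := by
      rw [hΛ, hy, neg_add, Real.exp_add, Real.exp_neg, Real.exp_neg, Real.exp_log two_pos,
        Real.exp_log (by positivity)]
      field_simp
    set m := (Nat.clog 2 n : ℝ) + 1 with hm
    have hm0 : 0 < m := by positivity
    have hmu : m ≤ 6 * u := (natCast_clog_add_one_le hn).trans (by linarith)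
    have hprob := h.measure_compl_le hp hreg hσ hargmin hin hΛ0
    rw [hexp] at hprob
    refine (ofReal_one_sub_le_measure hα.le hprob).trans (measure_mono fun ω hω t ht => ?_)
    have ht0 : (0 : ℝ) < t := by exact_mod_cast (Finset.mem_Icc.1 ht).1
    have hb0 : 0 < G + 2 * β * D := by positivity
    -- The recursion needs l ≥ 1 and l ≥ log n; for n ≥ 2, l = 2 log n meets both because log 2 >
    -- 1/2.
    have key := h.excess_iterate_le hp hargmin (n := n) (fun i => x i ω) (fun j => Z j ω)
      (l := 2 * u) (by positivity) (Real.sqrt_nonneg _) (by linarith) (by linarith) hω.1 hω.2 t ht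
    refine key.trans ?_
    set A := (G + 2 * β * D) * (√κ + √(2 * Λ)) with hA
    set B := √(m * (4 * σ ^ 2 * (m * d + Λ))) with hB
    have hA2 : (D * A + 2 * β * D ^ 2) ^ 2 ≤ 2304 * (D ^ 2 * (β * D + G) ^ 2 * (κ + y)) := by
      have e1 : (√κ + √(2 * Λ)) ^ 2 ≤ 8 * (κ + y) := by
        have := add_sq_le (a := √κ) (b := √(2 * Λ))
        rw [Real.sq_sqrt (by linarith), Real.sq_sqrt (by linarith)] at this
        linarith
      have e2 : (D * A + 2 * β * D ^ 2) ≤ 2 * (D * (β * D + G)) * (√κ + √(2 * Λ) + 1) := by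
        rw [hA]
        have := Real.sqrt_nonneg κ
        have := Real.sqrt_nonneg (2 * Λ)
        have : 0 ≤ D * G * (√κ + √(2 * Λ) + 2) := by positivity
        linarith
      have e3 : (√κ + √(2 * Λ) + 1) ^ 2 ≤ 18 * (κ + y) := by
        have := add_sq_le (a := √κ + √(2 * Λ)) (b := 1)
        linarith
      calc (D * A + 2 * β * D ^ 2) ^ 2
          ≤ (2 * (D * (β * D + G)) * (√κ + √(2 * Λ) + 1)) ^ 2 := by gcongr
        _ = 4 * (D ^ 2 * (β * D + G) ^ 2) * (√κ + √(2 * Λ) + 1) ^ 2 := by ring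
        _ ≤ 4 * (D ^ 2 * (β * D + G) ^ 2) * (18 * (κ + y)) := by gcongr
        _ = 72 * (D ^ 2 * (β * D + G) ^ 2 * (κ + y)) := by ring
        _ ≤ _ := by
          have hy0 : 0 ≤ y := by linarith
          have : 0 ≤ D ^ 2 * (β * D + G) ^ 2 * (κ + y) := by positivity
          linarith
    -- The constant 2304 = 16 · 144 originates here: 16 from (2u)² and 4σ², and 144 from m ≤ 6u and
    -- md + Λ ≤ 24Wd.
    have hB2 : (D * B) ^ 2 * (2 * u) ^ 2 ≤ 2304 * ((β ^ 2 * D ^ 4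
        + d * D ^ 2 * σ ^ 2 * W * u ^ 2) * u) := by
      have e1 : m * (m * d + Λ) ≤ 144 * (u * W * d) := by
        have f1 : m * d + Λ ≤ 24 * (W * d) := by
          have : m * d ≤ 18 * W * d := by
            gcongr
            linarith
          have : W * 1 ≤ W * d := by
            gcongr
            linarith
          linarith
        calc m * (m * d + Λ) ≤ (6 * u) * (24 * (W * d)) := by
              gcongr
          _ = _ := by ring
      have hB' : B ^ 2 = m * (4 * σ ^ 2 * (m * d + Λ)) := Real.sq_sqrt (by positivity)
      calc (D * B) ^ 2 * (2 * u) ^ 2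
          = 16 * (D ^ 2 * σ ^ 2 * u ^ 2) * (m * (m * d + Λ)) := by
            rw [mul_pow, hB']
            ring
        _ ≤ 16 * (D ^ 2 * σ ^ 2 * u ^ 2) * (144 * (u * W * d)) := by gcongr
        _ ≤ 16 * (D ^ 2 * σ ^ 2 * u ^ 2) * (144 * (u * W * d)) + 2304 * (β ^ 2 * D ^ 4 * u) :=
          le_add_of_nonneg_right (by positivity)
        _ = _ := by ring
    rw [mul_assoc (64 : ℝ) 2304]
    refine mul_le_mul_of_nonneg_left ?_ (by norm_num)
    calc _ ≤ 2304 * (D ^ 2 * (β * D + G) ^ 2 * (κ + y)) / (γ ^ 2 * μ * t)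
          + 2304 * ((β ^ 2 * D ^ 4 + d * D ^ 2 * σ ^ 2 * W * u ^ 2) * u) / (γ ^ 2 * μ * t ^ 2) := by
          gcongr
      _ = _ := by
        field_simp
  · have hn1 : n = 1 := le_antisymm hn2 hn
    have hul : u = 0 := by rw [hu, hn1]; simp
    refine (ENNReal.ofReal_le_one.2 (by linarith)).trans ?_
    rw [← measure_univ (μ := Pr)]
    refine measure_mono fun ω _ t ht => ?_
    have ht1 : t = 1 := by
      rw [Finset.mem_Icc] at ht
      omega
    rw [ht1]
    refine (h.excess_le hp (dpTOFW_mem _ _ h.convex h.zero_mem hargmin 1)).trans ?_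
    rw [hul]
    have hγD : γ ^ 2 ≤ D ^ 2 := by
      have := h.gamma_le_diam
      gcongr
    have hμβ := h.mu_le hp
    have e1 : γ ^ 2 * μ * (β * D ^ 2) ≤ 2 * (D ^ 2 * (β * D + G) ^ 2 * (κ + y)) := by
      calc γ ^ 2 * μ * (β * D ^ 2) ≤ D ^ 2 * (2 * β) * (β * D ^ 2) := by gcongr
        _ = 2 * (D ^ 2 * (β * D + 0) ^ 2 * (1 + 0)) := by ring
        _ ≤ _ := by
          gcongr
          linarith
    have e2 : β * D ^ 2 ≤ 2 * (1 / (γ ^ 2 * μ) * (D ^ 2 * (β * D + G) ^ 2 * (κ + y))) := by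
      have : 2 * (1 / (γ ^ 2 * μ) * (D ^ 2 * (β * D + G) ^ 2 * (κ + y)))
          = 2 * (D ^ 2 * (β * D + G) ^ 2 * (κ + y)) / (γ ^ 2 * μ) := by ring
      rw [this, le_div_iff₀ hgm]
      linarith
    have e3 : 0 ≤ 1 / (γ ^ 2 * μ) * (D ^ 2 * (β * D + G) ^ 2 * (κ + y)) := by
      have : 0 ≤ y := by linarith
      positivity
    simp only [Nat.cast_one, div_one, mul_zero, zero_div, add_zero]
    linarith

end

/-! ### The rate at the private noise level -/

theorem kappaQ_le {p : ℝ≥0∞} (hp2 : p ≤ 2) (d : ℕ) : kappaQ p d ≤ (dualExp p).toReal - 1 := by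
  rw [kappaQ, if_pos hp2]
  split_ifs with h
  · exact h.2.le
  · exact le_rfl

theorem IsRegularNorm.one_le {d : ℕ} {nrm N : (Fin d → ℝ) → ℝ} {κ : ℝ}
    (h : IsRegularNorm nrm N κ) : 1 ≤ κ := by
  obtain ⟨-, -, κp, h1, h2, -⟩ := h
  exact h1.trans h2

/-- The logarithmic factors of the private noise level. -/
theorem log_factors_le {n : ℕ} (hn : 1 ≤ n) {α δ : ℝ} (hα : 0 < α) (hα1 : α < 1) (hδ : 0 < δ)
    (hδ1 : δ < 1) :
    ((Nat.clog 2 n : ℝ) + 1) ^ 2 * Real.log (((Nat.clog 2 n : ℝ) + 1) / δ)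
        * Real.log (n * Real.log n / α) * Real.log n ^ 3
      ≤ 16 * (1 + Real.log (n / (α * δ))) ^ 7 := by
  have hn0 : (0 : ℝ) < n := by exact_mod_cast hn
  have hα' : Real.log α ≤ 0 := Real.log_nonpos hα.le hα1.le
  have hδ' : Real.log δ ≤ 0 := Real.log_nonpos hδ.le hδ1.le
  set u := Real.log n with hu
  have hu0 : 0 ≤ u := Real.log_nonneg (by exact_mod_cast hn)
  set m := (Nat.clog 2 n : ℝ) + 1 with hm
  have hm1 : 1 ≤ m := le_add_of_nonneg_left (Nat.cast_nonneg _)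
  have hmu : m ≤ 2 + 2 * u := natCast_clog_add_one_le hn
  set s := 1 + Real.log (n / (α * δ)) with hs
  have hs' : s = 1 + (u - (Real.log α + Real.log δ)) := by
    rw [hs, Real.log_div hn0.ne' (by positivity), Real.log_mul hα.ne' hδ.ne']
  have hlm : Real.log (m / δ) ≤ 2 * s := by
    rw [Real.log_div (by positivity) hδ.ne']
    have := Real.log_le_sub_one_of_pos (show 0 < m by positivity)
    linarith
  have hlm0 : 0 ≤ Real.log (m / δ) :=
    Real.log_nonneg ((one_le_div hδ).2 (by linarith))
  have hW : 0 ≤ Real.log (n * u / α) ∧ Real.log (n * u / α) ≤ 2 * s := by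
    rcases Nat.lt_or_ge 1 n with hn2 | hn2
    · have hu0 : 0 < u := Real.log_pos (by exact_mod_cast hn2)
      constructor
      · have h1 := log_div_le_three_mul hn2 hα hα1
        rw [Real.log_div hn0.ne' hα.ne'] at h1
        linarith
      · rw [Real.log_div (by positivity) hα.ne', Real.log_mul hn0.ne' hu0.ne']
        have := Real.log_le_sub_one_of_pos hu0
        linarith
    · have hul : u = 0 := by rw [hu, le_antisymm hn2 hn]; simp
      rw [hul]
      -- For n = 1 the argument of the logarithm is 0, and `Real.log 0 = 0` makes both inequalities
      -- hold.
      simp only [mul_zero, zero_div, Real.log_zero, le_refl, true_and]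
      linarith
  -- Two factors m, one log(m/δ) and one log(n log n/α), each at most 2s, with three factors log n ≤
  -- s: hence 2⁴s⁷.
  calc m ^ 2 * Real.log (m / δ) * Real.log (n * u / α) * u ^ 3
      ≤ (2 * s) ^ 2 * (2 * s) * (2 * s) * s ^ 3 := by
        have hs0 : 0 ≤ s := by linarith
        have hW0 := hW.1
        have hW2 := hW.2
        gcongr <;> linarith
    _ = _ := by ring

theorem StronglyConvexSCO.measure_excess_le_of_privateSigma {d n : ℕ} {X : Type*}
    [MeasurableSpace X] {p : ℝ≥0∞} {C : Set (Fin d → ℝ)} {P : Measure X}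
    {f : (Fin d → ℝ) → X → ℝ} {θs : Fin d → ℝ} {D μ β G L γ : ℝ}
    {argmin : (Fin d → ℝ) → Fin d → ℝ} {Ω : Type*} [MeasurableSpace Ω] {Pr : Measure Ω}
    [IsProbabilityMeasure Pr] {x : ℕ → Ω → X} {Z : ℕ × ℕ → Ω → Fin d → ℝ}
    [IsProbabilityMeasure P] (hd : 1 ≤ d) (hn : 1 ≤ n) (hp : 1 < p) (hp2 : p ≤ 2)
    (h : StronglyConvexSCO p C P f θs D μ β G L γ) (hargmin : IsLinearMinimizer C argmin)
    {ε δ : ℝ} (hε : 0 < ε) (hδ : 0 < δ) (hδ1 : δ < 1)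
    (hin : IsRandomInput P (generalizedGaussian (plusNorm p) (privateSigma p d n ε δ β D L))
      n Pr x Z) {α : ℝ} (hα : 0 < α) (hα1 : α < 1) :
    ENNReal.ofReal (1 - α) ≤ Pr {ω | ∀ t ∈ Finset.Icc 1 n,
      populationLoss P f (dpTOFW C f argmin n (fun i => x i ω) (fun j => Z j ω) t)
          - populationLoss P f θs ≤
        64 * 2304 * (1 / (γ ^ 2 * μ) * (((dualExp p).toReal - 1) * (D ^ 2 * (β * D + G) ^ 2)
            + β ^ 2 * D ^ 4 + 128 * ((dualExp p).toReal - 1) * D ^ 2 * (β * D + L) ^ 2))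
          * ((1 + Real.log (n / α)) / t
            + (1 + Real.log (n / (α * δ))) ^ 7 * d / ((t : ℝ) ^ 2 * ε ^ 2))} := by
  have hreg := isRegularNorm_plusNorm hd hp
  have hD := h.diam_pos
  have hβ := h.smooth_pos hp
  have hG := h.grad_bound_nonneg hp
  have hL := h.lipschitz_nonneg hp
  have hμ := h.mu_pos
  have hγ := h.gamma_pos
  have hκ := hreg.one_le
  have hκQ := kappaQ_le hp2 d
  set κ := kappaQ p d with hκ_def
  set Q := (dualExp p).toReal - 1 with hQ
  have hn0 : (0 : ℝ) < n := by exact_mod_cast hn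
  have hα' : Real.log α ≤ 0 := Real.log_nonpos hα.le hα1.le
  have hδ' : Real.log δ ≤ 0 := Real.log_nonpos hδ.le hδ1.le
  have hm1 : (1 : ℝ) ≤ (Nat.clog 2 n : ℝ) + 1 := le_add_of_nonneg_left (Nat.cast_nonneg _)
  have hlog := log_factors_le hn hα hα1 hδ hδ1
  set m := (Nat.clog 2 n : ℝ) + 1 with hm
  have hlm : 0 < Real.log (m / δ) := Real.log_pos ((one_lt_div hδ).2 (by linarith))
  set σ := privateSigma p d n ε δ β D L with hσ_def
  have hσ2 : σ ^ 2 = 8 * m ^ 2 * κ * Real.log (m / δ) * (β * D + L) ^ 2 / ε ^ 2 :=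
    Real.sq_sqrt (by positivity)
  have hσ : 0 < σ := Real.sqrt_pos.2 (by positivity)
  refine (h.measure_excess_le hd hn hp hreg hσ hargmin hin hα hα1).trans
    (measure_mono fun ω hω t ht => (hω t ht).trans ?_)
  have ht1 : (1 : ℝ) ≤ t := by exact_mod_cast (Finset.mem_Icc.1 ht).1
  have ht0 : (0 : ℝ) < t := by linarith
  set u := Real.log n with hu
  have hu0 : 0 ≤ u := Real.log_nonneg (by exact_mod_cast hn)
  set y := Real.log (n / α) with hy
  have huy : u ≤ y := by
    rw [hy, Real.log_div hn0.ne' hα.ne']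
    linarith
  set s := 1 + Real.log (n / (α * δ)) with hs
  have hs0 : 0 ≤ s := by
    rw [hs, Real.log_div hn0.ne' (by positivity), Real.log_mul hα.ne' hδ.ne']
    linarith
  set W := Real.log (n * u / α) with hW
  rw [mul_assoc (64 * 2304 : ℝ), mul_assoc (1 / (γ ^ 2 * μ)), ← mul_add]
  refine mul_le_mul_of_nonneg_left (mul_le_mul_of_nonneg_left ?_ (by positivity)) (by norm_num)
  have e1 : D ^ 2 * (β * D + G) ^ 2 * (κ + y) / t
      ≤ Q * (D ^ 2 * (β * D + G) ^ 2) * ((1 + y) / t) := by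
    rw [mul_div_assoc']
    gcongr ?_ / _
    have : κ + y ≤ Q * (1 + y) := by nlinarith
    calc D ^ 2 * (β * D + G) ^ 2 * (κ + y) ≤ D ^ 2 * (β * D + G) ^ 2 * (Q * (1 + y)) := by gcongr
      _ = _ := by ring
  -- The noise-free part of the second term decays like log n/t² and is absorbed into the 1/t term.
  have e2 : β ^ 2 * D ^ 4 * u / (t : ℝ) ^ 2 ≤ β ^ 2 * D ^ 4 * ((1 + y) / t) := by
    have hy0 : 0 ≤ y := by linarith
    rw [mul_div_assoc']
    gcongr
    · linarith
    · exact le_self_pow₀ ht1 two_ne_zero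
  have e3 : d * D ^ 2 * σ ^ 2 * W * u ^ 2 * u / (t : ℝ) ^ 2
      ≤ 128 * Q * D ^ 2 * (β * D + L) ^ 2 * (s ^ 7 * d / ((t : ℝ) ^ 2 * ε ^ 2)) := by
    calc d * D ^ 2 * σ ^ 2 * W * u ^ 2 * u / (t : ℝ) ^ 2
        = 8 * κ * D ^ 2 * (β * D + L) ^ 2 * d * (m ^ 2 * Real.log (m / δ) * W * u ^ 3)
          / ((t : ℝ) ^ 2 * ε ^ 2) := by
          rw [hσ2]
          field_simp
      _ ≤ 8 * κ * D ^ 2 * (β * D + L) ^ 2 * d * (16 * s ^ 7) / ((t : ℝ) ^ 2 * ε ^ 2) := by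
          gcongr
      _ ≤ 8 * Q * D ^ 2 * (β * D + L) ^ 2 * d * (16 * s ^ 7) / ((t : ℝ) ^ 2 * ε ^ 2) := by
          gcongr
      _ = _ := by ring
  have hQ0 : 0 ≤ Q := by linarith
  have g1 : 0 ≤ 128 * Q * D ^ 2 * (β * D + L) ^ 2 * ((1 + y) / t) := by
    have : 0 ≤ 1 + y := by linarith
    positivity
  have g2 : 0 ≤ (Q * (D ^ 2 * (β * D + G) ^ 2) + β ^ 2 * D ^ 4)
      * (s ^ 7 * d / ((t : ℝ) ^ 2 * ε ^ 2)) := by positivity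
  rw [add_mul (β ^ 2 * D ^ 4), add_div]
  linarith

theorem mainTheorem3 :
    -- the regularity constant and the smooth norm specified for `ℓ_q`
    (∀ (d : ℕ) (p : ℝ≥0∞), 1 ≤ d → 1 < p →
      IsRegularNorm (fun x : Fin d → ℝ => ellNorm (dualExp p) x) (plusNorm p) (kappaQ p d)) ∧
    -- the convergence guarantee, with a universal constant
    (∃ c : ℝ, 0 < c ∧
      ∀ (d n : ℕ) (p : ℝ≥0∞), 1 ≤ d → 1 ≤ n → 1 < p →
      ∀ (X : Type*) [MeasurableSpace X] (P : Measure X) [IsProbabilityMeasure P]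
        (C : Set (Fin d → ℝ)) (f : (Fin d → ℝ) → X → ℝ) (θs : Fin d → ℝ) (D μ β G L γ : ℝ),
      StronglyConvexSCO p C P f θs D μ β G L γ →
      ∀ (N : (Fin d → ℝ) → ℝ) (κ σ : ℝ),
      IsRegularNorm (fun x : Fin d → ℝ => ellNorm (dualExp p) x) N κ → 0 < σ →
      ∀ (argmin : (Fin d → ℝ) → Fin d → ℝ), IsLinearMinimizer C argmin →
      ∀ (Ω : Type*) [MeasurableSpace Ω] (Pr : Measure Ω) [IsProbabilityMeasure Pr]
        (x : ℕ → Ω → X) (Z : ℕ × ℕ → Ω → Fin d → ℝ),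
      IsRandomInput P (generalizedGaussian N σ) n Pr x Z →
      ∀ α : ℝ, 0 < α → α < 1 →
        ENNReal.ofReal (1 - α) ≤ Pr {ω | ∀ t ∈ Finset.Icc 1 n,
          populationLoss P f (dpTOFW C f argmin n (fun i => x i ω) (fun j => Z j ω) t)
              - populationLoss P f θs ≤
            c * (1 / (γ ^ 2 * μ) * (D ^ 2 * (β * D + G) ^ 2 * (κ + Real.log (n / α)) / t)
              + 1 / (γ ^ 2 * μ) * ((β ^ 2 * D ^ 4
                  + d * D ^ 2 * σ ^ 2 * Real.log (n * Real.log n / α) * Real.log n ^ 2)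
                    * Real.log n / (t : ℝ) ^ 2))}) ∧
    -- for `1 < p ≤ 2` and the noise level prescribed by privacy: rate `1/t + d/(t² ε²)` up to logs
    (∀ (p : ℝ≥0∞) (D μ β G L γ : ℝ), 1 < p → p ≤ 2 →
      ∃ c : ℝ, 0 < c ∧
      ∀ (d n : ℕ), 1 ≤ d → 1 ≤ n →
      ∀ (X : Type*) [MeasurableSpace X] (P : Measure X) [IsProbabilityMeasure P]
        (C : Set (Fin d → ℝ)) (f : (Fin d → ℝ) → X → ℝ) (θs : Fin d → ℝ),
      StronglyConvexSCO p C P f θs D μ β G L γ →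
      ∀ (argmin : (Fin d → ℝ) → Fin d → ℝ), IsLinearMinimizer C argmin →
      ∀ (ε δ : ℝ), 0 < ε → 0 < δ → δ < 1 →
      ∀ (Ω : Type*) [MeasurableSpace Ω] (Pr : Measure Ω) [IsProbabilityMeasure Pr]
        (x : ℕ → Ω → X) (Z : ℕ × ℕ → Ω → Fin d → ℝ),
      IsRandomInput P (generalizedGaussian (plusNorm p) (privateSigma p d n ε δ β D L)) n Pr x Z →
      ∀ α : ℝ, 0 < α → α < 1 →
        ENNReal.ofReal (1 - α) ≤ Pr {ω | ∀ t ∈ Finset.Icc 1 n,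
          populationLoss P f (dpTOFW C f argmin n (fun i => x i ω) (fun j => Z j ω) t)
              - populationLoss P f θs ≤
            c * ((1 + Real.log (n / α)) / t
              + (1 + Real.log (n / (α * δ))) ^ 7 * d / ((t : ℝ) ^ 2 * ε ^ 2))}) := by
  refine ⟨fun d p hd hp => isRegularNorm_plusNorm hd hp, ⟨64 * 2304, by norm_num, ?_⟩, ?_⟩
  · intro d n p hd hn hp X _ P _ C f θs D μ β G L γ h N κ σ hreg hσ argmin hargmin Ω _ Pr _ x Z hin
      α hα hα1
    exact h.measure_excess_le hd hn hp hreg hσ hargmin hin hα hα1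
  · intro p D μ β G L γ hp hp2
    set c := 64 * 2304 * (1 / (γ ^ 2 * μ) * (((dualExp p).toReal - 1) * (D ^ 2 * (β * D + G) ^ 2)
      + β ^ 2 * D ^ 4 + 128 * ((dualExp p).toReal - 1) * D ^ 2 * (β * D + L) ^ 2)) with hc
    -- The constant is chosen before the problem hypotheses are available, so the sign of `c` is
    -- unknown and μ or γ could vanish; |c| + 1 is positive in every case.
    refine ⟨|c| + 1, by positivity, ?_⟩
    intro d n hd hn X _ P _ C f θs h argmin hargmin ε δ hε hδ hδ1 Ω _ Pr _ x Z hin α hα hα1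
    refine (h.measure_excess_le_of_privateSigma hd hn hp hp2 hargmin hε hδ hδ1 hin hα hα1).trans
      (measure_mono fun ω hω t ht => (hω t ht).trans ?_)
    rw [← hc]
    have hn1 : (1 : ℝ) ≤ n := by exact_mod_cast hn
    have h1 : 0 ≤ Real.log (n / α) := Real.log_nonneg ((one_le_div hα).2 (hα1.le.trans hn1))
    have h2 : 0 ≤ Real.log (n / (α * δ)) := Real.log_nonneg
      ((one_le_div (by positivity)).2 ((mul_le_one₀ hα1.le hδ.le hδ1.le).trans hn1))
    exact mul_le_mul_of_nonneg_right ((le_abs_self c).trans (by linarith)) (by positivity)
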